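/- Let $S^1=\mathbb R/2\pi\mathbb Z$, let $Q=(S^1)^3$ and let the label space $Q_0$ be a copy of $(S^1)^3$. Let $P\subseteq\mathbb R$ be an open set of densities with $(0,\infty)\subseteq P$ (for instance $P=\mathbb R$). Let $\mathcal L(\mathbf u,\rho,\nabla\rho)$ be a real function that is smooth on $\mathbb R^3\times P\times\mathbb R^3$ and such that $\mathbf u\mapsto\partial\mathcal L/\partial\mathbf u(\mathbf u,\rho,\mathbf w)$ is a diffeomorphism of $\mathbb R^3$ for all $\rho\in P$, $\mathbf w\in\mathbb R^3$. Put $\mathcal H(\mathbf p,\rho,\mathbf w)=\underline{\mathbf u}\cdot\mathbf p-\mathcal L(\underline{\mathbf u},\rho,\mathbf w)$, where $\underline{\mathbf u}=\underline{\mathbf u}(\mathbf p,\rho,\mathbf w)$ is the solution of $\partial\mathcal L/\partial\mathbf u(\underline{\mathbf u},\rho,\mathbf w)=\mathbf p$. Write $(\nabla\cdot T)_j=\partial_iT_{ij}$ and $(\nabla\mathbf h)_{ia}=\partial_ih^a$. The derivatives of $\mathcal H$ below are evaluated at $(\mathbf p,\rho,\nabla\rho)$ and those of $\mathcal L$ at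 $(\mathbf u,\rho,\nabla\rho)$. The LBEP equations for $(\mathbf u,\rho)$ are $\partial_t\rho+\nabla\cdot(\rho\mathbf u)=0$ and $$\partial_t\frac{\partial\mathcal L}{\partial\mathbf u}+\nabla\cdot\Big(\mathbf u\otimes\frac{\partial\mathcal L}{\partial\mathbf u}\Big)=\nabla\cdot\Big(\Big[\rho\frac{\partial\mathcal L}{\partial\rho}-\rho\nabla\cdot\frac{\partial\mathcal L}{\partial\nabla\rho}-\mathcal L\Big]\mathbb I+\frac{\partial\mathcal L}{\partial\nabla\rho}\otimes\nabla\rho\Big).$$ The extended system for $(\mathbf h,\mathbf p,\rho,\chi)$ is $$\partial_t\mathbf h=-\frac{\partial\mathcal H}{\partial\mathbf p}\cdot\nabla\mathbf h,\qquad \partial_t\rho+\nabla\cdot\Big(\rho\frac{\partial\mathcal H}{\partial\mathbf p}\Big)=0,\qquad \partial_t\chi+\frac{\partial\mathcal H}{\partial\mathbf p}\cdot\nabla\chi=\frac{\partial\mathcal H}{\partial\rho}-\nabla\cdot\frac{\partial\mathcal H}{\partial\nabla\rho},$$ $$\partial_t\mathbf p+\nabla\cdot\Big(\frac{\partial\mathcal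 H}{\partial\mathbf p}\otimes\mathbf p+\frac{\partial\mathcal H}{\partial\nabla\rho}\otimes\nabla\rho\Big)=-\nabla\Big(\rho\frac{\partial\mathcal H}{\partial\rho}-\rho\nabla\cdot\frac{\partial\mathcal H}{\partial\nabla\rho}+\mathbf p\cdot\frac{\partial\mathcal H}{\partial\mathbf p}-\mathcal H\Big).$$ Let $\mathcal C_0$ be the set of smooth $(\mathbf h,\mathbf p,\rho,\chi):Q\to Q_0\times\mathbb R^3\times\mathbb R\times\mathbb R$ such that $\mathbf h$ is a diffeomorphism and $\rho>0$. For $t_1<t_2$ and a smooth path $[t_1,t_2]\to\mathcal C_0$ put $$\mathsf A(\mathbf h,\mathbf p,\rho,\chi)=\int_{t_1}^{t_2}\Big(\int_Q\mathbf p\cdot\mathbf v\,d^3x+\int_Q(\partial_t\chi+\mathbf v\cdot\nabla\chi)\rho\,d^3x-\int_Q\mathcal H(\mathbf p,\rho,\nabla\rho)\,d^3x\Big)dt,\qquad \mathbf v=-\partial_t\mathbf h\cdot(\nabla\mathbf h)^{-1}.$$ A path $\Phi$ is critical if $\frac{d}{d\epsilon}\big|_0\mathsf A(\Phi+\epsilon\,\delta\Phi)=0$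 for all smooth $\delta\Phi=(\delta\mathbf h,\delta\mathbf p,\delta\rho,\delta\chi)$ with values in $\mathbb R^3\times\mathbb R^3\times\mathbb R\times\mathbb R$ that vanish at $t_1$ and $t_2$. Then: 1. For all $t_1<t_2$, a smooth path $[t_1,t_2]\to\mathcal C_0$ is critical for $\mathsf A$ if and only if it satisfies the extended system on $[t_1,t_2]$. 2. For all $t_1<t_2$ and every smooth solution $(\mathbf u,\rho)$ of the LBEP equations on $[t_1,t_2]\times Q$ with $\rho>0$ there is a critical path $(\mathbf h,\mathbf p,\rho,\chi)$ of $\mathsf A$ in $\mathcal C_0$, with the same $\rho$, such that $\partial\mathcal L/\partial\mathbf u(\mathbf u,\rho,\nabla\rho)=\mathbf p$. 3. Let $M=Q\times\mathbb R$ and $F=Q_0\times\mathbb R^3\times\mathbb R\times\mathbb R$. The first-order classical field theory whose fields are all smooth $\varphi=(\mathbf h,\mathbf p,\rho,\chi):M\to F$ and whose Lagrangian density is $$\mathfrak L(\varphi,\partial\varphi)=-\partial_t\mathbf h\cdot(\nabla\mathbf h)^{-1}\cdot\mathbf p+\rho\big(\partial_t\chi-\partial_t\mathbf h\cdot(\nabla\mathbf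 h)^{-1}\cdot\nabla\chi\big)-\mathcal H(\mathbf p,\rho,\nabla\rho)$$ is ordinary, that is, its fields include all smooth compactly supported maps $M\to F$. A smooth field $\varphi$ with $\nabla\mathbf h$ invertible and $\rho\in P$ everywhere satisfies the Euler–Lagrange equations $\frac{\partial\mathfrak L}{\partial\varphi^a}=\frac{\partial}{\partial x^\mu}\frac{\partial\mathfrak L}{\partial(\partial_\mu\varphi^a)}$ on $M$ if and only if it satisfies the extended system on $M$. -/

import Mathlib

open Set
open scoped ContDiff Matrix

noncomputable section

namespace EulerPoincare

/-! ### Products of a torus with a vector space, in their natural coordinates -/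

/-- The product of the torus `(S¹)^τ`, where `S¹ = ℝ / 2πℤ`, with the vector space `ℝ^ν`.
Its natural coordinates are indexed by `τ ⊕ ν`. -/
abbrev Mixed (τ ν : Type) : Type := (τ → Real.Angle) × (ν → ℝ)

/-- The translate `x + v` of a point `x` by a coordinate vector `v`. -/
def shift {τ ν : Type} (x : Mixed τ ν) (v : τ ⊕ ν → ℝ) : Mixed τ ν :=
  (fun i => x.1 i + ((v (Sum.inl i) : ℝ) : Real.Angle), fun j => x.2 j + v (Sum.inr j))

/-- The coordinates of `y'` relative to `y`: in a circle factor this is the representative of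
`y' - y` in `(-π, π]`, which is the natural (angle) coordinate around `y`, centred at `y`. -/
def relCoord {κ σ : Type} (y' y : Mixed κ σ) : κ ⊕ σ → ℝ :=
  Sum.elim (fun i => (y'.1 i - y.1 i).toReal) (fun j => y'.2 j - y.2 j)

/-- A map into a normed space is smooth if it is smooth in the natural coordinates
around every point. -/
def SmoothFun {τ ν : Type} [Fintype τ] [Fintype ν]
    {E : Type} [NormedAddCommGroup E] [NormedSpace ℝ E] (f : Mixed τ ν → E) : Prop :=
  ∀ x, ContDiffAt ℝ ∞ (fun v : τ ⊕ ν → ℝ => f (shift x v)) 0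

/-- A map between products of a torus and a vector space is smooth if it is smooth in the
natural coordinates around every point and around its image. -/
def SmoothField {τ ν κ σ : Type} [Fintype τ] [Fintype ν] [Fintype κ] [Fintype σ]
    (φ : Mixed τ ν → Mixed κ σ) : Prop :=
  ∀ x, ContDiffAt ℝ ∞ (fun v : τ ⊕ ν → ℝ => relCoord (φ (shift x v)) (φ x)) 0

/-- The partial derivative `∂f/∂x^μ` of a real function. -/
def pderiv {τ ν : Type} [DecidableEq τ] [DecidableEq ν]
    (μ : τ ⊕ ν) (f : Mixed τ ν → ℝ) (x : Mixed τ ν) : ℝ :=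
  deriv (fun s : ℝ => f (shift x (Pi.single μ s))) 0

/-- The matrix `∂φ(x)` with entries `∂_μ φ^a (x)`, for `φ` with values in a product of a torus
and a vector space. -/
def jet {τ ν κ σ : Type} [DecidableEq τ] [DecidableEq ν]
    (φ : Mixed τ ν → Mixed κ σ) (x : Mixed τ ν) : Matrix (κ ⊕ σ) (τ ⊕ ν) ℝ :=
  Matrix.of fun a μ => deriv (fun s : ℝ => relCoord (φ (shift x (Pi.single μ s))) (φ x) a) 0

theorem shift_zero {τ ν : Type} (x : Mixed τ ν) : shift x 0 = x := by
  ext <;> simp [shift]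

theorem toReal_add_of_abs_lt {a b : Real.Angle}
    (ha : |a.toReal| < Real.pi / 2) (hb : |b.toReal| < Real.pi / 2) :
    (a + b).toReal = a.toReal + b.toReal := by
  rw [abs_lt] at ha hb
  conv_lhs => rw [← a.coe_toReal, ← b.coe_toReal, ← Real.Angle.coe_add]
  rw [Real.Angle.toReal_coe_eq_self_iff]
  constructor <;> linarith [ha.1, ha.2, hb.1, hb.2]

theorem toReal_neg_of_abs_lt {a : Real.Angle} (ha : |a.toReal| < Real.pi / 2) :
    (-a).toReal = -a.toReal := by
  rw [abs_lt] at ha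
  conv_lhs => rw [← a.coe_toReal, ← Real.Angle.coe_neg]
  rw [Real.Angle.toReal_coe_eq_self_iff]
  constructor <;> linarith [ha.1, ha.2, Real.pi_pos]

section Smooth

variable {τ ν κ σ : Type} [Fintype τ] [Fintype ν] [Fintype κ] [Fintype σ]

theorem SmoothField.eventually_abs_lt {φ : Mixed τ ν → Mixed κ σ} (hφ : SmoothField φ)
    (x : Mixed τ ν) :
    ∀ᶠ v : τ ⊕ ν → ℝ in nhds 0, ∀ i : κ,
      |((φ (shift x v)).1 i - (φ x).1 i).toReal| < Real.pi / 2 := by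
  rw [Filter.eventually_all]
  intro i
  have h1 : ContinuousAt (fun v : τ ⊕ ν → ℝ =>
      relCoord (φ (shift x v)) (φ x) (Sum.inl i)) 0 :=
    (continuous_apply (Sum.inl i)).continuousAt.comp (hφ x).continuousAt
  have h2 := h1.abs
  have h3 : |relCoord (φ (shift x 0)) (φ x) (Sum.inl i)| < Real.pi / 2 := by
    simp [relCoord, shift_zero, Real.pi_pos]
  exact h2.eventually_lt_const h3

theorem smoothField_zero : SmoothField (0 : Mixed τ ν → Mixed κ σ) := by
  intro x
  have : (fun v : τ ⊕ ν → ℝ => relCoord ((0 : Mixed τ ν → Mixed κ σ) (shift x v))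
      ((0 : Mixed τ ν → Mixed κ σ) x)) = fun _ => 0 := by
    funext v a
    cases a <;> simp [relCoord]
  rw [this]
  exact contDiffAt_const

theorem SmoothField.add {φ ψ : Mixed τ ν → Mixed κ σ} (hφ : SmoothField φ)
    (hψ : SmoothField ψ) : SmoothField (φ + ψ) := by
  intro x
  refine ((hφ x).add (hψ x)).congr_of_eventuallyEq ?_
  filter_upwards [hφ.eventually_abs_lt x, hψ.eventually_abs_lt x] with v h1 h2
  funext a
  cases a with
  | inl i =>
    simp only [relCoord, Sum.elim_inl, Pi.add_apply, Prod.fst_add]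
    rw [add_sub_add_comm]
    exact toReal_add_of_abs_lt (h1 i) (h2 i)
  | inr j =>
    simp only [relCoord, Sum.elim_inr, Pi.add_apply, Prod.snd_add]
    ring

theorem SmoothField.neg {φ : Mixed τ ν → Mixed κ σ} (hφ : SmoothField φ) :
    SmoothField (-φ) := by
  intro x
  refine (hφ x).neg.congr_of_eventuallyEq ?_
  filter_upwards [hφ.eventually_abs_lt x] with v h1
  funext a
  cases a with
  | inl i =>
    simp only [relCoord, Sum.elim_inl, Pi.neg_apply, Prod.fst_neg]
    rw [neg_sub_neg, ← neg_sub]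
    exact toReal_neg_of_abs_lt (h1 i)
  | inr j =>
    simp only [relCoord, Sum.elim_inr, Pi.neg_apply, Prod.snd_neg]
    ring

/-- The group of all smooth fields. -/
def smoothFields (τ ν κ σ : Type) [Fintype τ] [Fintype ν] [Fintype κ] [Fintype σ] :
    AddSubgroup (Mixed τ ν → Mixed κ σ) where
  carrier := {φ | SmoothField φ}
  zero_mem' := smoothField_zero
  add_mem' := SmoothField.add
  neg_mem' := SmoothField.neg

end Smooth

/-! ### First-order classical field theories -/

/-- A first-order classical field theory: spacetime `M = Mixed τ ν` and fibre `F = Mixed κ σ` are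
products of a torus and a vector space, `fields` is the space of fields (a subgroup of `M → F`,
scalar multiples being meaningless for circle-valued components), and `lagrangian` is the
Lagrangian density on `M × F × D`, with `D` the space of matrices `v^a_μ`. -/
structure FieldTheory (τ ν κ σ : Type) where
  fields : AddSubgroup (Mixed τ ν → Mixed κ σ)
  lagrangian : Mixed τ ν → Mixed κ σ → Matrix (κ ⊕ σ) (τ ⊕ ν) ℝ → ℝ

/-- A field theory is ordinary if its fields include all smooth compactly supported ones. -/
def FieldTheory.IsOrdinary {τ ν κ σ : Type} [Fintype τ] [Fintype ν] [Fintype κ] [Fintype σ]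
    (T : FieldTheory τ ν κ σ) : Prop :=
  ∀ φ : Mixed τ ν → Mixed κ σ, SmoothField φ → HasCompactSupport φ → φ ∈ T.fields

/-- The Euler–Lagrange equations
`∂L/∂φ^a (x, φ, ∂φ) = ∂/∂x^μ (∂L/∂v^a_μ (x, φ, ∂φ))`, for all `a` and at all `x`. -/
def FieldTheory.EulerLagrange {τ ν κ σ : Type} [Fintype τ] [Fintype ν]
    [DecidableEq τ] [DecidableEq ν] [DecidableEq κ] [DecidableEq σ]
    (T : FieldTheory τ ν κ σ) (φ : Mixed τ ν → Mixed κ σ) : Prop :=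
  ∀ (x : Mixed τ ν) (a : κ ⊕ σ),
    deriv (fun s : ℝ => T.lagrangian x (shift (φ x) (Pi.single a s)) (jet φ x)) 0 =
      ∑ μ : τ ⊕ ν, pderiv μ (fun y =>
        deriv (fun s : ℝ => T.lagrangian y (φ y) (jet φ y + Matrix.single a μ s)) 0) x

/-! ### Energy densities and the Legendre transform -/

/-- Vectors in `ℝ³`. -/
abbrev V3 : Type := Fin 3 → ℝ

/-- The torus `Q = (S¹)³`; the label space `Q₀` is a copy of it. -/
abbrev T3 : Type := Fin 3 → Real.Angle

/-- `∂G/∂a`, for a function `G (a, r, w)` of a vector, a density and a density gradient. -/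
def dVec (G : V3 → ℝ → V3 → ℝ) (a : V3) (r : ℝ) (w : V3) : V3 :=
  fun i => deriv (fun s : ℝ => G (a + Pi.single i s) r w) 0

/-- `∂G/∂ρ`. -/
def dRho (G : V3 → ℝ → V3 → ℝ) (a : V3) (r : ℝ) (w : V3) : ℝ :=
  deriv (fun s : ℝ => G a s w) r

/-- `∂G/∂∇ρ`. -/
def dGrad (G : V3 → ℝ → V3 → ℝ) (a : V3) (r : ℝ) (w : V3) : V3 :=
  fun i => deriv (fun s : ℝ => G a r (w + Pi.single i s)) 0

/-- Diffeomorphisms of `ℝ³`. -/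
def IsDiffeoV3 (f : V3 → V3) : Prop :=
  ContDiff ℝ ∞ f ∧ ∃ g : V3 → V3, ContDiff ℝ ∞ g ∧
    Function.LeftInverse g f ∧ Function.RightInverse g f

/-- `L (u, ρ, ∇ρ)` is an Euler–Poincaré Lagrange density on the set `P` of densities: it is smooth
and `u ↦ ∂L/∂u (u, ρ, ∇ρ)` is a diffeomorphism of `ℝ³` for all `ρ ∈ P` and all `∇ρ`. -/
structure IsEPDensity (P : Set ℝ) (L : V3 → ℝ → V3 → ℝ) : Prop where
  smooth : ContDiffOn ℝ ∞ (fun z : V3 × ℝ × V3 => L z.1 z.2.1 z.2.2) (univ ×ˢ P ×ˢ univ)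
  legendre : ∀ r ∈ P, ∀ w : V3, IsDiffeoV3 (fun u => dVec L u r w)

/-- The velocity `u(p, ρ, ∇ρ)` determined by `∂L/∂u (u(p, ρ, ∇ρ), ρ, ∇ρ) = p`. -/
def legendreVelocity (L : V3 → ℝ → V3 → ℝ) (p : V3) (r : ℝ) (w : V3) : V3 :=
  Function.invFun (fun u => dVec L u r w) p

/-- The Hamiltonian density `H(p, ρ, ∇ρ) = u · p - L(u, ρ, ∇ρ)` at `u = u(p, ρ, ∇ρ)`. -/
def hamiltonian (L : V3 → ℝ → V3 → ℝ) (p : V3) (r : ℝ) (w : V3) : ℝ :=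
  legendreVelocity L p r w ⬝ᵥ p - L (legendreVelocity L p r w) r w

/-! ### Fields on `Q × ℝ` -/

/-- Spacetime `M = Q × ℝ`; a point is `(x, t)`. -/
abbrev M : Type := Mixed (Fin 3) Unit

/-- The fibre `F = Q₀ × ℝ³ × ℝ × ℝ`, with coordinates `(h, p, ρ, χ)`. -/
abbrev F : Type := Mixed (Fin 3) (Fin 3 ⊕ Unit ⊕ Unit)

/-- The index of the coordinate `h^a` of `F`. -/
abbrev ixH (a : Fin 3) : Fin 3 ⊕ (Fin 3 ⊕ Unit ⊕ Unit) := Sum.inl a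
/-- The index of the coordinate `ρ` of `F`. -/
abbrev ixRho : Fin 3 ⊕ (Fin 3 ⊕ Unit ⊕ Unit) := Sum.inr (Sum.inr (Sum.inl ()))
/-- The index of the coordinate `χ` of `F`. -/
abbrev ixChi : Fin 3 ⊕ (Fin 3 ⊕ Unit ⊕ Unit) := Sum.inr (Sum.inr (Sum.inr ()))
/-- The index of the spatial coordinate `x^i` of `M`. -/
abbrev ixSpace (i : Fin 3) : Fin 3 ⊕ Unit := Sum.inl i
/-- The index of the time coordinate of `M`. -/
abbrev ixTime : Fin 3 ⊕ Unit := Sum.inr ()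

/-- The point `(x, t)` of `M`. -/
def at_ (x : T3) (t : ℝ) : M := (x, fun _ => t)

/-- The time coordinate of a point of `M`. -/
def timeOf (y : M) : ℝ := y.2 ()

/-! The components `h`, `p`, `ρ`, `χ` of a point of `F`. -/
def hOf (y : F) : T3 := y.1
def pOf (y : F) : V3 := fun j => y.2 (Sum.inl j)
def rhoOf (y : F) : ℝ := y.2 (Sum.inr (Sum.inl ()))
def chiOf (y : F) : ℝ := y.2 (Sum.inr (Sum.inr ()))

/-- The time derivative. -/
def dt (f : M → ℝ) (x : M) : ℝ := pderiv ixTime f x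

/-- The spatial gradient. -/
def grad (f : M → ℝ) (x : M) : V3 := fun i => pderiv (ixSpace i) f x

/-- The spatial divergence of a vector field. -/
def div (f : M → V3) (x : M) : ℝ := ∑ i, pderiv (ixSpace i) (fun y => f y i) x

/-- The spatial divergence of a tensor field, `(∇ · T)_j = ∂_i T_ij`. -/
def divT (T : M → Matrix (Fin 3) (Fin 3) ℝ) (x : M) : V3 :=
  fun j => ∑ i, pderiv (ixSpace i) (fun y => T y i j) x

/-- The time derivative of the back-to-labels map, read off from `∂φ`. -/
def dtH (J : Matrix (Fin 3 ⊕ (Fin 3 ⊕ Unit ⊕ Unit)) (Fin 3 ⊕ Unit) ℝ) : V3 :=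
  fun a => J (ixH a) ixTime

/-- The matrix `∇h` with entries `(∇h)_ia = ∂_i h^a`, read off from `∂φ`. -/
def gradH (J : Matrix (Fin 3 ⊕ (Fin 3 ⊕ Unit ⊕ Unit)) (Fin 3 ⊕ Unit) ℝ) :
    Matrix (Fin 3) (Fin 3) ℝ :=
  Matrix.of fun i a => J (ixH a) (ixSpace i)

/-! ### Equations of motion -/

/-- The LBEP equations for `(u, ρ)`, at all times in `I`. -/
def LBEP (L : V3 → ℝ → V3 → ℝ) (I : Set ℝ) (u : M → V3) (ρ : M → ℝ) : Prop :=
  let Lu : M → V3 := fun y => dVec L (u y) (ρ y) (grad ρ y)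
  let Lρ : M → ℝ := fun y => dRho L (u y) (ρ y) (grad ρ y)
  let Lw : M → V3 := fun y => dGrad L (u y) (ρ y) (grad ρ y)
  ∀ x : M, timeOf x ∈ I →
    dt ρ x + div (fun y => ρ y • u y) x = 0 ∧
    ∀ j, dt (fun y => Lu y j) x + divT (fun y => Matrix.vecMulVec (u y) (Lu y)) x j =
      divT (fun y =>
        (ρ y * Lρ y - ρ y * div Lw y - L (u y) (ρ y) (grad ρ y)) •
            (1 : Matrix (Fin 3) (Fin 3) ℝ) +
          Matrix.vecMulVec (Lw y) (grad ρ y)) x j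

/-- The momentum form of the LBEP equations for `(p, ρ)`, at all times in `I`. -/
def MomentumLBEP (H : V3 → ℝ → V3 → ℝ) (I : Set ℝ) (p : M → V3) (ρ : M → ℝ) : Prop :=
  let Hp : M → V3 := fun y => dVec H (p y) (ρ y) (grad ρ y)
  let Hρ : M → ℝ := fun y => dRho H (p y) (ρ y) (grad ρ y)
  let Hw : M → V3 := fun y => dGrad H (p y) (ρ y) (grad ρ y)
  ∀ x : M, timeOf x ∈ I →
    dt ρ x + div (fun y => ρ y • Hp y) x = 0 ∧
    ∀ j, dt (fun y => p y j) x +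
        divT (fun y => Matrix.vecMulVec (Hp y) (p y) + Matrix.vecMulVec (Hw y) (grad ρ y)) x j =
      - grad (fun y => ρ y * Hρ y - ρ y * div Hw y + p y ⬝ᵥ Hp y
          - H (p y) (ρ y) (grad ρ y)) x j

/-- The extended system for `Φ = (h, p, ρ, χ)`, at all times in `I`: the transport equation
`∂_t h = -∂H/∂p · ∇h`, the momentum form of the LBEP equations, and the equation
`∂_t χ + ∂H/∂p · ∇χ = ∂H/∂ρ - ∇ · ∂H/∂∇ρ`. -/
def ExtendedSystem (H : V3 → ℝ → V3 → ℝ) (I : Set ℝ) (Φ : M → F) : Prop :=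
  let p : M → V3 := fun y => pOf (Φ y)
  let ρ : M → ℝ := fun y => rhoOf (Φ y)
  let χ : M → ℝ := fun y => chiOf (Φ y)
  let Hp : M → V3 := fun y => dVec H (p y) (ρ y) (grad ρ y)
  let Hρ : M → ℝ := fun y => dRho H (p y) (ρ y) (grad ρ y)
  let Hw : M → V3 := fun y => dGrad H (p y) (ρ y) (grad ρ y)
  (∀ x : M, timeOf x ∈ I → dtH (jet Φ x) = -(Hp x ᵥ* gradH (jet Φ x))) ∧
  MomentumLBEP H I p ρ ∧
  (∀ x : M, timeOf x ∈ I → dt χ x + Hp x ⬝ᵥ grad χ x = Hρ x - div Hw x)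

/-! ### The phase-space action -/

/-- Smooth self-maps of the torus. -/
def SmoothT3 (f : T3 → T3) : Prop :=
  ∀ x, ContDiffAt ℝ ∞
    (fun v : V3 => fun a => (f (fun i => x i + ((v i : ℝ) : Real.Angle)) a - f x a).toReal) 0

/-- Diffeomorphisms `Q → Q₀`. -/
def IsDiffeoT3 (f : T3 → T3) : Prop :=
  SmoothT3 f ∧ ∃ g : T3 → T3, SmoothT3 g ∧ Function.LeftInverse g f ∧ Function.RightInverse g f

/-- `Φ = (h, p, ρ, χ)` restricts to a smooth path `[t₁, t₂] → C₀`, where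
`C₀ = Diff(Q, Q₀) × X(Q) × C^∞_+(Q) × C^∞(Q)`. As usual, smoothness on the closed interval means
that the path is the restriction of a smooth one; the values of `Φ` outside `[t₁, t₂]` play no
further role. -/
structure IsPath (t₁ t₂ : ℝ) (Φ : M → F) : Prop where
  smooth : SmoothField Φ
  diffeo : ∀ t ∈ Icc t₁ t₂, IsDiffeoT3 (fun x => hOf (Φ (at_ x t)))
  pos : ∀ t ∈ Icc t₁ t₂, ∀ x, 0 < rhoOf (Φ (at_ x t))

/-- The integral over `Q` with respect to `d³x`, computed on the cell `[0, 2π]³`. -/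
def integralQ (f : T3 → ℝ) : ℝ :=
  ∫ y : V3 in Icc 0 (fun _ => 2 * Real.pi), f (fun i => ((y i : ℝ) : Real.Angle))

/-- The velocity `v = -∂_t h · (∇h)⁻¹`. -/
def velocity (Φ : M → F) (x : M) : V3 := -(dtH (jet Φ x) ᵥ* (gradH (jet Φ x))⁻¹)

/-- The phase-space Lagrangian at time `t`,
`∫ p · v d³x + ∫ (∂_t χ + v · ∇χ) ρ d³x - ∫ H(p, ρ, ∇ρ) d³x`. -/
def phaseLagrangian (H : V3 → ℝ → V3 → ℝ) (Φ : M → F) (t : ℝ) : ℝ :=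
  let p : M → V3 := fun y => pOf (Φ y)
  let ρ : M → ℝ := fun y => rhoOf (Φ y)
  let χ : M → ℝ := fun y => chiOf (Φ y)
  let v : M → V3 := velocity Φ
  integralQ (fun x => p (at_ x t) ⬝ᵥ v (at_ x t)) +
    integralQ (fun x => (dt χ (at_ x t) + v (at_ x t) ⬝ᵥ grad χ (at_ x t)) * ρ (at_ x t)) -
    integralQ (fun x => H (p (at_ x t)) (ρ (at_ x t)) (grad ρ (at_ x t)))

/-- The phase-space action on paths over `[t₁, t₂]`. -/
def action (H : V3 → ℝ → V3 → ℝ) (t₁ t₂ : ℝ) (Φ : M → F) : ℝ :=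
  ∫ t in t₁..t₂, phaseLagrangian H Φ t

/-- The varied path `Φ + δ`, where `δ = (δh, δp, δρ, δχ)` has real components. -/
def vary (Φ : M → F) (δ : M → (Fin 3 ⊕ (Fin 3 ⊕ Unit ⊕ Unit) → ℝ)) : M → F :=
  fun x => shift (Φ x) (δ x)

/-- `Φ` is a critical point of the action with fixed endpoints: `d/dε|₀ A(Φ + ε δΦ) = 0` for all
smooth variations `δΦ = (δh, δp, δρ, δχ)` that vanish at times `t₁` and `t₂`. -/
def IsCritical (H : V3 → ℝ → V3 → ℝ) (t₁ t₂ : ℝ) (Φ : M → F) : Prop :=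
  ∀ δ : M → (Fin 3 ⊕ (Fin 3 ⊕ Unit ⊕ Unit) → ℝ), SmoothFun δ →
    (∀ x, δ (at_ x t₁) = 0) → (∀ x, δ (at_ x t₂) = 0) →
    HasDerivAt (fun ε : ℝ => action H t₁ t₂ (vary Φ (ε • δ))) 0 0

/-! ### The field theory -/

/-- The theory on `M = Q × ℝ` of all smooth fields `(h, p, ρ, χ) : M → F` with Lagrangian density
`-∂_t h · (∇h)⁻¹ · p + ρ (∂_t χ - ∂_t h · (∇h)⁻¹ · ∇χ) - H(p, ρ, ∇ρ)`. -/
def epTheory (H : V3 → ℝ → V3 → ℝ) :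
    FieldTheory (Fin 3) Unit (Fin 3) (Fin 3 ⊕ Unit ⊕ Unit) where
  fields := smoothFields (Fin 3) Unit (Fin 3) (Fin 3 ⊕ Unit ⊕ Unit)
  lagrangian := fun _ y J =>
    -((dtH J ᵥ* (gradH J)⁻¹) ⬝ᵥ pOf y) +
      rhoOf y * (J ixChi ixTime -
        (dtH J ᵥ* (gradH J)⁻¹) ⬝ᵥ (fun i : Fin 3 => J ixChi (ixSpace i))) -
      H (pOf y) (rhoOf y) (fun i : Fin 3 => J ixRho (ixSpace i))

end EulerPoincare

end

/-!
The theorem has an algebraic half, which identifies the Euler–Lagrange equations of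
`epTheory H` with the extended system, and an analytic half, which produces the labels `h` and the
potential `χ` belonging to a solution of the LBEP equations.

*Algebra.* Put `v = -∂ₜh · (∇h)⁻¹` and `λ = (∇h)⁻¹ (p + ρ ∇χ)`. Differentiating `v ∇h = -∂ₜh` shows
that `-λ` is the momentum conjugate to `h` (`hasDerivAt_lagrangian`), so the Euler–Lagrange
equations are: transport of `λ` as a density, `v = ∂H/∂p`, the equation for `χ`, and the continuity
equation. Given the last three, `p = ∇h · λ - ρ ∇χ` and the product rule turn the equation for `λ`,
contracted with the invertible matrix `∇h`, into the momentum equation (`transport_momentum`,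
`momentum_flux_eq`, `elResidual_eq_zero_iff_extendedSystem`). This needs no variational argument
and settles the claim about the field theory on `Q × ℝ`.

*First variation.* On a compact time interval, differentiation under the integral sign and
integration by parts on the torus express `d/dε|₀ A(Φ + ε δΦ)` as the integral of `δΦ` against the
Euler–Lagrange expressions (`hasDerivAt_action`). Testing with these expressions themselves, times
a bump function of time, shows that criticality is their vanishing
(`isCritical_iff_extendedSystem`). Along a path `∇h` is invertible because `h` is a diffeomorphism
at each time.

*From LBEP to critical paths.* Since `∂H/∂p`, `∂H/∂ρ`, `∂H/∂∇ρ` are `u`, `-∂L/∂ρ`, `-∂L/∂∇ρ`, the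
momentum `p = ∂L/∂u` solves the momentum form of the LBEP equations (`LBEP.momentumLBEP`). It
remains to solve `∂ₜh + u · ∇h = 0` with `h` a diffeomorphism, and
`∂ₜχ + u · ∇χ = ∂H/∂ρ - ∇ · ∂H/∂∇ρ`. This is done by following trajectories on the universal cover
`ℝ³ × ℝ`, with an extra real coordinate accumulating the source term of `χ`
(`exists_transport`). After a cutoff in time the velocity is globally Lipschitz, being periodic in
space, so its flow exists for all times; the flow is smooth by the implicit function theorem,
applied to the integral equation in a Banach space of curves (`exists_smooth_flow`).
-/

namespace EulerPoincare

/-! ### Calculus of smooth functions on products of a torus with a vector space -/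

section Calculus

set_option linter.unusedSectionVars false
set_option linter.unusedFintypeInType false
set_option linter.unusedDecidableInType false

variable {τ ν κ σ : Type} [Fintype τ] [Fintype ν] [DecidableEq τ] [DecidableEq ν]
  {E : Type} [NormedAddCommGroup E] [NormedSpace ℝ E]

theorem shift_shift (x : Mixed τ ν) (v w : τ ⊕ ν → ℝ) :
    shift (shift x v) w = shift x (v + w) := by
  ext <;> simp [shift, add_assoc]

theorem shift_relCoord (y y' : Mixed τ ν) : shift y (relCoord y' y) = y' := by
  ext <;> simp [shift, relCoord]

/-- Smoothness at a point, in the natural coordinates around it. -/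
def SmoothAt (f : Mixed τ ν → E) (x : Mixed τ ν) : Prop :=
  ContDiffAt ℝ ∞ (fun v : τ ⊕ ν → ℝ => f (shift x v)) 0

/-- Two functions agree in a neighbourhood of `x`. -/
def EqNear {α : Type} (f g : Mixed τ ν → α) (x : Mixed τ ν) : Prop :=
  ∀ᶠ v : τ ⊕ ν → ℝ in nhds 0, f (shift x v) = g (shift x v)

theorem EqNear.eq {α : Type} {f g : Mixed τ ν → α} {x : Mixed τ ν} (h : EqNear f g x) :
    f x = g x := by
  simpa [shift_zero] using h.self_of_nhds

theorem smoothAt_shift_iff {f : Mixed τ ν → E} {x : Mixed τ ν} {v : τ ⊕ ν → ℝ} :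
    SmoothAt f (shift x v) ↔ ContDiffAt ℝ ∞ (fun w => f (shift x w)) v := by
  simp only [SmoothAt, shift_shift]
  constructor
  · intro h
    have h2 : ContDiffAt ℝ ∞ (fun w : τ ⊕ ν → ℝ => w - v) v := contDiffAt_id.sub contDiffAt_const
    have h' : ContDiffAt ℝ ∞ (fun w => f (shift x (v + w))) ((fun w => w - v) v) := by
      simpa using h
    have := ContDiffAt.comp (f := fun w : τ ⊕ ν → ℝ => w - v) v h' h2
    simpa [Function.comp_def] using this
  · intro h
    have h2 : ContDiffAt ℝ ∞ (fun w : τ ⊕ ν → ℝ => v + w) 0 := contDiffAt_const.add contDiffAt_id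
    have h' : ContDiffAt ℝ ∞ (fun w => f (shift x w)) ((fun w => v + w) 0) := by
      simpa using h
    exact h'.comp 0 h2

theorem SmoothAt.congr {f g : Mixed τ ν → E} {x : Mixed τ ν} (hf : SmoothAt f x)
    (h : EqNear g f x) : SmoothAt g x :=
  ContDiffAt.congr_of_eventuallyEq hf h

theorem pderiv_congr {f g : Mixed τ ν → ℝ} {x : Mixed τ ν} (h : EqNear f g x) (μ : τ ⊕ ν) :
    pderiv μ f x = pderiv μ g x := by
  unfold pderiv
  apply Filter.EventuallyEq.deriv_eq
  have hc : ContinuousAt (fun s : ℝ => (Pi.single μ s : τ ⊕ ν → ℝ)) 0 :=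
    (continuous_single (A := fun _ : τ ⊕ ν => ℝ) μ).continuousAt
  rw [ContinuousAt, Pi.single_zero] at hc
  exact hc.eventually h

theorem pderiv_shift_of_differentiableAt {f : Mixed τ ν → ℝ} {x : Mixed τ ν} {v : τ ⊕ ν → ℝ}
    (h : DifferentiableAt ℝ (fun w => f (shift x w)) v) (μ : τ ⊕ ν) :
    HasDerivAt (fun s : ℝ => f (shift (shift x v) (Pi.single μ s)))
      (fderiv ℝ (fun w => f (shift x w)) v (Pi.single μ 1)) 0 := by
  have h1 : HasDerivAt (fun s : ℝ => v + Pi.single μ s) (Pi.single μ (1 : ℝ)) 0 :=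
    (hasDerivAt_single μ (0 : ℝ)).const_add v
  have h2 : HasFDerivAt (fun w => f (shift x w)) (fderiv ℝ (fun w => f (shift x w)) v)
      (v + Pi.single μ (0 : ℝ)) := by simpa using h.hasFDerivAt
  simpa [shift_shift, Function.comp_def] using h2.comp_hasDerivAt (0 : ℝ) h1

theorem SmoothAt.differentiableAt {f : Mixed τ ν → E} {x : Mixed τ ν} (h : SmoothAt f x) :
    DifferentiableAt ℝ (fun v : τ ⊕ ν → ℝ => f (shift x v)) 0 :=
  ContDiffAt.differentiableAt h (by simp)

theorem SmoothAt.eventually_differentiableAt {f : Mixed τ ν → E} {x : Mixed τ ν}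
    (h : SmoothAt f x) :
    ∀ᶠ v in nhds 0, DifferentiableAt ℝ (fun v : τ ⊕ ν → ℝ => f (shift x v)) v := by
  have h1 : ContDiffAt ℝ 1 (fun v : τ ⊕ ν → ℝ => f (shift x v)) 0 := h.of_le (by simp)
  filter_upwards [h1.eventually (by simp)] with v hv using hv.differentiableAt (by simp)

theorem SmoothAt.hasDerivAt {f : Mixed τ ν → ℝ} {x : Mixed τ ν} (h : SmoothAt f x) (μ : τ ⊕ ν) :
    HasDerivAt (fun s : ℝ => f (shift x (Pi.single μ s))) (pderiv μ f x) 0 := by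
  have := pderiv_shift_of_differentiableAt h.differentiableAt μ
  simp only [shift_zero] at this
  exact this.differentiableAt.hasDerivAt

theorem SmoothAt.pderiv_eq_fderiv {f : Mixed τ ν → ℝ} {x : Mixed τ ν} (h : SmoothAt f x)
    (μ : τ ⊕ ν) :
    pderiv μ f x = fderiv ℝ (fun v : τ ⊕ ν → ℝ => f (shift x v)) 0 (Pi.single μ 1) := by
  have := pderiv_shift_of_differentiableAt h.differentiableAt μ
  simp only [shift_zero] at this
  exact this.deriv

theorem SmoothAt.eventually_pderiv_eq {f : Mixed τ ν → ℝ} {x : Mixed τ ν} (h : SmoothAt f x)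
    (μ : τ ⊕ ν) :
    ∀ᶠ v in nhds 0, pderiv μ f (shift x v) =
      fderiv ℝ (fun v : τ ⊕ ν → ℝ => f (shift x v)) v (Pi.single μ 1) := by
  filter_upwards [h.eventually_differentiableAt] with v hv
  exact (pderiv_shift_of_differentiableAt hv μ).deriv

theorem contDiffAt_fderiv_apply {V W : Type*} [NormedAddCommGroup V] [NormedSpace ℝ V]
    [NormedAddCommGroup W] [NormedSpace ℝ W] {G : V → W} {x : V} (h : ContDiffAt ℝ ∞ G x) (e : V) :
    ContDiffAt ℝ ∞ (fun v => fderiv ℝ G v e) x :=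
  (h.fderiv_right (m := ∞) (by simp)).clm_apply contDiffAt_const

/-- Symmetry of second derivatives, in the form used for partial derivatives. -/
theorem fderiv_fderiv_apply_comm {V : Type*} [NormedAddCommGroup V] [NormedSpace ℝ V]
    {G : V → ℝ} {x : V} (h : ContDiffAt ℝ ∞ G x) (e e' : V) :
    fderiv ℝ (fun v => fderiv ℝ G v e) x e' = fderiv ℝ (fun v => fderiv ℝ G v e') x e := by
  have hd : DifferentiableAt ℝ (fderiv ℝ G) x :=
    (h.fderiv_right (m := 1) (by norm_cast)).differentiableAt (by simp)
  have hs : IsSymmSndFDerivAt ℝ G x := h.isSymmSndFDerivAt (by simp; norm_cast)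
  rw [fderiv_clm_apply hd (differentiableAt_const _),
    fderiv_clm_apply hd (differentiableAt_const _)]
  simpa using hs.eq e' e

theorem SmoothAt.smoothAt_pderiv {f : Mixed τ ν → ℝ} {x : Mixed τ ν} (h : SmoothAt f x)
    (μ : τ ⊕ ν) :
    SmoothAt (pderiv μ f) x :=
  (contDiffAt_fderiv_apply h (Pi.single μ 1)).congr_of_eventuallyEq (h.eventually_pderiv_eq μ)

theorem SmoothAt.pderiv_comm {f : Mixed τ ν → ℝ} {x : Mixed τ ν} (h : SmoothAt f x)
    (μ μ' : τ ⊕ ν) :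
    pderiv μ (pderiv μ' f) x =
      pderiv μ' (pderiv μ f) x := by
  rw [(h.smoothAt_pderiv μ').pderiv_eq_fderiv, (h.smoothAt_pderiv μ).pderiv_eq_fderiv,
    Filter.EventuallyEq.fderiv_eq (h.eventually_pderiv_eq μ'),
    Filter.EventuallyEq.fderiv_eq (h.eventually_pderiv_eq μ)]
  exact fderiv_fderiv_apply_comm h _ _

theorem smoothAt_const (c : E) (x : Mixed τ ν) : SmoothAt (fun _ => c) x := contDiffAt_const

theorem SmoothAt.add {f g : Mixed τ ν → E} {x : Mixed τ ν} (hf : SmoothAt f x)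
    (hg : SmoothAt g x) : SmoothAt (fun y => f y + g y) x := ContDiffAt.add hf hg

theorem SmoothAt.sub {f g : Mixed τ ν → E} {x : Mixed τ ν} (hf : SmoothAt f x)
    (hg : SmoothAt g x) : SmoothAt (fun y => f y - g y) x := ContDiffAt.sub hf hg

theorem SmoothAt.neg {f : Mixed τ ν → E} {x : Mixed τ ν} (hf : SmoothAt f x) :
    SmoothAt (fun y => -f y) x := ContDiffAt.neg hf

theorem SmoothAt.mul {f g : Mixed τ ν → ℝ} {x : Mixed τ ν} (hf : SmoothAt f x)
    (hg : SmoothAt g x) : SmoothAt (fun y => f y * g y) x := ContDiffAt.mul hf hg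

theorem SmoothAt.sum {ι : Type} {s : Finset ι} {f : ι → Mixed τ ν → E} {x : Mixed τ ν}
    (hf : ∀ i ∈ s, SmoothAt (f i) x) : SmoothAt (fun y => ∑ i ∈ s, f i y) x :=
  ContDiffAt.sum hf

theorem SmoothAt.dotProduct {ι : Type} [Fintype ι] {f g : Mixed τ ν → ι → ℝ} {x : Mixed τ ν}
    (hf : ∀ i, SmoothAt (fun y => f y i) x) (hg : ∀ i, SmoothAt (fun y => g y i) x) :
    SmoothAt (fun y => f y ⬝ᵥ g y) x :=
  SmoothAt.sum fun i _ => (hf i).mul (hg i)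

theorem smoothAt_pi {ι : Type} [Fintype ι] {f : Mixed τ ν → ι → E} {x : Mixed τ ν} :
    SmoothAt f x ↔ ∀ i, SmoothAt (fun y => f y i) x := contDiffAt_pi

theorem pderiv_const (c : ℝ) (μ : τ ⊕ ν) (x : Mixed τ ν) : pderiv μ (fun _ => c) x = 0 := by
  simp [pderiv]

theorem pderiv_neg (f : Mixed τ ν → ℝ) (μ : τ ⊕ ν) (x : Mixed τ ν) :
    pderiv μ (fun y => -f y) x = -pderiv μ f x := by
  simp [pderiv]

theorem SmoothAt.pderiv_add {f g : Mixed τ ν → ℝ} {x : Mixed τ ν} (hf : SmoothAt f x)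
    (hg : SmoothAt g x) (μ : τ ⊕ ν) : pderiv μ (fun y => f y + g y) x =
      pderiv μ f x + pderiv μ g x :=
  ((hf.hasDerivAt μ).add (hg.hasDerivAt μ)).deriv

theorem SmoothAt.pderiv_sub {f g : Mixed τ ν → ℝ} {x : Mixed τ ν} (hf : SmoothAt f x)
    (hg : SmoothAt g x) (μ : τ ⊕ ν) : pderiv μ (fun y => f y - g y) x =
      pderiv μ f x - pderiv μ g x :=
  ((hf.hasDerivAt μ).sub (hg.hasDerivAt μ)).deriv

theorem SmoothAt.pderiv_mul {f g : Mixed τ ν → ℝ} {x : Mixed τ ν} (hf : SmoothAt f x)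
    (hg : SmoothAt g x) (μ : τ ⊕ ν) : pderiv μ (fun y => f y * g y) x =
      pderiv μ f x * g x + f x * pderiv μ g x := by
  have := ((hf.hasDerivAt μ).fun_mul (hg.hasDerivAt μ)).deriv
  simpa [pderiv, shift_zero] using this

theorem SmoothAt.pderiv_sum {ι : Type} {s : Finset ι} {f : ι → Mixed τ ν → ℝ} {x : Mixed τ ν}
    (hf : ∀ i ∈ s, SmoothAt (f i) x) (μ : τ ⊕ ν) :
    pderiv μ (fun y => ∑ i ∈ s, f i y) x =
      ∑ i ∈ s, pderiv μ (f i) x :=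
  (HasDerivAt.fun_sum fun i hi => (hf i hi).hasDerivAt μ).deriv

theorem SmoothAt.eventually_mem {f : Mixed τ ν → E} {x : Mixed τ ν} (h : SmoothAt f x)
    {U : Set E} (hU : IsOpen U) (hx : f x ∈ U) : ∀ᶠ v in nhds 0, f (shift x v) ∈ U := by
  have hc : ContinuousAt (fun v : τ ⊕ ν → ℝ => f (shift x v)) 0 := ContDiffAt.continuousAt h
  apply hc.eventually
  have : ∀ᶠ y in nhds (f x), y ∈ U := hU.mem_nhds hx
  simpa only [shift_zero] using this

variable [Fintype κ] [Fintype σ]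

/-- Near `x`, the matrix `∂φ` consists of the partial derivatives of the coordinate expression of
`φ` that is centred at `x`. -/
theorem SmoothField.eventually_jet_eq {φ : Mixed τ ν → Mixed κ σ} (hφ : SmoothField φ)
    (x : Mixed τ ν) (a : κ ⊕ σ) (μ : τ ⊕ ν) :
    ∀ᶠ v in nhds 0, jet φ (shift x v) a μ =
      fderiv ℝ (fun v => relCoord (φ (shift x v)) (φ x) a) v (Pi.single μ 1) := by
  have h1 : ContDiffAt ℝ 1 (fun v : τ ⊕ ν → ℝ => relCoord (φ (shift x v)) (φ x)) 0 :=
    (hφ x).of_le (by simp)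
  filter_upwards [h1.eventually (by simp), hφ.eventually_abs_lt x] with v hv hlt
  have hva : ContDiffAt ℝ 1 (fun v : τ ⊕ ν → ℝ => relCoord (φ (shift x v)) (φ x) a) v :=
    contDiffAt_pi.1 hv a
  have hd := pderiv_shift_of_differentiableAt (f := fun y => relCoord (φ y) (φ x) a)
    (hva.differentiableAt (by simp)) μ
  rw [← hd.deriv]
  simp only [jet, Matrix.of_apply]
  refine Eq.trans ?_ (deriv_sub_const (relCoord (φ (shift x v)) (φ x) a))
  apply Filter.EventuallyEq.deriv_eq
  cases a with
  | inr j =>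
    refine Filter.Eventually.of_forall fun s => ?_
    simp [relCoord]
  | inl i =>
    have hc : ContinuousAt (fun s : ℝ => |relCoord (φ (shift (shift x v) (Pi.single μ s)))
        (φ x) (Sum.inl i)|) 0 := hd.continuousAt.abs
    have hlt' : |relCoord (φ (shift (shift x v) (Pi.single μ (0 : ℝ)))) (φ x) (Sum.inl i)|
        < Real.pi / 2 := by
      simpa [relCoord, shift_zero] using hlt i
    filter_upwards [hc.eventually_lt_const hlt'] with s hs
    -- The angle coordinates centred at `φ x` and at `φ (shift x v)` differ by a constant, since the
    -- angles involved are too small for their sum to leave `(-π, π]`.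
    have e : (φ (shift (shift x v) (Pi.single μ s))).1 i - (φ (shift x v)).1 i =
        ((φ (shift (shift x v) (Pi.single μ s))).1 i - (φ x).1 i) +
          -((φ (shift x v)).1 i - (φ x).1 i) := by abel
    simp only [relCoord, Sum.elim_inl] at hs ⊢
    rw [e, toReal_add_of_abs_lt hs, toReal_neg_of_abs_lt (hlt i),
      ← sub_eq_add_neg]
    rw [toReal_neg_of_abs_lt (hlt i), abs_neg]
    exact hlt i

theorem SmoothField.smoothAt_jet {φ : Mixed τ ν → Mixed κ σ} (hφ : SmoothField φ)
    (a : κ ⊕ σ) (μ : τ ⊕ ν) (x : Mixed τ ν) : SmoothAt (fun y => jet φ y a μ) x :=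
  (contDiffAt_fderiv_apply (contDiffAt_pi.1 (hφ x) a) (Pi.single μ 1)).congr_of_eventuallyEq
    (hφ.eventually_jet_eq x a μ)

/-- The rows of `∂φ` are closed one-forms. -/
theorem SmoothField.pderiv_jet_comm {φ : Mixed τ ν → Mixed κ σ} (hφ : SmoothField φ)
    (a : κ ⊕ σ) (μ μ' : τ ⊕ ν) (x : Mixed τ ν) :
    pderiv μ (fun y => jet φ y a μ') x = pderiv μ' (fun y => jet φ y a μ) x := by
  rw [(hφ.smoothAt_jet a μ' x).pderiv_eq_fderiv, (hφ.smoothAt_jet a μ x).pderiv_eq_fderiv,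
    Filter.EventuallyEq.fderiv_eq (hφ.eventually_jet_eq x a μ'),
    Filter.EventuallyEq.fderiv_eq (hφ.eventually_jet_eq x a μ)]
  exact fderiv_fderiv_apply_comm (contDiffAt_pi.1 (hφ x) a) _ _

theorem SmoothField.smoothAt_snd {φ : Mixed τ ν → Mixed κ σ} (hφ : SmoothField φ)
    (j : σ) (x : Mixed τ ν) : SmoothAt (fun y => (φ y).2 j) x := by
  have h := contDiffAt_pi.1 (hφ x) (Sum.inr j)
  have h2 := h.add (contDiffAt_const (c := (φ x).2 j))
  simpa [relCoord, SmoothAt] using h2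

theorem jet_inr (φ : Mixed τ ν → Mixed κ σ) (j : σ) (μ : τ ⊕ ν) (x : Mixed τ ν) :
    jet φ x (Sum.inr j) μ = pderiv μ (fun y => (φ y).2 j) x := by
  simp [jet, relCoord, pderiv]

theorem smoothAt_of_smoothFun {f : Mixed τ ν → E} (h : SmoothFun f) (x : Mixed τ ν) :
    SmoothAt f x := h x

end Calculus

theorem timeOf_shift_space (x : M) (i : Fin 3) (s : ℝ) :
    timeOf (shift x (Pi.single (ixSpace i) s)) = timeOf x := by
  simp [timeOf, shift, ixSpace]

/-- A spatial derivative only depends on the values at the time in question. -/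
theorem pderiv_space_congr {f g : M → ℝ} {x : M} (h : ∀ y, timeOf y = timeOf x → f y = g y)
    (i : Fin 3) : pderiv (ixSpace i) f x = pderiv (ixSpace i) g x := by
  unfold pderiv
  congr 1
  funext s
  exact h _ (timeOf_shift_space x i s)

/-! ### Smooth densities and the Legendre transform -/

/-- `G (a, ρ, ∇ρ)` is smooth at all arguments with density in `P`. -/
def SmoothDensity (P : Set ℝ) (G : V3 → ℝ → V3 → ℝ) : Prop :=
  ∀ (a : V3) (r : ℝ) (w : V3), r ∈ P →
    ContDiffAt ℝ ∞ (fun z : V3 × ℝ × V3 => G z.1 z.2.1 z.2.2) (a, r, w)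

theorem IsEPDensity.smoothDensity {P : Set ℝ} (hP : IsOpen P) {L : V3 → ℝ → V3 → ℝ}
    (hL : IsEPDensity P L) : SmoothDensity P L := fun a r w hr =>
  hL.smooth.contDiffAt ((isOpen_univ.prod (hP.prod isOpen_univ)).mem_nhds (by simp [hr]))

section Density

variable {P : Set ℝ} {G : V3 → ℝ → V3 → ℝ}

theorem dVec_eq_fderiv {a : V3} {r : ℝ} {w : V3}
    (h : DifferentiableAt ℝ (fun z : V3 × ℝ × V3 => G z.1 z.2.1 z.2.2) (a, r, w)) (i : Fin 3) :
    dVec G a r w i =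
      fderiv ℝ (fun z : V3 × ℝ × V3 => G z.1 z.2.1 z.2.2) (a, r, w) (Pi.single i 1, 0, 0) := by
  have h1 : HasDerivAt (fun s : ℝ => ((a + Pi.single i s, r, w) : V3 × ℝ × V3))
      (Pi.single i 1, 0, 0) 0 :=
    ((hasDerivAt_single i (0 : ℝ)).const_add a).prodMk
      ((hasDerivAt_const _ _).prodMk (hasDerivAt_const _ _))
  exact (h.hasFDerivAt.comp_hasDerivAt_of_eq (0 : ℝ) h1 (by simp)).deriv

theorem dRho_eq_fderiv {a : V3} {r : ℝ} {w : V3}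
    (h : DifferentiableAt ℝ (fun z : V3 × ℝ × V3 => G z.1 z.2.1 z.2.2) (a, r, w)) :
    dRho G a r w =
      fderiv ℝ (fun z : V3 × ℝ × V3 => G z.1 z.2.1 z.2.2) (a, r, w) (0, 1, 0) := by
  have h1 : HasDerivAt (fun s : ℝ => ((a, s, w) : V3 × ℝ × V3)) (0, 1, 0) r :=
    (hasDerivAt_const _ _).prodMk ((hasDerivAt_id _).prodMk (hasDerivAt_const _ _))
  have h2 := HasFDerivAt.comp_hasDerivAt r h.hasFDerivAt h1
  simpa [dRho, Function.comp_def] using h2.deriv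

theorem dGrad_eq_fderiv {a : V3} {r : ℝ} {w : V3}
    (h : DifferentiableAt ℝ (fun z : V3 × ℝ × V3 => G z.1 z.2.1 z.2.2) (a, r, w)) (i : Fin 3) :
    dGrad G a r w i =
      fderiv ℝ (fun z : V3 × ℝ × V3 => G z.1 z.2.1 z.2.2) (a, r, w) (0, 0, Pi.single i 1) := by
  have h1 : HasDerivAt (fun s : ℝ => ((a, r, w + Pi.single i s) : V3 × ℝ × V3))
      (0, 0, Pi.single i 1) 0 :=
    (hasDerivAt_const _ _).prodMk ((hasDerivAt_const _ _).prodMk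
      ((hasDerivAt_single i (0 : ℝ)).const_add w))
  exact (h.hasFDerivAt.comp_hasDerivAt_of_eq (0 : ℝ) h1 (by simp)).deriv

theorem fderiv_density_apply {a : V3} {r : ℝ} {w : V3}
    (h : DifferentiableAt ℝ (fun z : V3 × ℝ × V3 => G z.1 z.2.1 z.2.2) (a, r, w))
    (da : V3) (dr : ℝ) (dw : V3) :
    fderiv ℝ (fun z : V3 × ℝ × V3 => G z.1 z.2.1 z.2.2) (a, r, w) (da, dr, dw) =
      dVec G a r w ⬝ᵥ da + dRho G a r w * dr + dGrad G a r w ⬝ᵥ dw := by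
  set D := fderiv ℝ (fun z : V3 × ℝ × V3 => G z.1 z.2.1 z.2.2) (a, r, w) with hD
  have e : ((da, dr, dw) : V3 × ℝ × V3) =
      (∑ i, da i • ((Pi.single i 1, 0, 0) : V3 × ℝ × V3)) + dr • ((0, 1, 0) : V3 × ℝ × V3) +
        ∑ i, dw i • ((0, 0, Pi.single i 1) : V3 × ℝ × V3) := by
    ext j
    · fin_cases j <;> simp [Fin.sum_univ_three]
    · simp [Fin.sum_univ_three]
    · fin_cases j <;> simp [Fin.sum_univ_three]
  rw [e, map_add, map_add, map_sum, map_sum]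
  simp only [map_smul, smul_eq_mul, hD, ← dVec_eq_fderiv h, ← dRho_eq_fderiv h,
    ← dGrad_eq_fderiv h, dotProduct]
  congr 1
  · congr 1
    · exact Finset.sum_congr rfl fun i _ => mul_comm _ _
    · exact mul_comm _ _
  · exact Finset.sum_congr rfl fun i _ => mul_comm _ _

theorem SmoothDensity.differentiableAt (hG : SmoothDensity P G) {r : ℝ} (hr : r ∈ P) (a w : V3) :
    DifferentiableAt ℝ (fun z : V3 × ℝ × V3 => G z.1 z.2.1 z.2.2) (a, r, w) :=
  (hG a r w hr).differentiableAt (by simp)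

theorem SmoothDensity.eventually_differentiableAt (hG : SmoothDensity P G) {r : ℝ} (hr : r ∈ P)
    (a w : V3) : ∀ᶠ z : V3 × ℝ × V3 in nhds (a, r, w),
      DifferentiableAt ℝ (fun z : V3 × ℝ × V3 => G z.1 z.2.1 z.2.2) (z.1, z.2.1, z.2.2) := by
  have h1 : ContDiffAt ℝ 1 (fun z : V3 × ℝ × V3 => G z.1 z.2.1 z.2.2) (a, r, w) :=
    (hG a r w hr).of_le (by simp)
  filter_upwards [h1.eventually (by simp)] with v hv using hv.differentiableAt (by simp)

theorem SmoothDensity.dVec (hG : SmoothDensity P G) (i : Fin 3) :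
    SmoothDensity P (fun a r w => EulerPoincare.dVec G a r w i) := fun a r w hr => by
  refine (contDiffAt_fderiv_apply (hG a r w hr) (Pi.single i 1, 0, 0)).congr_of_eventuallyEq ?_
  filter_upwards [hG.eventually_differentiableAt hr a w] with z hz using dVec_eq_fderiv hz i

theorem SmoothDensity.dRho (hG : SmoothDensity P G) :
    SmoothDensity P (EulerPoincare.dRho G) := fun a r w hr => by
  refine (contDiffAt_fderiv_apply (hG a r w hr) (0, 1, 0)).congr_of_eventuallyEq ?_
  filter_upwards [hG.eventually_differentiableAt hr a w] with z hz using dRho_eq_fderiv hz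

theorem SmoothDensity.dGrad (hG : SmoothDensity P G) (i : Fin 3) :
    SmoothDensity P (fun a r w => EulerPoincare.dGrad G a r w i) := fun a r w hr => by
  refine (contDiffAt_fderiv_apply (hG a r w hr) (0, 0, Pi.single i 1)).congr_of_eventuallyEq ?_
  filter_upwards [hG.eventually_differentiableAt hr a w] with z hz using dGrad_eq_fderiv hz i

theorem SmoothDensity.comp_contDiffAt {E : Type*} [NormedAddCommGroup E] [NormedSpace ℝ E]
    (hG : SmoothDensity P G) {p w : E → V3} {ρ : E → ℝ} {x : E} (hp : ContDiffAt ℝ ∞ p x)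
    (hρ : ContDiffAt ℝ ∞ ρ x) (hw : ContDiffAt ℝ ∞ w x) (hx : ρ x ∈ P) :
    ContDiffAt ℝ ∞ (fun y => G (p y) (ρ y) (w y)) x :=
  ContDiffAt.comp (f := fun y => (p y, ρ y, w y)) x (hG (p x) (ρ x) (w x) hx)
    (hp.prodMk (hρ.prodMk hw))

theorem SmoothDensity.hasDerivAt_comp (hG : SmoothDensity P G) {p w : ℝ → V3} {ρ : ℝ → ℝ}
    {p' w' : V3} {ρ' : ℝ} {s : ℝ} (hp : HasDerivAt p p' s)
    (hρ : HasDerivAt ρ ρ' s) (hw : HasDerivAt w w' s) (hx : ρ s ∈ P) :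
    HasDerivAt (fun y => G (p y) (ρ y) (w y))
      (EulerPoincare.dVec G (p s) (ρ s) (w s) ⬝ᵥ p' + EulerPoincare.dRho G (p s) (ρ s) (w s) * ρ' +
        EulerPoincare.dGrad G (p s) (ρ s) (w s) ⬝ᵥ w') s := by
  have h := hG.differentiableAt hx (p s) (w s)
  rw [← fderiv_density_apply h]
  exact HasFDerivAt.comp_hasDerivAt (f := fun y => (p y, ρ y, w y)) s h.hasFDerivAt
    (hp.prodMk (hρ.prodMk hw))

section Fields

variable {p w : M → V3} {ρ : M → ℝ} {x : M}

theorem SmoothDensity.smoothAt (hG : SmoothDensity P G) (hp : SmoothAt p x)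
    (hρ : SmoothAt ρ x) (hw : SmoothAt w x) (hx : ρ x ∈ P) :
    SmoothAt (fun y => G (p y) (ρ y) (w y)) x :=
  hG.comp_contDiffAt hp hρ hw (by simpa [shift_zero] using hx)

theorem SmoothAt.hasDerivAt_pi {f : M → V3} (hf : SmoothAt f x) (μ : Fin 3 ⊕ Unit) :
    HasDerivAt (fun s : ℝ => f (shift x (Pi.single μ s)))
      (fun i => pderiv μ (fun y => f y i) x) 0 :=
  _root_.hasDerivAt_pi.2 fun i => (smoothAt_pi.1 hf i).hasDerivAt μ

theorem SmoothDensity.pderiv_comp (hG : SmoothDensity P G) (hp : SmoothAt p x)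
    (hρ : SmoothAt ρ x) (hw : SmoothAt w x) (hx : ρ x ∈ P) (μ : Fin 3 ⊕ Unit) :
    pderiv μ (fun y => G (p y) (ρ y) (w y)) x =
      (∑ j, EulerPoincare.dVec G (p x) (ρ x) (w x) j * pderiv μ (fun y => p y j) x) +
        EulerPoincare.dRho G (p x) (ρ x) (w x) * pderiv μ ρ x +
        ∑ j, EulerPoincare.dGrad G (p x) (ρ x) (w x) j * pderiv μ (fun y => w y j) x := by
  have := hG.hasDerivAt_comp (hp.hasDerivAt_pi μ) (hρ.hasDerivAt μ) (hw.hasDerivAt_pi μ)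
    (by simpa [shift_zero] using hx)
  simpa [pderiv, shift_zero, dotProduct] using this.deriv

end Fields

end Density

section Legendre

variable {P : Set ℝ} {L : V3 → ℝ → V3 → ℝ}

theorem IsDiffeoV3.bijective {f : V3 → V3} (hf : IsDiffeoV3 f) : Function.Bijective f := by
  obtain ⟨-, g, -, h1, h2⟩ := hf
  exact ⟨h1.injective, h2.surjective⟩

theorem IsDiffeoV3.isInvertible_fderiv {f : V3 → V3} (hf : IsDiffeoV3 f) (x : V3) :
    (fderiv ℝ f x).IsInvertible := by
  obtain ⟨hf, g, hg, h1, h2⟩ := hf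
  have df : HasFDerivAt f (fderiv ℝ f x) x := (hf.differentiable (by simp) x).hasFDerivAt
  have dg : HasFDerivAt g (fderiv ℝ g (f x)) (f x) :=
    (hg.differentiable (by simp) (f x)).hasFDerivAt
  have df' : HasFDerivAt f (fderiv ℝ f x) (g (f x)) := by rwa [h1 x]
  refine ContinuousLinearMap.IsInvertible.of_inverse (g := fderiv ℝ g (f x)) ?_ ?_
  · have e : f ∘ g = id := funext h2
    have := df'.comp (f x) dg
    rw [e] at this
    exact this.unique (hasFDerivAt_id _)
  · have e : g ∘ f = id := funext h1
    have := dg.comp x df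
    rw [e] at this
    exact this.unique (hasFDerivAt_id _)

theorem IsEPDensity.dVec_legendreVelocity (hL : IsEPDensity P L) {r : ℝ} (hr : r ∈ P)
    (p w : V3) : dVec L (legendreVelocity L p r w) r w = p :=
  Function.invFun_eq (f := fun u => dVec L u r w) ((hL.legendre r hr w).bijective.2 p)

theorem IsEPDensity.legendreVelocity_dVec (hL : IsEPDensity P L) {r : ℝ} (hr : r ∈ P)
    (u w : V3) : legendreVelocity L (dVec L u r w) r w = u :=
  (hL.legendre r hr w).bijective.1 (hL.dVec_legendreVelocity hr _ w)

/-- The velocity depends smoothly on `(p, ρ, ∇ρ)`, by the implicit function theorem. -/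
theorem IsEPDensity.contDiffAt_legendreVelocity (hP : IsOpen P) (hL : IsEPDensity P L)
    (p : V3) (r : ℝ) (w : V3) (hr : r ∈ P) :
    ContDiffAt ℝ ∞ (fun z : V3 × ℝ × V3 => legendreVelocity L z.1 z.2.1 z.2.2) (p, r, w) := by
  set u := legendreVelocity L p r w with hu
  set f : (V3 × ℝ × V3) × V3 → V3 := fun q => dVec L q.2 q.1.2.1 q.1.2.2 - q.1.1 with hf
  have cdf : ContDiffAt ℝ ∞ f ((p, r, w), u) := by
    refine ContDiffAt.sub (contDiffAt_pi.2 fun i => ?_) (by fun_prop)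
    exact ((hL.smoothDensity hP).dVec i).comp_contDiffAt (p := fun q : (V3 × ℝ × V3) × V3 => q.2)
      (ρ := fun q => q.1.2.1) (w := fun q => q.1.2.2) (by fun_prop) (by fun_prop) (by fun_prop) hr
  have hinv : (fderiv ℝ f ((p, r, w), u) ∘L .inr ℝ (V3 × ℝ × V3) V3).IsInvertible := by
    have h1 : HasFDerivAt (fun v : V3 => f ((p, r, w), v))
        (fderiv ℝ f ((p, r, w), u) ∘L .inr ℝ (V3 × ℝ × V3) V3) u :=
      (cdf.differentiableAt (by simp)).hasFDerivAt.comp u (hasFDerivAt_prodMk_right (p, r, w) u)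
    have h2 : HasFDerivAt (fun v : V3 => f ((p, r, w), v))
        (fderiv ℝ (fun v => dVec L v r w) u) u :=
      ((((hL.legendre r hr w).1.differentiable (by simp)) u).hasFDerivAt).sub_const p
    rw [h1.unique h2]
    exact (hL.legendre r hr w).isInvertible_fderiv u
  refine (cdf.contDiffAt_implicitFunction (by simp) hinv).congr_of_eventuallyEq ?_
  have hPev : ∀ᶠ z : V3 × ℝ × V3 in nhds (p, r, w), z.2.1 ∈ P :=
    (continuous_snd.fst.continuousAt).eventually (hP.mem_nhds hr)
  filter_upwards [cdf.eventually_apply_implicitFunction (by simp) hinv, hPev] with z hz hzP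
  have h0 : f ((p, r, w), u) = 0 := by
    simp [hf, hu, hL.dVec_legendreVelocity hr]
  rw [h0] at hz
  have hz' : dVec L (cdf.implicitFunction (by simp) hinv z) z.2.1 z.2.2 = z.1 := sub_eq_zero.1 hz
  rw [← hL.legendreVelocity_dVec hzP (cdf.implicitFunction (by simp) hinv z) z.2.2, hz']

theorem IsEPDensity.smoothDensity_hamiltonian (hP : IsOpen P) (hL : IsEPDensity P L) :
    SmoothDensity P (hamiltonian L) := fun p r w hr => by
  have hv := hL.contDiffAt_legendreVelocity hP p r w hr
  refine ContDiffAt.sub (ContDiffAt.sum fun i _ => ?_) ?_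
  · exact (contDiffAt_pi.1 hv i).mul (by fun_prop)
  · exact (hL.smoothDensity hP).comp_contDiffAt hv (by fun_prop) (by fun_prop) hr

/-- The differential of the Hamiltonian density: the terms containing the derivative of the
velocity cancel, because `∂L/∂u = p`. -/
theorem IsEPDensity.fderiv_hamiltonian (hP : IsOpen P) (hL : IsEPDensity P L) {r : ℝ} (hr : r ∈ P)
    (p w dp : V3) (dr : ℝ) (dw : V3) :
    fderiv ℝ (fun z : V3 × ℝ × V3 => hamiltonian L z.1 z.2.1 z.2.2) (p, r, w) (dp, dr, dw) =
      legendreVelocity L p r w ⬝ᵥ dp - dRho L (legendreVelocity L p r w) r w * dr -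
        dGrad L (legendreVelocity L p r w) r w ⬝ᵥ dw := by
  have hv := ((hL.contDiffAt_legendreVelocity hP p r w hr).differentiableAt (by simp)).hasFDerivAt
  set V := fderiv ℝ (fun z : V3 × ℝ × V3 => legendreVelocity L z.1 z.2.1 z.2.2) (p, r, w)
  have hp : HasDerivAt (fun s : ℝ => p + s • dp) dp 0 := by
    simpa using ((hasDerivAt_id (0 : ℝ)).smul_const dp).const_add p
  have hw : HasDerivAt (fun s : ℝ => w + s • dw) dw 0 := by
    simpa using ((hasDerivAt_id (0 : ℝ)).smul_const dw).const_add w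
  have hr' : HasDerivAt (fun s : ℝ => r + s * dr) dr 0 := by
    simpa using ((hasDerivAt_id (0 : ℝ)).mul_const dr).const_add r
  have hid := hp.prodMk (hr'.prodMk hw)
  have hH := (((hL.smoothDensity_hamiltonian hP) p r w hr).differentiableAt
    (by simp)).hasFDerivAt.comp_hasDerivAt_of_eq (0 : ℝ) hid (by simp)
  have hu : HasDerivAt (fun s : ℝ => legendreVelocity L (p + s • dp) (r + s * dr) (w + s • dw))
      (V (dp, dr, dw)) 0 := hv.comp_hasDerivAt_of_eq (0 : ℝ) hid (by simp)
  have h1 := (hL.smoothDensity hP).hasDerivAt_comp hu hr' hw (by simpa using hr)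
  have h2 : HasDerivAt (fun s : ℝ => legendreVelocity L (p + s • dp) (r + s * dr) (w + s • dw) ⬝ᵥ
      (p + s • dp)) (V (dp, dr, dw) ⬝ᵥ p + legendreVelocity L p r w ⬝ᵥ dp) 0 := by
    have := HasDerivAt.fun_sum (u := Finset.univ) fun (i : Fin 3) _ =>
      (hasDerivAt_pi.1 hu i).fun_mul (hasDerivAt_pi.1 hp i)
    simpa only [dotProduct, Finset.sum_add_distrib, zero_smul, zero_mul, add_zero] using this
  rw [hH.unique (h2.sub h1)]
  simp only [zero_smul, zero_mul, add_zero, hL.dVec_legendreVelocity hr]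
  rw [dotProduct_comm p]
  ring

variable (hP : IsOpen P) (hL : IsEPDensity P L)
include hP hL

theorem IsEPDensity.dVec_hamiltonian {r : ℝ} (hr : r ∈ P) (p w : V3) :
    dVec (hamiltonian L) p r w = legendreVelocity L p r w := by
  funext i
  rw [dVec_eq_fderiv ((hL.smoothDensity_hamiltonian hP).differentiableAt hr p w),
    hL.fderiv_hamiltonian hP hr]
  simp

theorem IsEPDensity.dRho_hamiltonian {r : ℝ} (hr : r ∈ P) (p w : V3) :
    dRho (hamiltonian L) p r w = -dRho L (legendreVelocity L p r w) r w := by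
  rw [dRho_eq_fderiv ((hL.smoothDensity_hamiltonian hP).differentiableAt hr p w),
    hL.fderiv_hamiltonian hP hr]
  simp

theorem IsEPDensity.dGrad_hamiltonian {r : ℝ} (hr : r ∈ P) (p w : V3) :
    dGrad (hamiltonian L) p r w = -dGrad L (legendreVelocity L p r w) r w := by
  funext i
  rw [dGrad_eq_fderiv ((hL.smoothDensity_hamiltonian hP).differentiableAt hr p w),
    hL.fderiv_hamiltonian hP hr]
  simp

end Legendre

/-! ### Partial derivatives of the Lagrangian density -/

theorem contDiffAt_matrix_inv_apply {A₀ : Fin 3 → Fin 3 → ℝ} (h : (Matrix.of A₀).det ≠ 0)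
    (i j : Fin 3) : ContDiffAt ℝ ∞ (fun A : Fin 3 → Fin 3 → ℝ => (Matrix.of A)⁻¹ i j) A₀ := by
  have hdet : ContDiffAt ℝ ∞ (fun A : Fin 3 → Fin 3 → ℝ => (Matrix.of A).det) A₀ := by
    simp only [Matrix.det_fin_three, Matrix.of_apply]
    fun_prop
  simp only [Matrix.inv_def, Ring.inverse_eq_inv', Matrix.smul_apply, smul_eq_mul]
  refine (hdet.inv h).mul ?_
  simp only [Matrix.adjugate_fin_three, Matrix.of_apply]
  fin_cases i <;> fin_cases j <;> simp <;> fun_prop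

theorem contDiffAt_inv_apply {E : Type*} [NormedAddCommGroup E] [NormedSpace ℝ E]
    {B : E → Matrix (Fin 3) (Fin 3) ℝ} {x : E} (hB : ∀ i j, ContDiffAt ℝ ∞ (fun y => B y i j) x)
    (h : (B x).det ≠ 0) (i j : Fin 3) : ContDiffAt ℝ ∞ (fun y => (B y)⁻¹ i j) x :=
  ContDiffAt.comp (g := fun A : Fin 3 → Fin 3 → ℝ => (Matrix.of A)⁻¹ i j)
    (f := fun y i j => B y i j) x (contDiffAt_matrix_inv_apply h i j)
    (contDiffAt_pi.2 fun i => contDiffAt_pi.2 fun j => hB i j)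

/-- The derivative of `T B⁻¹`, obtained by differentiating `(T B⁻¹) B = T`. -/
theorem hasDerivAt_vecMul_inv {T : ℝ → V3} {B : ℝ → Matrix (Fin 3) (Fin 3) ℝ} {T' : V3}
    {B' : Matrix (Fin 3) (Fin 3) ℝ} {s : ℝ} (hT : HasDerivAt T T' s)
    (hB : ∀ i j, HasDerivAt (fun s => B s i j) (B' i j) s) (h : (B s).det ≠ 0) :
    HasDerivAt (fun s => T s ᵥ* (B s)⁻¹) ((T' - (T s ᵥ* (B s)⁻¹) ᵥ* B') ᵥ* (B s)⁻¹) s := by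
  have hBp : HasDerivAt (fun s i j => B s i j) (fun i j => B' i j) s :=
    hasDerivAt_pi.2 fun i => hasDerivAt_pi.2 fun j => hB i j
  have hinv : ∀ i j, DifferentiableAt ℝ (fun s => (B s)⁻¹ i j) s := fun i j =>
    DifferentiableAt.comp (g := fun A : Fin 3 → Fin 3 → ℝ => (Matrix.of A)⁻¹ i j)
      (f := fun y i j => B y i j) s ((contDiffAt_matrix_inv_apply h i j).differentiableAt (by simp))
      hBp.differentiableAt
  have hVd : DifferentiableAt ℝ (fun s => T s ᵥ* (B s)⁻¹) s := by
    refine differentiableAt_pi.2 fun j => ?_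
    change DifferentiableAt ℝ (fun s => ∑ i, T s i * (B s)⁻¹ i j) s
    refine DifferentiableAt.fun_sum fun i _ => ?_
    exact ((hasDerivAt_pi.1 hT i).differentiableAt).mul (hinv i j)
  obtain ⟨V', hV'⟩ : ∃ V', HasDerivAt (fun s => T s ᵥ* (B s)⁻¹) V' s := ⟨_, hVd.hasDerivAt⟩
  have hdet : ContinuousAt (fun s => (B s).det) s := by
    simp only [Matrix.det_fin_three]
    have := fun i j => (hB i j).continuousAt
    fun_prop
  have hev : (fun s => (T s ᵥ* (B s)⁻¹) ᵥ* B s) =ᶠ[nhds s] T := by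
    filter_upwards [hdet.eventually_ne h] with s hs
    rw [Matrix.vecMul_vecMul, Matrix.nonsing_inv_mul _ (isUnit_iff_ne_zero.2 hs),
      Matrix.vecMul_one]
  have hprod : HasDerivAt (fun s => (T s ᵥ* (B s)⁻¹) ᵥ* B s)
      (V' ᵥ* B s + (T s ᵥ* (B s)⁻¹) ᵥ* B') s := by
    refine hasDerivAt_pi.2 fun j => ?_
    have := HasDerivAt.fun_sum (u := Finset.univ) fun (i : Fin 3) _ =>
      (hasDerivAt_pi.1 hV' i).fun_mul (hB i j)
    exact this.congr_deriv Finset.sum_add_distrib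
  have e := hprod.unique (hT.congr_of_eventuallyEq hev)
  have e2 : (T' - (T s ᵥ* (B s)⁻¹) ᵥ* B') ᵥ* (B s)⁻¹ = V' := by
    rw [← e, add_sub_cancel_right, Matrix.vecMul_vecMul,
      Matrix.mul_nonsing_inv _ (isUnit_iff_ne_zero.2 h), Matrix.vecMul_one]
  rw [e2]
  exact hV'

/-- The gradient of a non-circle component, read off from `∂φ`. -/
def gradOf (j : Fin 3 ⊕ Unit ⊕ Unit) (J : Matrix (Fin 3 ⊕ (Fin 3 ⊕ Unit ⊕ Unit)) (Fin 3 ⊕ Unit) ℝ) :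
    V3 := fun i => J (Sum.inr j) (ixSpace i)

/-- The velocity `-∂_t h · (∇h)⁻¹`, read off from `∂φ`. -/
noncomputable def velOf (J : Matrix (Fin 3 ⊕ (Fin 3 ⊕ Unit ⊕ Unit)) (Fin 3 ⊕ Unit) ℝ) : V3 :=
  -(dtH J ᵥ* (gradH J)⁻¹)

/-- The momentum `λ = (∇h)⁻¹ (p + ρ ∇χ)` in label coordinates; `-λ` is conjugate to `h`. -/
noncomputable def labelMomentum (y : F)
    (J : Matrix (Fin 3 ⊕ (Fin 3 ⊕ Unit ⊕ Unit)) (Fin 3 ⊕ Unit) ℝ) : V3 :=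
  (gradH J)⁻¹ *ᵥ (pOf y + rhoOf y • gradOf (Sum.inr (Sum.inr ())) J)

/-- The partial derivatives `∂L/∂φ^a` of the Lagrangian density of `epTheory H`. -/
noncomputable def elField (H : V3 → ℝ → V3 → ℝ) (y : F)
    (J : Matrix (Fin 3 ⊕ (Fin 3 ⊕ Unit ⊕ Unit)) (Fin 3 ⊕ Unit) ℝ) :
    Fin 3 ⊕ (Fin 3 ⊕ Unit ⊕ Unit) → ℝ :=
  Sum.elim (fun _ => 0) (Sum.elim
    (fun i => velOf J i - dVec H (pOf y) (rhoOf y) (gradOf (Sum.inr (Sum.inl ())) J) i)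
    (Sum.elim
      (fun _ => J ixChi ixTime + velOf J ⬝ᵥ gradOf (Sum.inr (Sum.inr ())) J -
        dRho H (pOf y) (rhoOf y) (gradOf (Sum.inr (Sum.inl ())) J))
      (fun _ => 0)))

/-- The partial derivatives `∂L/∂v^a_μ` of the Lagrangian density of `epTheory H`. -/
noncomputable def elMomentum (H : V3 → ℝ → V3 → ℝ) (y : F)
    (J : Matrix (Fin 3 ⊕ (Fin 3 ⊕ Unit ⊕ Unit)) (Fin 3 ⊕ Unit) ℝ) :
    Fin 3 ⊕ (Fin 3 ⊕ Unit ⊕ Unit) → Fin 3 ⊕ Unit → ℝ :=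
  Sum.elim (fun b => Sum.elim (fun j => -(velOf J j * labelMomentum y J b))
      (fun _ => -labelMomentum y J b))
    (Sum.elim (fun _ _ => 0)
    (Sum.elim
      (fun _ => Sum.elim
        (fun j => -dGrad H (pOf y) (rhoOf y) (gradOf (Sum.inr (Sum.inl ())) J) j) (fun _ => 0))
      (fun _ => Sum.elim (fun j => rhoOf y * velOf J j) (fun _ => rhoOf y))))

section Derivative

variable {P : Set ℝ} {H : V3 → ℝ → V3 → ℝ}

/-- The differential of the Lagrangian density along a line in `F × D`. It is computed in all
directions at once, so that it serves both for the Euler–Lagrange equations and for the first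
variation of the action. -/
theorem hasDerivAt_lagrangian (hH : SmoothDensity P H) (x : M) {y : F}
    {J : Matrix (Fin 3 ⊕ (Fin 3 ⊕ Unit ⊕ Unit)) (Fin 3 ⊕ Unit) ℝ}
    (hdet : (gradH J).det ≠ 0) (hρ : rhoOf y ∈ P) (δ : Fin 3 ⊕ (Fin 3 ⊕ Unit ⊕ Unit) → ℝ)
    (K : Matrix (Fin 3 ⊕ (Fin 3 ⊕ Unit ⊕ Unit)) (Fin 3 ⊕ Unit) ℝ) :
    HasDerivAt (fun s : ℝ => (epTheory H).lagrangian x (shift y (s • δ)) (J + s • K))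
      (∑ a, elField H y J a * δ a + ∑ a, ∑ μ, elMomentum H y J a μ * K a μ) 0 := by
  have hlin : ∀ c d : ℝ, HasDerivAt (fun s : ℝ => c + s * d) d 0 := fun c d => by
    simpa using ((hasDerivAt_id (0 : ℝ)).mul_const d).const_add c
  have hT : HasDerivAt (fun s : ℝ => dtH (J + s • K)) (dtH K) 0 :=
    hasDerivAt_pi.2 fun i => hlin (J (ixH i) ixTime) (K (ixH i) ixTime)
  have hB : ∀ i j, HasDerivAt (fun s : ℝ => gradH (J + s • K) i j) (gradH K i j) 0 :=
    fun i j => hlin (J (ixH j) (ixSpace i)) (K (ixH j) (ixSpace i))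
  have hV := hasDerivAt_vecMul_inv hT hB (by simpa using hdet)
  have hp : HasDerivAt (fun s : ℝ => pOf (shift y (s • δ)))
      (fun i => δ (Sum.inr (Sum.inl i))) 0 :=
    hasDerivAt_pi.2 fun i => hlin (pOf y i) _
  have hr : HasDerivAt (fun s : ℝ => rhoOf (shift y (s • δ)))
      (δ ixRho) 0 := hlin (rhoOf y) _
  have hg : ∀ j, HasDerivAt (fun s : ℝ => gradOf j (J + s • K)) (gradOf j K) 0 := fun j =>
    hasDerivAt_pi.2 fun i => hlin (gradOf j J i) (gradOf j K i)
  have hXt : HasDerivAt (fun s : ℝ => (J + s • K) ixChi ixTime) (K ixChi ixTime) 0 :=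
    hlin _ _
  have hdot : ∀ {f g : ℝ → V3} {f' g' : V3}, HasDerivAt f f' 0 → HasDerivAt g g' 0 →
      HasDerivAt (fun s => f s ⬝ᵥ g s) (f' ⬝ᵥ g 0 + f 0 ⬝ᵥ g') 0 := by
    intro f g f' g' hf hg
    have := HasDerivAt.fun_sum (u := Finset.univ) fun (i : Fin 3) _ =>
      (hasDerivAt_pi.1 hf i).fun_mul (hasDerivAt_pi.1 hg i)
    simpa only [dotProduct, Finset.sum_add_distrib] using this
  have hHd := hH.hasDerivAt_comp hp hr (hg (Sum.inr (Sum.inl ())))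
    (by simpa [rhoOf, shift] using hρ)
  have key := ((hdot hV hp).neg.add
    (hr.mul (hXt.sub (hdot hV (hg (Sum.inr (Sum.inr ()))))))).sub hHd
  refine key.congr_deriv ?_
  -- All terms containing `w (∇h)⁻¹` combine to `w · λ`.
  have e0 : ∀ w : V3, w ᵥ* (gradH J)⁻¹ ⬝ᵥ pOf y +
      rhoOf y * (w ᵥ* (gradH J)⁻¹ ⬝ᵥ gradOf (Sum.inr (Sum.inr ())) J) =
      w ⬝ᵥ labelMomentum y J := fun w => by
    rw [labelMomentum, Matrix.dotProduct_mulVec, dotProduct_add, dotProduct_smul, smul_eq_mul]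
  have e1 := e0 (dtH K - (dtH J ᵥ* (gradH J)⁻¹) ᵥ* gradH K)
  simp only [Pi.sub_apply, zero_smul, add_zero, shift_zero] at e1 ⊢
  set v := dtH J ᵥ* (gradH J)⁻¹ with hv
  set V' := (dtH K - v ᵥ* gradH K) ᵥ* (gradH J)⁻¹ with hV'
  have hvel : velOf J = -v := rfl
  have e2 : (dtH K - v ᵥ* gradH K) ⬝ᵥ labelMomentum y J =
      ∑ b, K (ixH b) ixTime * labelMomentum y J b -
        ∑ b, ∑ j, v j * K (ixH b) (ixSpace j) * labelMomentum y J b := by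
    simp only [dotProduct, Pi.sub_apply, sub_mul, Finset.sum_sub_distrib, Matrix.vecMul,
      Finset.sum_mul]
    rfl
  rw [e2] at e1
  simp only [Fintype.sum_sum_type, elField, elMomentum, hvel, Sum.elim_inl, Sum.elim_inr,
    Finset.univ_unique, Finset.sum_singleton, dotProduct, Fin.sum_univ_three, Pi.neg_apply,
    PUnit.default_eq_unit, gradOf] at e1 ⊢
  linear_combination -e1

theorem deriv_lagrangian_field (hH : SmoothDensity P H) (x : M) {y : F}
    {J : Matrix (Fin 3 ⊕ (Fin 3 ⊕ Unit ⊕ Unit)) (Fin 3 ⊕ Unit) ℝ}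
    (hdet : (gradH J).det ≠ 0) (hρ : rhoOf y ∈ P) (a : Fin 3 ⊕ (Fin 3 ⊕ Unit ⊕ Unit)) :
    deriv (fun s : ℝ => (epTheory H).lagrangian x (shift y (Pi.single a s)) J) 0 =
      elField H y J a := by
  have h := (hasDerivAt_lagrangian hH x hdet hρ (Pi.single a 1) 0).deriv
  simpa [← Pi.single_smul, Pi.single_apply] using h

theorem deriv_lagrangian_jet (hH : SmoothDensity P H) (x : M) {y : F}
    {J : Matrix (Fin 3 ⊕ (Fin 3 ⊕ Unit ⊕ Unit)) (Fin 3 ⊕ Unit) ℝ}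
    (hdet : (gradH J).det ≠ 0) (hρ : rhoOf y ∈ P) (a : Fin 3 ⊕ (Fin 3 ⊕ Unit ⊕ Unit))
    (μ : Fin 3 ⊕ Unit) :
    deriv (fun s : ℝ => (epTheory H).lagrangian x y (J + Matrix.single a μ s)) 0 =
      elMomentum H y J a μ := by
  have h := (hasDerivAt_lagrangian hH x hdet hρ 0 (Matrix.single a μ 1)).deriv
  have e : ∑ a', ∑ μ', elMomentum H y J a' μ' * (Matrix.single a μ (1 : ℝ)) a' μ' =
      elMomentum H y J a μ := by
    rw [Finset.sum_eq_single a, Finset.sum_eq_single μ]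
    · simp
    · intro b _ hb
      rw [Matrix.single_apply_of_col_ne _ _ hb.symm]
      simp
    · simp
    · intro b _ hb
      refine Finset.sum_eq_zero fun c _ => ?_
      rw [Matrix.single_apply_of_row_ne hb.symm]
      simp
    · simp
  rw [e] at h
  simpa [shift_zero] using h

end Derivative

/-! ### The Euler–Lagrange equations and the extended system -/

/-- If `p + ρ ∇χ = λ_b ∇h^b`, where `h` is transported by `v`, `ρ` is a density transported by `v`
and `χ` has material derivative `S`, then transport of `λ` as a density is transport of `p` up to
the force `-p_j ∇v_j - ρ ∇S`. Here `B i b = ∂_i h^b` and `T b = ∂_t h^b`. -/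
theorem transport_momentum {p v l T : M → V3} {ρ χ S : M → ℝ} {B : Fin 3 → Fin 3 → M → ℝ} {x : M}
    (hv : ∀ j, SmoothAt (fun y => v y j) x) (hl : ∀ j, SmoothAt (fun y => l y j) x)
    (hB : ∀ i b, SmoothAt (B i b) x) (hρ : SmoothAt ρ x) (hχ : SmoothAt χ x)
    (hp : ∀ i, EqNear (fun y => p y i)
      (fun y => (∑ b, l y b * B i b y) - ρ y * pderiv (ixSpace i) χ y) x)
    (hBt : ∀ i b, pderiv ixTime (B i b) x = pderiv (ixSpace i) (fun y => T y b) x)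
    (hBB : ∀ i j b, pderiv (ixSpace i) (B j b) x = pderiv (ixSpace j) (B i b) x)
    (hT : ∀ y, timeOf y = timeOf x → ∀ b, T y b = -∑ j, v y j * B j b y)
    (hc : dt ρ x + div (fun y => ρ y • v y) x = 0)
    (hS : ∀ y, timeOf y = timeOf x → dt χ y + v y ⬝ᵥ grad χ y = S y) (i : Fin 3) :
    dt (fun y => p y i) x + ∑ j, pderiv (ixSpace j) (fun y => v y j * p y i) x =
      (∑ b, (dt (fun y => l y b) x + ∑ j, pderiv (ixSpace j) (fun y => v y j * l y b) x) *
          B i b x) -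
        (∑ j, p x j * pderiv (ixSpace i) (fun y => v y j) x) -
        ρ x * pderiv (ixSpace i) S x := by
  have hχi : ∀ μ, SmoothAt (pderiv μ χ) x := hχ.smoothAt_pderiv
  have hlB : ∀ i b, SmoothAt (fun y => l y b * B i b y) x := fun i b => (hl b).mul (hB i b)
  have hps : ∀ i, SmoothAt (fun y => p y i) x := fun i =>
    ((SmoothAt.sum fun b _ => hlB i b).sub (hρ.mul (hχi _))).congr (hp i)
  have hpd : ∀ μ, pderiv μ (fun y => p y i) x =
      (∑ b, (pderiv μ (fun y => l y b) x * B i b x + l x b * pderiv μ (B i b) x)) -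
        (pderiv μ ρ x * pderiv (ixSpace i) χ x + ρ x * pderiv μ (pderiv (ixSpace i) χ) x) := by
    intro μ
    rw [pderiv_congr (hp i) μ, (SmoothAt.sum fun b _ => hlB i b).pderiv_sub (hρ.mul (hχi _)),
      SmoothAt.pderiv_sum (fun b _ => hlB i b), hρ.pderiv_mul (hχi _)]
    congr 1
    exact Finset.sum_congr rfl fun b _ => (hl b).pderiv_mul (hB i b) μ
  have hTd : ∀ b, pderiv (ixSpace i) (fun y => T y b) x =
      -∑ j, (pderiv (ixSpace i) (fun y => v y j) x * B j b x +
        v x j * pderiv (ixSpace i) (B j b) x) := by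
    intro b
    rw [pderiv_space_congr (fun y hy => hT y hy b), pderiv_neg,
      SmoothAt.pderiv_sum (fun j _ => (hv j).mul (hB j b))]
    congr 1
    exact Finset.sum_congr rfl fun j _ => (hv j).pderiv_mul (hB j b) _
  have hSd : pderiv (ixSpace i) S x = pderiv (ixSpace i) (pderiv ixTime χ) x +
      ∑ j, (pderiv (ixSpace i) (fun y => v y j) x * pderiv (ixSpace j) χ x +
        v x j * pderiv (ixSpace i) (pderiv (ixSpace j) χ) x) := by
    rw [pderiv_space_congr (fun y hy => (hS y hy).symm)]
    simp only [dt, dotProduct, grad]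
    rw [(hχi _).pderiv_add (SmoothAt.sum fun j _ => (hv j).mul (hχi _)),
      SmoothAt.pderiv_sum (fun j _ => (hv j).mul (hχi _))]
    congr 1
    exact Finset.sum_congr rfl fun j _ => (hv j).pderiv_mul (hχi _) _
  have hcd : dt ρ x + ∑ j, (pderiv (ixSpace j) ρ x * v x j +
      ρ x * pderiv (ixSpace j) (fun y => v y j) x) = 0 := by
    rw [← hc]
    congr 1
    exact Finset.sum_congr rfl fun j _ => (hρ.pderiv_mul (hv j) _).symm
  have hvp : ∀ j, pderiv (ixSpace j) (fun y => v y j * p y i) x =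
      pderiv (ixSpace j) (fun y => v y j) x * p x i +
        v x j * pderiv (ixSpace j) (fun y => p y i) x := fun j => (hv j).pderiv_mul (hps i) _
  have hvl : ∀ j b, pderiv (ixSpace j) (fun y => v y j * l y b) x =
      pderiv (ixSpace j) (fun y => v y j) x * l x b +
        v x j * pderiv (ixSpace j) (fun y => l y b) x := fun j b => (hv j).pderiv_mul (hl b) _
  have hpx : ∀ i, p x i = (∑ b, l x b * B i b x) - ρ x * pderiv (ixSpace i) χ x :=
    fun i => (hp i).eq
  simp only [hvp, hvl, dt, hpd, hBt, hTd, hSd, hpx, hχ.pderiv_comm ixTime (ixSpace i),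
    fun j => hχ.pderiv_comm (ixSpace j) (ixSpace i), fun j b => hBB j i b]
  simp only [dt, Fin.sum_univ_three] at hcd ⊢
  -- What is left after inserting the other equations is `-∂ᵢχ` times the continuity equation.
  linear_combination (-pderiv (ixSpace i) χ x) * hcd

/-- The pressure gradient of the momentum equation, by the chain rule for `H (p, ρ, ∇ρ)`. -/
theorem momentum_flux_eq {P : Set ℝ} {H : V3 → ℝ → V3 → ℝ} (hH : SmoothDensity P H)
    {p : M → V3} {ρ : M → ℝ} {x : M} (hp : SmoothAt p x) (hρ : SmoothAt ρ x) (hx : ρ x ∈ P)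
    (i : Fin 3) :
    let Hp : M → V3 := fun y => dVec H (p y) (ρ y) (grad ρ y)
    let Hρ : M → ℝ := fun y => dRho H (p y) (ρ y) (grad ρ y)
    let Hw : M → V3 := fun y => dGrad H (p y) (ρ y) (grad ρ y)
    divT (fun y => Matrix.vecMulVec (Hp y) (p y) + Matrix.vecMulVec (Hw y) (grad ρ y)) x i +
      grad (fun y => ρ y * Hρ y - ρ y * div Hw y + p y ⬝ᵥ Hp y - H (p y) (ρ y) (grad ρ y)) x i =
    (∑ j, pderiv (ixSpace j) (fun y => Hp y j * p y i) x) +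
      (∑ j, p x j * pderiv (ixSpace i) (fun y => Hp y j) x) +
      ρ x * pderiv (ixSpace i) (fun y => Hρ y - div Hw y) x := by
  intro Hp Hρ Hw
  have hw : SmoothAt (grad ρ) x := smoothAt_pi.2 fun j => hρ.smoothAt_pderiv (ixSpace j)
  have hwj : ∀ j, SmoothAt (pderiv (ixSpace j) ρ) x := fun j => hρ.smoothAt_pderiv (ixSpace j)
  have hpj : ∀ j, SmoothAt (fun y => p y j) x := smoothAt_pi.1 hp
  have hHp : ∀ j, SmoothAt (fun y => Hp y j) x := fun j => (hH.dVec j).smoothAt hp hρ hw hx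
  have hHw : ∀ j, SmoothAt (fun y => Hw y j) x := fun j => (hH.dGrad j).smoothAt hp hρ hw hx
  have hHρ : SmoothAt Hρ x := hH.dRho.smoothAt hp hρ hw hx
  have hdiv : SmoothAt (div Hw) x := SmoothAt.sum fun j _ => (hHw j).smoothAt_pderiv _
  have hHs : SmoothAt (fun y => H (p y) (ρ y) (grad ρ y)) x := hH.smoothAt hp hρ hw hx
  have hdot : SmoothAt (fun y => p y ⬝ᵥ Hp y) x := SmoothAt.dotProduct hpj hHp
  have e1 : divT (fun y => Matrix.vecMulVec (Hp y) (p y) + Matrix.vecMulVec (Hw y) (grad ρ y)) x i =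
      (∑ j, pderiv (ixSpace j) (fun y => Hp y j * p y i) x) +
        ∑ j, (pderiv (ixSpace j) (fun y => Hw y j) x * pderiv (ixSpace i) ρ x +
          Hw x j * pderiv (ixSpace i) (pderiv (ixSpace j) ρ) x) := by
    rw [divT, ← Finset.sum_add_distrib]
    refine Finset.sum_congr rfl fun j _ => ?_
    rw [← hρ.pderiv_comm (ixSpace j) (ixSpace i), ← (hHw j).pderiv_mul (hwj i),
      ← ((hHp j).mul (hpj i)).pderiv_add ((hHw j).mul (hwj i))]
    rfl
  have e2 : grad (fun y => ρ y * Hρ y - ρ y * div Hw y + p y ⬝ᵥ Hp y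
        - H (p y) (ρ y) (grad ρ y)) x i =
      pderiv (ixSpace i) ρ x * Hρ x + ρ x * pderiv (ixSpace i) Hρ x -
        (pderiv (ixSpace i) ρ x * div Hw x + ρ x * pderiv (ixSpace i) (div Hw) x) +
        (∑ j, (pderiv (ixSpace i) (fun y => p y j) x * Hp x j +
          p x j * pderiv (ixSpace i) (fun y => Hp y j) x)) -
        ((∑ j, Hp x j * pderiv (ixSpace i) (fun y => p y j) x) + Hρ x * pderiv (ixSpace i) ρ x +
          ∑ j, Hw x j * pderiv (ixSpace i) (pderiv (ixSpace j) ρ) x) := by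
    have hc := hH.pderiv_comp hp hρ hw hx (ixSpace i)
    rw [grad, (((hρ.mul hHρ).sub (hρ.mul hdiv)).add hdot).pderiv_sub hHs,
      ((hρ.mul hHρ).sub (hρ.mul hdiv)).pderiv_add hdot, (hρ.mul hHρ).pderiv_sub (hρ.mul hdiv),
      hρ.pderiv_mul hHρ, hρ.pderiv_mul hdiv, hc]
    congr 2
    simp only [dotProduct]
    rw [SmoothAt.pderiv_sum fun j _ => (hpj j).mul (hHp j)]
    exact Finset.sum_congr rfl fun j _ => (hpj j).pderiv_mul (hHp j) _
  rw [e1, e2, hHρ.pderiv_sub hdiv]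
  simp only [div, Fin.sum_univ_three]
  ring

section Residual

/-- The Euler–Lagrange expression `∂L/∂φ^a - ∂/∂x^μ (∂L/∂v^a_μ)` of `epTheory H`. -/
noncomputable def elResidual (H : V3 → ℝ → V3 → ℝ) (φ : M → F)
    (a : Fin 3 ⊕ (Fin 3 ⊕ Unit ⊕ Unit)) (x : M) : ℝ :=
  elField H (φ x) (jet φ x) a - ∑ μ, pderiv μ (fun y => elMomentum H (φ y) (jet φ y) a μ) x

variable {P : Set ℝ} {H : V3 → ℝ → V3 → ℝ} {φ : M → F}

theorem gradOf_jet (φ : M → F) (j : Fin 3 ⊕ Unit ⊕ Unit) (x : M) :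
    gradOf j (jet φ x) = grad (fun y => (φ y).2 j) x := by
  funext i
  exact jet_inr φ j (ixSpace i) x

theorem SmoothField.smoothAt_pOf (hφ : SmoothField φ) (x : M) :
    SmoothAt (fun y => pOf (φ y)) x := smoothAt_pi.2 fun _ => hφ.smoothAt_snd _ x

theorem SmoothField.smoothAt_gradOf (hφ : SmoothField φ) (j : Fin 3 ⊕ Unit ⊕ Unit) (x : M) :
    SmoothAt (fun y => gradOf j (jet φ y)) x := smoothAt_pi.2 fun _ => hφ.smoothAt_jet _ _ x

theorem SmoothField.smoothAt_inv_gradH (hφ : SmoothField φ) {x : M}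
    (hdet : (gradH (jet φ x)).det ≠ 0) (i j : Fin 3) :
    SmoothAt (fun y => (gradH (jet φ y))⁻¹ i j) x :=
  contDiffAt_inv_apply (B := fun v : Fin 3 ⊕ Unit → ℝ => gradH (jet φ (shift x v)))
    (fun i j => hφ.smoothAt_jet (ixH j) (ixSpace i) x) (by simpa [shift_zero] using hdet) i j

theorem SmoothField.smoothAt_velOf (hφ : SmoothField φ) {x : M}
    (hdet : (gradH (jet φ x)).det ≠ 0) (j : Fin 3) :
    SmoothAt (fun y => velOf (jet φ y) j) x := by
  change SmoothAt (fun y => -∑ i, jet φ y (ixH i) ixTime * (gradH (jet φ y))⁻¹ i j) x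
  exact (SmoothAt.sum fun i _ => (hφ.smoothAt_jet (ixH i) ixTime x).mul
    (hφ.smoothAt_inv_gradH hdet i j)).neg

theorem SmoothField.smoothAt_labelMomentum (hφ : SmoothField φ) {x : M}
    (hdet : (gradH (jet φ x)).det ≠ 0) (b : Fin 3) :
    SmoothAt (fun y => labelMomentum (φ y) (jet φ y) b) x := by
  change SmoothAt (fun y => ∑ i, (gradH (jet φ y))⁻¹ b i *
    (pOf (φ y) i + rhoOf (φ y) * jet φ y ixChi (ixSpace i))) x
  exact SmoothAt.sum fun i _ => (hφ.smoothAt_inv_gradH hdet b i).mul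
    ((hφ.smoothAt_snd _ x).add ((hφ.smoothAt_snd _ x).mul (hφ.smoothAt_jet ixChi (ixSpace i) x)))

theorem SmoothField.smoothAt_elMomentum (hH : SmoothDensity P H) (hφ : SmoothField φ) {x : M}
    (hdet : (gradH (jet φ x)).det ≠ 0) (hρ : rhoOf (φ x) ∈ P)
    (a : Fin 3 ⊕ (Fin 3 ⊕ Unit ⊕ Unit)) (μ : Fin 3 ⊕ Unit) :
    SmoothAt (fun y => elMomentum H (φ y) (jet φ y) a μ) x := by
  have hr : SmoothAt (fun y => rhoOf (φ y)) x := hφ.smoothAt_snd _ x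
  obtain b | i | ⟨⟩ | ⟨⟩ := a <;> obtain j | ⟨⟩ := μ <;>
    simp only [elMomentum, Sum.elim_inl, Sum.elim_inr]
  · exact ((hφ.smoothAt_velOf hdet j).mul (hφ.smoothAt_labelMomentum hdet b)).neg
  · exact (hφ.smoothAt_labelMomentum hdet b).neg
  · exact smoothAt_const 0 x
  · exact smoothAt_const 0 x
  · exact ((hH.dGrad j).smoothAt (hφ.smoothAt_pOf x) hr (hφ.smoothAt_gradOf _ x) hρ).neg
  · exact smoothAt_const 0 x
  · exact hr.mul (hφ.smoothAt_velOf hdet j)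
  · exact hr

theorem SmoothField.smoothAt_elField (hH : SmoothDensity P H) (hφ : SmoothField φ) {x : M}
    (hdet : (gradH (jet φ x)).det ≠ 0) (hρ : rhoOf (φ x) ∈ P)
    (a : Fin 3 ⊕ (Fin 3 ⊕ Unit ⊕ Unit)) :
    SmoothAt (fun y => elField H (φ y) (jet φ y) a) x := by
  have hr : SmoothAt (fun y => rhoOf (φ y)) x := hφ.smoothAt_snd _ x
  obtain b | i | ⟨⟩ | ⟨⟩ := a <;> simp only [elField, Sum.elim_inl, Sum.elim_inr]
  · exact smoothAt_const 0 x
  · exact (hφ.smoothAt_velOf hdet i).sub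
      ((hH.dVec i).smoothAt (hφ.smoothAt_pOf x) hr (hφ.smoothAt_gradOf _ x) hρ)
  · exact ((hφ.smoothAt_jet ixChi ixTime x).add (SmoothAt.dotProduct (hφ.smoothAt_velOf hdet)
      fun i => hφ.smoothAt_jet ixChi (ixSpace i) x)).sub
      (hH.dRho.smoothAt (hφ.smoothAt_pOf x) hr (hφ.smoothAt_gradOf _ x) hρ)
  · exact smoothAt_const 0 x

theorem SmoothField.smoothAt_elResidual (hH : SmoothDensity P H) (hφ : SmoothField φ) {x : M}
    (hdet : (gradH (jet φ x)).det ≠ 0) (hρ : rhoOf (φ x) ∈ P)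
    (a : Fin 3 ⊕ (Fin 3 ⊕ Unit ⊕ Unit)) : SmoothAt (elResidual H φ a) x :=
  (hφ.smoothAt_elField hH hdet hρ a).sub
    (SmoothAt.sum fun μ _ => (hφ.smoothAt_elMomentum hH hdet hρ a μ).smoothAt_pderiv μ)

theorem elResidual_h (H : V3 → ℝ → V3 → ℝ) (φ : M → F) (b : Fin 3) (x : M) :
    elResidual H φ (ixH b) x = dt (fun y => labelMomentum (φ y) (jet φ y) b) x +
      ∑ j, pderiv (ixSpace j) (fun y => velOf (jet φ y) j * labelMomentum (φ y) (jet φ y) b) x := by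
  simp [elResidual, elField, elMomentum, pderiv_neg, dt, Finset.sum_neg_distrib, add_comm]

theorem elResidual_p (H : V3 → ℝ → V3 → ℝ) (φ : M → F) (i : Fin 3) (x : M) :
    elResidual H φ (Sum.inr (Sum.inl i)) x = velOf (jet φ x) i -
      dVec H (pOf (φ x)) (rhoOf (φ x)) (grad (fun y => rhoOf (φ y)) x) i := by
  simp only [elResidual, elField, elMomentum, Sum.elim_inl, Sum.elim_inr, pderiv_const,
    Finset.sum_const_zero, sub_zero, gradOf_jet]
  rfl

theorem elResidual_rho (H : V3 → ℝ → V3 → ℝ) (φ : M → F) (x : M) :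
    elResidual H φ ixRho x = dt (fun y => chiOf (φ y)) x +
      velOf (jet φ x) ⬝ᵥ grad (fun y => chiOf (φ y)) x -
      dRho H (pOf (φ x)) (rhoOf (φ x)) (grad (fun y => rhoOf (φ y)) x) +
      div (fun y => dGrad H (pOf (φ y)) (rhoOf (φ y)) (grad (fun y => rhoOf (φ y)) y)) x := by
  simp only [elResidual, elField, elMomentum, Sum.elim_inl, Sum.elim_inr, pderiv_const,
    Fintype.sum_sum_type, Finset.sum_const_zero, gradOf_jet, pderiv_neg,
    Finset.sum_neg_distrib, add_zero, sub_neg_eq_add]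
  rw [jet_inr]
  rfl

theorem elResidual_chi (H : V3 → ℝ → V3 → ℝ) (φ : M → F) (x : M) :
    elResidual H φ ixChi x = -(dt (fun y => rhoOf (φ y)) x +
      div (fun y => rhoOf (φ y) • velOf (jet φ y)) x) := by
  simp [elResidual, elField, elMomentum, dt, div, add_comm]

/-- If `∇h` is invertible, then `∂ₜh = -u · ∇h` says that the velocity is `u`. -/
theorem dtH_eq_iff {J : Matrix (Fin 3 ⊕ (Fin 3 ⊕ Unit ⊕ Unit)) (Fin 3 ⊕ Unit) ℝ}
    (hdet : (gradH J).det ≠ 0) (u : V3) : dtH J = -(u ᵥ* gradH J) ↔ velOf J = u := by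
  have hu := isUnit_iff_ne_zero.2 hdet
  constructor
  · intro h
    rw [velOf, h, Matrix.neg_vecMul, Matrix.vecMul_vecMul, Matrix.mul_nonsing_inv _ hu,
      Matrix.vecMul_one, neg_neg]
  · rintro rfl
    rw [velOf, Matrix.neg_vecMul, Matrix.vecMul_vecMul, Matrix.nonsing_inv_mul _ hu,
      Matrix.vecMul_one, neg_neg]

/-- The definition of the label momentum solved for `p`: `p = ∇h · λ - ρ ∇χ`. -/
theorem pOf_eq_labelMomentum {y : F}
    {J : Matrix (Fin 3 ⊕ (Fin 3 ⊕ Unit ⊕ Unit)) (Fin 3 ⊕ Unit) ℝ}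
    (hdet : (gradH J).det ≠ 0) (i : Fin 3) :
    pOf y i = (∑ b, labelMomentum y J b * gradH J i b) - rhoOf y * J ixChi (ixSpace i) := by
  have hu := isUnit_iff_ne_zero.2 hdet
  have h : gradH J *ᵥ labelMomentum y J = pOf y + rhoOf y • gradOf (Sum.inr (Sum.inr ())) J := by
    rw [labelMomentum, Matrix.mulVec_mulVec, Matrix.mul_nonsing_inv _ hu, Matrix.one_mulVec]
  have h2 := congrFun h i
  have h3 : (∑ b, labelMomentum y J b * gradH J i b) = (gradH J *ᵥ labelMomentum y J) i :=
    Finset.sum_congr rfl fun b _ => mul_comm _ _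
  rw [h3, h2]
  simp [gradOf]

theorem SmoothField.eventually_det_ne_zero (hφ : SmoothField φ) {x : M}
    (hdet : (gradH (jet φ x)).det ≠ 0) :
    ∀ᶠ v : Fin 3 ⊕ Unit → ℝ in nhds 0, (gradH (jet φ (shift x v))).det ≠ 0 := by
  have hB : ∀ i j, SmoothAt (fun y => gradH (jet φ y) i j) x := fun i j =>
    hφ.smoothAt_jet (ixH j) (ixSpace i) x
  have hd : SmoothAt (fun y => (gradH (jet φ y)).det) x := by
    simp only [Matrix.det_fin_three, SmoothAt] at hB ⊢
    fun_prop
  exact hd.eventually_mem isOpen_ne hdet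

/-- If the equations for `p`, `ρ` and `χ` hold, then the momentum equation is the equation for the
label momentum `λ`, contracted with `∇h`. -/
theorem momentum_residual_eq (hH : SmoothDensity P H) (hφ : SmoothField φ) {x : M}
    (hdet : ∀ y, timeOf y = timeOf x → (gradH (jet φ y)).det ≠ 0) (hρ : rhoOf (φ x) ∈ P)
    (h1 : ∀ y, timeOf y = timeOf x → velOf (jet φ y) =
      dVec H (pOf (φ y)) (rhoOf (φ y)) (grad (fun y => rhoOf (φ y)) y))
    (h2 : ∀ y, timeOf y = timeOf x → elResidual H φ ixRho y = 0)
    (h3 : elResidual H φ ixChi x = 0) (i : Fin 3) :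
    let p : M → V3 := fun y => pOf (φ y)
    let ρ : M → ℝ := fun y => rhoOf (φ y)
    let Hp : M → V3 := fun y => dVec H (p y) (ρ y) (grad ρ y)
    let Hρ : M → ℝ := fun y => dRho H (p y) (ρ y) (grad ρ y)
    let Hw : M → V3 := fun y => dGrad H (p y) (ρ y) (grad ρ y)
    dt (fun y => p y i) x +
      (divT (fun y => Matrix.vecMulVec (Hp y) (p y) + Matrix.vecMulVec (Hw y) (grad ρ y)) x i +
      grad (fun y => ρ y * Hρ y - ρ y * div Hw y + p y ⬝ᵥ Hp y - H (p y) (ρ y) (grad ρ y)) x i) =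
      ∑ b, elResidual H φ (ixH b) x * gradH (jet φ x) i b := by
  intro p ρ Hp Hρ Hw
  have hd := hdet x rfl
  have hr : SmoothAt ρ x := hφ.smoothAt_snd _ x
  have key := transport_momentum (p := p) (v := fun y => velOf (jet φ y))
    (l := fun y => labelMomentum (φ y) (jet φ y)) (T := fun y => dtH (jet φ y)) (ρ := ρ)
    (χ := fun y => chiOf (φ y)) (S := fun y => Hρ y - div Hw y)
    (B := fun i b y => gradH (jet φ y) i b) (x := x) (hφ.smoothAt_velOf hd)
    (hφ.smoothAt_labelMomentum hd) (fun i b => hφ.smoothAt_jet _ _ x) hr (hφ.smoothAt_snd _ x)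
    (fun i => by
      filter_upwards [hφ.eventually_det_ne_zero hd] with w hw
      have := pOf_eq_labelMomentum (y := φ (shift x w)) hw i
      rwa [jet_inr] at this)
    (fun i b => hφ.pderiv_jet_comm (ixH b) _ _ x) (fun i j b => hφ.pderiv_jet_comm (ixH b) _ _ x)
    (fun y hy b => by
      exact congrFun ((dtH_eq_iff (hdet y hy) _).2 rfl) b)
    (by rw [elResidual_chi, neg_eq_zero] at h3; exact h3)
    (fun y hy => by
      have := h2 y hy
      rw [elResidual_rho] at this
      simp only [Hρ, Hw, p, ρ]
      linarith) i
  have hflux := momentum_flux_eq hH (hφ.smoothAt_pOf x) hr hρ i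
  simp only at hflux
  rw [hflux]
  have c1 : ∀ j, pderiv (ixSpace j) (fun y => Hp y j * p y i) x =
      pderiv (ixSpace j) (fun y => velOf (jet φ y) j * p y i) x := fun j =>
    pderiv_space_congr (fun y hy => by simp only [h1 y hy, Hp, p, ρ]) j
  have c2 : ∀ j, pderiv (ixSpace i) (fun y => Hp y j) x =
      pderiv (ixSpace i) (fun y => velOf (jet φ y) j) x := fun j =>
    pderiv_space_congr (fun y hy => by simp only [h1 y hy, Hp, p, ρ]) i
  have c3 : ∀ b, elResidual H φ (ixH b) x = _ := fun b => elResidual_h H φ b x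
  simp only [c3]
  simp only [Hp, p, ρ, Hρ, Hw] at c1 c2 key ⊢
  simp only [c1, c2]
  linear_combination key

/-- At the times in `I`, the Euler–Lagrange expressions vanish if and only if the extended system
holds. -/
theorem elResidual_eq_zero_iff_extendedSystem (hH : SmoothDensity P H) (hφ : SmoothField φ)
    {I : Set ℝ} (hdet : ∀ x, timeOf x ∈ I → (gradH (jet φ x)).det ≠ 0)
    (hρ : ∀ x, timeOf x ∈ I → rhoOf (φ x) ∈ P) :
    (∀ x, timeOf x ∈ I → ∀ a, elResidual H φ a x = 0) ↔ ExtendedSystem H I φ := by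
  have hdet' : ∀ x, timeOf x ∈ I → ∀ y, timeOf y = timeOf x → (gradH (jet φ y)).det ≠ 0 :=
    fun x hx y hy => hdet y (hy ▸ hx)
  have hdiv : ∀ x, (∀ y, timeOf y = timeOf x → velOf (jet φ y) =
      dVec H (pOf (φ y)) (rhoOf (φ y)) (grad (fun y => rhoOf (φ y)) y)) →
      div (fun y => rhoOf (φ y) • velOf (jet φ y)) x = div (fun y => rhoOf (φ y) •
        dVec H (pOf (φ y)) (rhoOf (φ y)) (grad (fun y => rhoOf (φ y)) y)) x := fun x hx =>
    Finset.sum_congr rfl fun j _ => pderiv_space_congr (fun y hy => by simp only [hx y hy]) j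
  constructor
  · intro h
    have h1 : ∀ x, timeOf x ∈ I → velOf (jet φ x) =
        dVec H (pOf (φ x)) (rhoOf (φ x)) (grad (fun y => rhoOf (φ y)) x) := fun x hx => by
      funext i
      exact sub_eq_zero.1 ((elResidual_p H φ i x).symm.trans (h x hx _))
    refine ⟨fun x hx => (dtH_eq_iff (hdet x hx) _).2 (h1 x hx), fun x hx => ⟨?_, fun j => ?_⟩,
      fun x hx => ?_⟩
    · have := h x hx ixChi
      rwa [elResidual_chi, neg_eq_zero, hdiv x fun y hy => h1 y (hy ▸ hx)] at this
    · have key := momentum_residual_eq hH hφ (hdet' x hx) (hρ x hx) (fun y hy => h1 y (hy ▸ hx))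
        (fun y hy => h y (hy ▸ hx) _) (h x hx _) j
      simp only [h x hx, zero_mul, Finset.sum_const_zero] at key
      linarith
    · have := h x hx ixRho
      rw [elResidual_rho, h1 x hx] at this
      linarith
  · rintro ⟨h1, h2, h3⟩ x hx
    have h1' : ∀ x, timeOf x ∈ I → velOf (jet φ x) =
        dVec H (pOf (φ x)) (rhoOf (φ x)) (grad (fun y => rhoOf (φ y)) x) := fun x hx =>
      (dtH_eq_iff (hdet x hx) _).1 (h1 x hx)
    have hρ0 : ∀ x, timeOf x ∈ I → elResidual H φ ixRho x = 0 := fun x hx => by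
      have := h3 x hx
      rw [elResidual_rho, h1' x hx]
      linarith
    have hχ0 : elResidual H φ ixChi x = 0 := by
      rw [elResidual_chi, hdiv x fun y hy => h1' y (hy ▸ hx), (h2 x hx).1, neg_zero]
    -- The momentum equation is the equation for `λ` multiplied by `∇h`, which is invertible.
    have hh : gradH (jet φ x) *ᵥ (fun b => elResidual H φ (ixH b) x) = 0 := by
      funext i
      have key := momentum_residual_eq hH hφ (hdet' x hx) (hρ x hx) (fun y hy => h1' y (hy ▸ hx))
        (fun y hy => hρ0 y (hy ▸ hx)) hχ0 i
      have e : (gradH (jet φ x) *ᵥ (fun b => elResidual H φ (ixH b) x)) i =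
          ∑ b, elResidual H φ (ixH b) x * gradH (jet φ x) i b := by
        simp only [Matrix.mulVec, dotProduct, mul_comm]
      rw [e, ← key]
      have := (h2 x hx).2 i
      rw [Pi.zero_apply]
      linarith
    rintro (b | i | ⟨⟩ | ⟨⟩)
    · exact congrFun (Matrix.eq_zero_of_mulVec_eq_zero (hdet x hx) hh) b
    · rw [elResidual_p, h1' x hx, sub_self]
    · exact hρ0 x hx
    · exact hχ0

theorem eulerLagrange_iff_elResidual (hH : SmoothDensity P H)
    (hdet : ∀ x, (gradH (jet φ x)).det ≠ 0) (hρ : ∀ x, rhoOf (φ x) ∈ P) :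
    (epTheory H).EulerLagrange φ ↔ ∀ x a, elResidual H φ a x = 0 := by
  unfold FieldTheory.EulerLagrange elResidual
  simp only [deriv_lagrangian_field hH _ (hdet _) (hρ _),
    deriv_lagrangian_jet hH _ (hdet _) (hρ _), sub_eq_zero]

end Residual

/-! ### Integration over a time interval and the torus -/

section Integration

open MeasureTheory

/-- Differentiation under the integral sign over a compact set. -/
theorem hasDerivAt_setIntegral_of_contDiffAt {Y : Type*} [NormedAddCommGroup Y] [NormedSpace ℝ Y]
    [MeasurableSpace Y] [BorelSpace Y] {μ : Measure Y} [IsFiniteMeasureOnCompacts μ] {K : Set Y}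
    (hK : IsCompact K) {f : ℝ × Y → ℝ} (h : ∀ y ∈ K, ContDiffAt ℝ 1 f (0, y)) :
    HasDerivAt (fun ε => ∫ y in K, f (ε, y) ∂μ)
      (∫ y in K, fderiv ℝ f (0, y) (1, 0) ∂μ) 0 := by
  have hev : ∀ᶠ ε : ℝ in nhds 0, ∀ y ∈ K, ContDiffAt ℝ 1 f (ε, y) :=
    hK.eventually_forall_of_forall_eventually (P := fun ε y => ContDiffAt ℝ 1 f (ε, y))
      fun y hy => (h y hy).eventually (by simp)
  obtain ⟨r, hr, hball⟩ := Metric.eventually_nhds_iff_ball.1 hev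
  have hr2 : 0 < r / 2 := by positivity
  have hsub : Metric.closedBall (0 : ℝ) (r / 2) ⊆ Metric.ball 0 r :=
    Metric.closedBall_subset_ball (by linarith)
  have hcd : ∀ z ∈ Metric.closedBall (0 : ℝ) (r / 2) ×ˢ K, ContDiffAt ℝ 1 f z :=
    fun z hz => hball z.1 (hsub hz.1) z.2 hz.2
  have hcomp : IsCompact (Metric.closedBall (0 : ℝ) (r / 2) ×ˢ K) :=
    (isCompact_closedBall _ _).prod hK
  have hcont' : ContinuousOn (fun z => fderiv ℝ f z (1, 0))
      (Metric.closedBall (0 : ℝ) (r / 2) ×ˢ K) := fun z hz =>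
    ((((hcd z hz).fderiv_right (m := 0) (by simp)).continuousAt).clm_apply
      continuousAt_const).continuousWithinAt
  obtain ⟨C, hC⟩ := hcomp.exists_bound_of_continuousOn hcont'
  have hslice : ∀ ε ∈ Metric.closedBall (0 : ℝ) (r / 2), ContinuousOn (fun y => f (ε, y)) K :=
    fun ε hε y hy => ((hcd (ε, y) ⟨hε, hy⟩).continuousAt.comp
      (f := fun y => (ε, y)) (by fun_prop)).continuousWithinAt
  have h0 : (0 : ℝ) ∈ Metric.closedBall (0 : ℝ) (r / 2) := by simp [hr2.le]
  refine (hasDerivAt_integral_of_dominated_loc_of_deriv_le (F := fun ε y => f (ε, y))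
    (F' := fun ε y => fderiv ℝ f (ε, y) (1, 0)) (bound := fun _ => C) (s := Metric.ball 0 (r / 2))
    (Metric.ball_mem_nhds _ hr2) ?_ ?_ ?_ ?_ ?_ ?_).2
  · filter_upwards [Metric.ball_mem_nhds (0 : ℝ) hr2] with ε hε
    exact (hslice ε (Metric.ball_subset_closedBall hε)).aestronglyMeasurable_of_isCompact hK
      hK.measurableSet
  · exact (hslice 0 h0).integrableOn_compact hK
  · refine ContinuousOn.aestronglyMeasurable_of_isCompact ?_ hK hK.measurableSet
    exact hcont'.comp (f := fun y : Y => ((0 : ℝ), y)) (by fun_prop) fun y hy => ⟨h0, hy⟩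
  · filter_upwards [ae_restrict_mem hK.measurableSet] with y hy ε hε
    exact hC _ ⟨Metric.ball_subset_closedBall hε, hy⟩
  · exact integrableOn_const hK.measure_lt_top.ne
  · filter_upwards [ae_restrict_mem hK.measurableSet] with y hy ε hε
    have h1 := ((hcd (ε, y) ⟨Metric.ball_subset_closedBall hε, hy⟩).differentiableAt
      (by simp)).hasFDerivAt
    exact h1.comp_hasDerivAt ε ((hasDerivAt_id ε).prodMk (hasDerivAt_const ε y))

/-- The cell `[0, 2π]³`, whose opposite faces are identified in the torus. -/
def cell : Set V3 := Icc 0 (fun _ => 2 * Real.pi)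

theorem isCompact_cell : IsCompact cell := isCompact_Icc

/-- The point of `M` with time coordinate `t` and the angles `y`. -/
noncomputable def pt (q : ℝ × V3) : M := at_ (fun i => ((q.2 i : ℝ) : Real.Angle)) q.1

theorem timeOf_pt (q : ℝ × V3) : timeOf (pt q) = q.1 := rfl

theorem pt_add (q q' : ℝ × V3) : pt (q + q') = shift (pt q) (Sum.elim q'.2 fun _ => q'.1) := by
  ext <;> simp [pt, at_, shift]

theorem exists_pt (x : M) : ∃ y ∈ cell, pt (timeOf x, y) = x := by
  have h2 : Fact (0 < 2 * Real.pi) := ⟨Real.two_pi_pos⟩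
  have hsurj : ∀ θ : Real.Angle, ∃ s ∈ Icc 0 (2 * Real.pi), (s : Real.Angle) = θ := fun θ => by
    obtain ⟨s, hs, rfl⟩ := (AddCircle.coe_image_Icc_eq (p := 2 * Real.pi) 0).symm ▸ mem_univ θ
    exact ⟨s, by simpa using hs, rfl⟩
  choose s hs hsx using fun i => hsurj (x.1 i)
  refine ⟨s, ⟨fun i => (hs i).1, fun i => (hs i).2⟩, ?_⟩
  ext
  · simp [pt, at_, hsx]
  · rfl

theorem SmoothAt.contDiffAt_pt {E : Type} [NormedAddCommGroup E] [NormedSpace ℝ E] {f : M → E}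
    {q : ℝ × V3} (h : SmoothAt f (pt q)) : ContDiffAt ℝ ∞ (fun q => f (pt q)) q := by
  have h1 : ContDiffAt ℝ ∞ (fun q' : ℝ × V3 =>
      (Sum.elim (q' - q).2 fun _ => (q' - q).1 : Fin 3 ⊕ Unit → ℝ)) q := by
    refine contDiffAt_pi.2 fun μ => ?_
    obtain i | ⟨⟩ := μ <;> simp only [Sum.elim_inl, Sum.elim_inr, Prod.fst_sub, Prod.snd_sub,
      Pi.sub_apply] <;> fun_prop
  have h0 : (Sum.elim (q - q).2 fun _ => (q - q).1 : Fin 3 ⊕ Unit → ℝ) = 0 := by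
    funext μ
    obtain i | ⟨⟩ := μ <;> simp
  have h2 : ContDiffAt ℝ ∞ (fun v => f (shift (pt q) v))
      (Sum.elim (q - q).2 fun _ => (q - q).1 : Fin 3 ⊕ Unit → ℝ) := by rw [h0]; exact h
  have h3 := ContDiffAt.comp (f := fun q' : ℝ × V3 =>
      (Sum.elim (q' - q).2 fun _ => (q' - q).1 : Fin 3 ⊕ Unit → ℝ)) q h2 h1
  refine h3.congr_of_eventuallyEq (Filter.Eventually.of_forall fun q' => ?_)
  simp only [Function.comp_apply, ← pt_add, add_sub_cancel]

theorem SmoothAt.hasDerivAt_pt_time {f : M → ℝ} {t : ℝ} {y : V3} (h : SmoothAt f (pt (t, y))) :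
    HasDerivAt (fun s => f (pt (s, y))) (pderiv ixTime f (pt (t, y))) t := by
  have h1 := h.hasDerivAt ixTime
  have e : ∀ s, shift (pt (t, y)) (Pi.single ixTime s) = pt (t + s, y) := fun s => by
    have := pt_add (t, y) (s, 0)
    simp only [Prod.mk_add_mk, add_zero] at this
    rw [this]
    congr 1
    funext μ
    obtain i | ⟨⟩ := μ <;> simp [ixTime]
  simp only [e] at h1
  have h2 := HasDerivAt.comp_sub_const (x := t) (a := t) (f := fun s => f (pt (t + s, y)))
    (by simpa using h1)
  simpa using h2

theorem SmoothAt.hasFDerivAt_pt_space {f : M → ℝ} {t : ℝ} {y : V3} (h : SmoothAt f (pt (t, y))) :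
    ∃ f' : V3 →L[ℝ] ℝ, HasFDerivAt (fun y => f (pt (t, y))) f' y ∧
      ∀ i, f' (Pi.single i 1) = pderiv (ixSpace i) f (pt (t, y)) := by
  have h1 : ContDiffAt ℝ ∞ (fun y => f (pt (t, y))) y :=
    h.contDiffAt_pt.comp (f := fun y : V3 => (t, y)) y (by fun_prop)
  have h2 := (h1.differentiableAt (by simp)).hasFDerivAt
  refine ⟨_, h2, fun i => ?_⟩
  have h3 : HasDerivAt (fun s : ℝ => y + Pi.single i s) (Pi.single i (1 : ℝ)) 0 :=
    (hasDerivAt_single i (0 : ℝ)).const_add y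
  have h4 := (h2.comp_hasDerivAt_of_eq (0 : ℝ) h3 (by simp)).deriv
  rw [← h4, pderiv]
  congr 1
  funext s
  have := pt_add (t, y) (0, Pi.single i s)
  simp only [Prod.mk_add_mk, add_zero] at this
  rw [Function.comp_apply, this]
  congr 2
  funext μ
  obtain j | ⟨⟩ := μ <;> simp [ixSpace, Pi.single_apply]

/-- The integral of a spatial derivative over the torus vanishes. -/
theorem integral_pderiv_space {f : M → ℝ} {t : ℝ} (h : ∀ x, timeOf x = t → SmoothAt f x)
    (i : Fin 3) : ∫ y in cell, pderiv (ixSpace i) f (pt (t, y)) = 0 := by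
  have hs : ∀ y, SmoothAt f (pt (t, y)) := fun y => h _ rfl
  choose f' hf' hf'i using fun y => (hs y).hasFDerivAt_pt_space
  have hcont : Continuous fun y => f (pt (t, y)) := continuous_iff_continuousAt.2 fun y =>
    (hf' y).continuousAt
  have hcont' : Continuous fun y => pderiv (ixSpace i) f (pt (t, y)) :=
    continuous_iff_continuousAt.2 fun y =>
      (((hs y).smoothAt_pderiv (ixSpace i)).contDiffAt_pt.continuousAt).comp
        (f := fun y : V3 => (t, y)) (by fun_prop)
  have e : ∀ y, ∑ j, (if j = i then f' y else 0) (Pi.single j 1) =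
      pderiv (ixSpace i) f (pt (t, y)) := fun y => by
    rw [Finset.sum_eq_single i]
    · simp [hf'i]
    · intro b _ hb
      simp [hb]
    · simp
  -- The divergence theorem for the vector field with only component `f` in the direction `i`.
  have key := integral_divergence_of_hasFDerivAt_off_countable' (n := 2) (E := ℝ)
    (a := (0 : V3)) (b := fun _ => 2 * Real.pi) (fun _ => by positivity)
    (fun j y => if j = i then f (pt (t, y)) else 0) (fun j y => if j = i then f' y else 0) ∅
    countable_empty
    (fun j => by
      by_cases hj : j = i
      · simpa [hj] using hcont.continuousOn
      · simpa [hj] using continuousOn_const)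
    (fun y _ j => by
      by_cases hj : j = i
      · simpa [hj] using hf' y
      · simpa [hj] using hasFDerivAt_const (0 : ℝ) y)
    (by
      simp only [e]
      exact hcont'.continuousOn.integrableOn_compact isCompact_Icc)
  simp only [e] at key
  rw [cell, key]
  refine Finset.sum_eq_zero fun j _ => ?_
  -- Opposite faces of the cell consist of the same points of the torus.
  rw [sub_eq_zero]
  congr 1
  funext y
  by_cases hj : j = i
  · subst hj
    simp only [if_true]
    congr 1
    ext k
    · refine Fin.succAboveCases j ?_ (fun k => ?_) k <;> simp [pt, at_]
    · rfl
  · simp [hj]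

/-- Integration over `[t₁, t₂] × Q` of a partial derivative of a function that vanishes at the
endpoints. -/
theorem integral_pderiv_eq_zero {f : M → ℝ} {t₁ t₂ : ℝ} (h12 : t₁ ≤ t₂)
    (h : ∀ x, timeOf x ∈ Icc t₁ t₂ → SmoothAt f x) (h1 : ∀ x, timeOf x = t₁ → f x = 0)
    (h2 : ∀ x, timeOf x = t₂ → f x = 0) (μ : Fin 3 ⊕ Unit) :
    ∫ q in Icc t₁ t₂ ×ˢ cell, pderiv μ f (pt q) = 0 := by
  have hcont : ContinuousOn (fun q => pderiv μ f (pt q)) (Icc t₁ t₂ ×ˢ cell) := fun q hq =>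
    (((h (pt q) hq.1).smoothAt_pderiv μ).contDiffAt_pt.continuousAt).continuousWithinAt
  have hint : IntegrableOn (fun q => pderiv μ f (pt q)) (Icc t₁ t₂ ×ˢ cell) :=
    hcont.integrableOn_compact (isCompact_Icc.prod isCompact_cell)
  obtain i | ⟨⟩ := μ
  · rw [Measure.volume_eq_prod, setIntegral_prod _ hint]
    refine setIntegral_eq_zero_of_forall_eq_zero fun t ht => ?_
    exact integral_pderiv_space (fun x hx => h x (hx ▸ ht)) i
  · have hswap : IntegrableOn (fun q : V3 × ℝ => pderiv ixTime f (pt q.swap))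
        (cell ×ˢ Icc t₁ t₂) (volume.prod volume) := by
      have hc : ContinuousOn (fun q : V3 × ℝ => pderiv ixTime f (pt q.swap))
          (cell ×ˢ Icc t₁ t₂) :=
        hcont.comp (f := fun q : V3 × ℝ => q.swap) continuous_swap.continuousOn
          fun q hq => ⟨hq.2, hq.1⟩
      exact hc.integrableOn_compact (isCompact_cell.prod isCompact_Icc)
    rw [Measure.volume_eq_prod, ← setIntegral_prod_swap, setIntegral_prod _ hswap]
    refine setIntegral_eq_zero_of_forall_eq_zero fun y _ => ?_
    simp only [Prod.swap_prod_mk]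
    rw [integral_Icc_eq_integral_Ioc, ← intervalIntegral.integral_of_le h12,
      intervalIntegral.integral_eq_sub_of_hasDerivAt (f := fun t => f (pt (t, y)))
        (fun t ht => (h (pt (t, y)) (by rwa [uIcc_of_le h12] at ht)).hasDerivAt_pt_time)]
    · rw [h1 (pt (t₁, y)) rfl, h2 (pt (t₂, y)) rfl, sub_zero]
    · apply ContinuousOn.intervalIntegrable
      rw [uIcc_of_le h12]
      intro t ht
      exact ((((h (pt (t, y)) ht).smoothAt_pderiv _).contDiffAt_pt.continuousAt).comp
        (f := fun t : ℝ => (t, y)) (by fun_prop)).continuousWithinAt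

end Integration

/-! ### The first variation of the action -/

section Variation

open MeasureTheory

variable {P : Set ℝ} {H : V3 → ℝ → V3 → ℝ} {Φ : M → F}
  {δ : M → (Fin 3 ⊕ (Fin 3 ⊕ Unit ⊕ Unit) → ℝ)}

/-- The matrix of partial derivatives of a variation. -/
noncomputable def jetVar (δ : M → (Fin 3 ⊕ (Fin 3 ⊕ Unit ⊕ Unit) → ℝ)) (x : M) :
    Matrix (Fin 3 ⊕ (Fin 3 ⊕ Unit ⊕ Unit)) (Fin 3 ⊕ Unit) ℝ :=
  Matrix.of fun a μ => pderiv μ (fun y => δ y a) x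

/-- Although the components `h` of a field are angles, its derivatives vary linearly: near a point
the increments of `Φ` and of `ε δ` are small angles, which add up without wrapping around. -/
theorem jet_vary (hΦ : SmoothField Φ) (hδ : SmoothFun δ) (ε : ℝ) (x : M) :
    jet (vary Φ (ε • δ)) x = jet Φ x + ε • jetVar δ x := by
  ext a μ
  have hδa : SmoothAt (fun y => δ y a) x := smoothAt_pi.1 (hδ x) a
  have hΦa : SmoothAt (fun y => relCoord (Φ y) (Φ x) a) x := contDiffAt_pi.1 (hΦ x) a
  have h1 := (hΦa.hasDerivAt μ).add (((hδa.hasDerivAt μ).const_mul ε).sub_const (ε * δ x a))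
  have e1 : pderiv μ (fun y => relCoord (Φ y) (Φ x) a) x = jet Φ x a μ := by
    rw [hΦa.pderiv_eq_fderiv μ, ← (hΦ.eventually_jet_eq x a μ).self_of_nhds, shift_zero]
  rw [e1] at h1
  refine (h1.congr_of_eventuallyEq ?_).deriv
  obtain i | j := a
  · have hc1 := (hΦa.hasDerivAt μ).continuousAt.abs
    have hc2 := (((hδa.hasDerivAt μ).const_mul ε).sub_const (ε * δ x (Sum.inl i))).continuousAt.abs
    have l1 : |relCoord (Φ (shift x (Pi.single μ (0 : ℝ)))) (Φ x) (Sum.inl i)| < Real.pi / 2 := by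
      simp [relCoord, shift_zero, Real.pi_pos]
    have l2 : |ε * δ (shift x (Pi.single μ (0 : ℝ))) (Sum.inl i) - ε * δ x (Sum.inl i)| <
        Real.pi / 2 := by
      simp [shift_zero, Real.pi_pos]
    filter_upwards [hc1.eventually_lt_const l1, hc2.eventually_lt_const l2] with s h1 h2
    have hr : ((ε * δ (shift x (Pi.single μ s)) (Sum.inl i) - ε * δ x (Sum.inl i) : ℝ) :
        Real.Angle).toReal =
        ε * δ (shift x (Pi.single μ s)) (Sum.inl i) - ε * δ x (Sum.inl i) := by
      rw [Real.Angle.toReal_coe_eq_self_iff]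
      rw [abs_lt] at h2
      constructor <;> linarith [h2.1, h2.2, Real.pi_pos]
    simp only [relCoord, Sum.elim_inl] at h1
    have ev : ∀ z, (vary Φ (ε • δ) z).1 i =
        (Φ z).1 i + ((ε * δ z (Sum.inl i) : ℝ) : Real.Angle) := fun z => rfl
    simp only [relCoord, Sum.elim_inl, Pi.add_apply, ev]
    rw [← hr, ← toReal_add_of_abs_lt h1 (by rw [hr]; exact h2), Real.Angle.coe_sub]
    congr 1
    abel
  · refine Filter.Eventually.of_forall fun s => ?_
    have ev : ∀ z, (vary Φ (ε • δ) z).2 j = (Φ z).2 j + ε * δ z (Sum.inr j) := fun z => rfl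
    simp only [relCoord, Sum.elim_inr, Pi.add_apply, ev]
    ring

/-- The term `p · v` of the phase-space Lagrangian. -/
noncomputable def lag₁ (y : F)
    (J : Matrix (Fin 3 ⊕ (Fin 3 ⊕ Unit ⊕ Unit)) (Fin 3 ⊕ Unit) ℝ) : ℝ := pOf y ⬝ᵥ velOf J

/-- The term `(∂_t χ + v · ∇χ) ρ` of the phase-space Lagrangian. -/
noncomputable def lag₂ (y : F)
    (J : Matrix (Fin 3 ⊕ (Fin 3 ⊕ Unit ⊕ Unit)) (Fin 3 ⊕ Unit) ℝ) : ℝ :=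
  (J ixChi ixTime + velOf J ⬝ᵥ gradOf (Sum.inr (Sum.inr ())) J) * rhoOf y

/-- The term `H (p, ρ, ∇ρ)` of the phase-space Lagrangian. -/
def lag₃ (H : V3 → ℝ → V3 → ℝ) (y : F)
    (J : Matrix (Fin 3 ⊕ (Fin 3 ⊕ Unit ⊕ Unit)) (Fin 3 ⊕ Unit) ℝ) : ℝ :=
  H (pOf y) (rhoOf y) (gradOf (Sum.inr (Sum.inl ())) J)

theorem lagrangian_eq (x : M) (y : F)
    (J : Matrix (Fin 3 ⊕ (Fin 3 ⊕ Unit ⊕ Unit)) (Fin 3 ⊕ Unit) ℝ) :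
    (epTheory H).lagrangian x y J = lag₁ y J + lag₂ y J - lag₃ H y J := by
  have e : velOf J = -(dtH J ᵥ* (gradH J)⁻¹) := rfl
  have g : ∀ j, gradOf j J = fun i => J (Sum.inr j) (ixSpace i) := fun _ => rfl
  simp only [epTheory, lag₁, lag₂, lag₃, e, neg_dotProduct, dotProduct_comm (pOf y), g]
  ring

/-- The integrals over `Q` in the phase-space Lagrangian, taken over the cell. They stay separate,
because they may only be added once their integrands are known to be integrable. -/
theorem phaseLagrangian_eq (H : V3 → ℝ → V3 → ℝ) (Ψ : M → F) (t : ℝ) :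
    phaseLagrangian H Ψ t =
      (∫ y in cell, lag₁ (Ψ (pt (t, y))) (jet Ψ (pt (t, y)))) +
        (∫ y in cell, lag₂ (Ψ (pt (t, y))) (jet Ψ (pt (t, y)))) -
        ∫ y in cell, lag₃ H (Ψ (pt (t, y))) (jet Ψ (pt (t, y))) := by
  simp only [lag₁, lag₂, lag₃, gradOf_jet, ixChi, jet_inr]
  rfl

section Smoothness

variable {E : Type} [NormedAddCommGroup E] [NormedSpace ℝ E] {y : E → F}
  {J : E → Matrix (Fin 3 ⊕ (Fin 3 ⊕ Unit ⊕ Unit)) (Fin 3 ⊕ Unit) ℝ} {e : E}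

theorem contDiffAt_velOf (hJ : ∀ a μ, ContDiffAt ℝ ∞ (fun e => J e a μ) e)
    (hdet : (gradH (J e)).det ≠ 0) (j : Fin 3) : ContDiffAt ℝ ∞ (fun e => velOf (J e) j) e := by
  change ContDiffAt ℝ ∞ (fun e => -∑ i, J e (ixH i) ixTime * (gradH (J e))⁻¹ i j) e
  exact (ContDiffAt.sum fun i _ => (hJ _ _).mul (contDiffAt_inv_apply
    (B := fun e => gradH (J e)) (fun i j => hJ (ixH j) (ixSpace i)) hdet i j)).neg

theorem contDiffAt_lag₁ (hy : ∀ j, ContDiffAt ℝ ∞ (fun e => (y e).2 j) e)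
    (hJ : ∀ a μ, ContDiffAt ℝ ∞ (fun e => J e a μ) e) (hdet : (gradH (J e)).det ≠ 0) :
    ContDiffAt ℝ ∞ (fun e => lag₁ (y e) (J e)) e := by
  change ContDiffAt ℝ ∞ (fun e => ∑ i, (y e).2 (Sum.inl i) * velOf (J e) i) e
  exact ContDiffAt.sum fun i _ => (hy (Sum.inl i)).mul (contDiffAt_velOf hJ hdet i)

theorem contDiffAt_lag₂ (hy : ∀ j, ContDiffAt ℝ ∞ (fun e => (y e).2 j) e)
    (hJ : ∀ a μ, ContDiffAt ℝ ∞ (fun e => J e a μ) e) (hdet : (gradH (J e)).det ≠ 0) :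
    ContDiffAt ℝ ∞ (fun e => lag₂ (y e) (J e)) e :=
  ((hJ ixChi ixTime).add (ContDiffAt.sum fun i _ => (contDiffAt_velOf hJ hdet i).mul
    (hJ ixChi (ixSpace i)))).mul (hy _)

theorem contDiffAt_lag₃ (hH : SmoothDensity P H) (hy : ∀ j, ContDiffAt ℝ ∞ (fun e => (y e).2 j) e)
    (hJ : ∀ a μ, ContDiffAt ℝ ∞ (fun e => J e a μ) e) (hρ : rhoOf (y e) ∈ P) :
    ContDiffAt ℝ ∞ (fun e => lag₃ H (y e) (J e)) e :=
  hH.comp_contDiffAt (contDiffAt_pi.2 fun _ => hy _) (hy _) (contDiffAt_pi.2 fun _ => hJ _ _) hρ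

end Smoothness

/-- The first variation of the action, after integration by parts: the boundary terms vanish in
space by periodicity, and in time because the variation vanishes at `t₁` and `t₂`. -/
theorem hasDerivAt_action (hH : SmoothDensity P H) {t₁ t₂ : ℝ} (h12 : t₁ ≤ t₂)
    (hΦ : SmoothField Φ) (hdet : ∀ x, timeOf x ∈ Icc t₁ t₂ → (gradH (jet Φ x)).det ≠ 0)
    (hρ : ∀ x, timeOf x ∈ Icc t₁ t₂ → rhoOf (Φ x) ∈ P) (hδ : SmoothFun δ)
    (h1 : ∀ x, δ (at_ x t₁) = 0) (h2 : ∀ x, δ (at_ x t₂) = 0) :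
    HasDerivAt (fun ε : ℝ => action H t₁ t₂ (vary Φ (ε • δ)))
      (∫ q in Icc t₁ t₂ ×ˢ cell, ∑ a, elResidual H Φ a (pt q) * δ (pt q) a) 0 := by
  set K := Icc t₁ t₂ ×ˢ cell with hK
  have hKc : IsCompact K := isCompact_Icc.prod isCompact_cell
  have hδa : ∀ a x, SmoothAt (fun y => δ y a) x := fun a x => smoothAt_pi.1 (hδ x) a
  set yy : ℝ × (ℝ × V3) → F := fun e => shift (Φ (pt e.2)) (e.1 • δ (pt e.2)) with hyy
  set JJ : ℝ × (ℝ × V3) → Matrix (Fin 3 ⊕ (Fin 3 ⊕ Unit ⊕ Unit)) (Fin 3 ⊕ Unit) ℝ :=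
    fun e => jet Φ (pt e.2) + e.1 • jetVar δ (pt e.2) with hJJ
  have hlift : ∀ {f : M → ℝ} (e : ℝ × (ℝ × V3)), SmoothAt f (pt e.2) →
      ContDiffAt ℝ ∞ (fun e : ℝ × (ℝ × V3) => f (pt e.2)) e := fun e hf =>
    hf.contDiffAt_pt.comp (f := fun e : ℝ × (ℝ × V3) => e.2) e contDiffAt_snd
  have hy : ∀ e j, ContDiffAt ℝ ∞ (fun e => (yy e).2 j) e := fun e j =>
    (hlift e (hΦ.smoothAt_snd j _)).add (contDiffAt_fst.mul (hlift e (hδa (Sum.inr j) _)))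
  have hJ : ∀ e a μ, ContDiffAt ℝ ∞ (fun e => JJ e a μ) e := fun e a μ =>
    (hlift e (hΦ.smoothAt_jet a μ _)).add
      (contDiffAt_fst.mul (hlift e ((hδa a _).smoothAt_pderiv μ)))
  have hyy0 : ∀ q, yy (0, q) = Φ (pt q) := fun q => by simp [hyy, shift_zero]
  have hJJ0 : ∀ q, JJ (0, q) = jet Φ (pt q) := fun q => by simp [hJJ]
  have hdet0 : ∀ q ∈ K, (gradH (JJ (0, q))).det ≠ 0 := fun q hq => by
    rw [hJJ0]; exact hdet _ hq.1
  have hρ0 : ∀ q ∈ K, rhoOf (yy (0, q)) ∈ P := fun q hq => by rw [hyy0]; exact hρ _ hq.1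
  have c1 : ∀ q ∈ K, ContDiffAt ℝ ∞ (fun e => lag₁ (yy e) (JJ e)) (0, q) := fun q hq =>
    contDiffAt_lag₁ (hy _) (hJ _) (hdet0 q hq)
  have c2 : ∀ q ∈ K, ContDiffAt ℝ ∞ (fun e => lag₂ (yy e) (JJ e)) (0, q) := fun q hq =>
    contDiffAt_lag₂ (hy _) (hJ _) (hdet0 q hq)
  have c3 : ∀ q ∈ K, ContDiffAt ℝ ∞ (fun e => lag₃ H (yy e) (JJ e)) (0, q) := fun q hq =>
    contDiffAt_lag₃ hH (hy _) (hJ _) (hρ0 q hq)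
  set f : ℝ × (ℝ × V3) → ℝ := fun e => lag₁ (yy e) (JJ e) + lag₂ (yy e) (JJ e) -
    lag₃ H (yy e) (JJ e) with hf
  have hfc : ∀ q ∈ K, ContDiffAt ℝ ∞ f (0, q) := fun q hq => ((c1 q hq).add (c2 q hq)).sub (c3 q hq)
  -- The three integrals of the action combine into one as soon as the integrands are continuous,
  -- which by compactness holds for all small `ε`.
  have hcts : ∀ {g : ℝ × (ℝ × V3) → ℝ}, (∀ q ∈ K, ContDiffAt ℝ ∞ g (0, q)) →
      ∀ᶠ ε : ℝ in nhds 0, ∀ q ∈ K, ContinuousAt g (ε, q) := fun {g} hg =>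
    hKc.eventually_forall_of_forall_eventually (P := fun ε q => ContinuousAt g (ε, q))
      fun q hq => by
        have : ContDiffAt ℝ 1 g (0, q) := (hg q hq).of_le (by simp)
        filter_upwards [this.eventually (by simp)] with z hz using hz.continuousAt
  have hact : (fun ε : ℝ => action H t₁ t₂ (vary Φ (ε • δ))) =ᶠ[nhds 0]
      fun ε => ∫ q in K, f (ε, q) := by
    filter_upwards [hcts c1, hcts c2, hcts c3] with ε k1 k2 k3
    have hslice : ∀ {g : ℝ × (ℝ × V3) → ℝ}, (∀ q ∈ K, ContinuousAt g (ε, q)) →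
        ∀ t ∈ Icc t₁ t₂, IntegrableOn (fun y => g (ε, (t, y))) cell := fun {g} hg t ht => by
      have : ContinuousOn (fun y => g (ε, (t, y))) cell := fun y hy =>
        ((hg (t, y) ⟨ht, hy⟩).comp (f := fun y : V3 => (ε, (t, y)))
          (by fun_prop)).continuousWithinAt
      exact this.integrableOn_compact isCompact_cell
    have hfK : IntegrableOn (fun q => f (ε, q)) K := by
      have : ContinuousOn (fun q => f (ε, q)) K := fun q hq =>
        ((((k1 q hq).add (k2 q hq)).sub (k3 q hq)).comp (f := fun q : ℝ × V3 => (ε, q))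
          (by fun_prop)).continuousWithinAt
      exact this.integrableOn_compact hKc
    rw [Measure.volume_eq_prod, hK] at *
    rw [setIntegral_prod _ hfK, action, intervalIntegral.integral_of_le h12,
      ← integral_Icc_eq_integral_Ioc]
    refine setIntegral_congr_fun measurableSet_Icc fun t ht => ?_
    rw [phaseLagrangian_eq]
    simp only [jet_vary hΦ hδ]
    have s1 := integral_add (hslice k1 t ht) (hslice k2 t ht)
    have s2 := integral_sub ((hslice k1 t ht).add (hslice k2 t ht)) (hslice k3 t ht)
    exact (congrArg (fun r => r - ∫ y in cell, lag₃ H (yy (ε, t, y)) (JJ (ε, t, y))) s1.symm).trans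
      s2.symm
  have hder := hasDerivAt_setIntegral_of_contDiffAt (μ := volume) hKc
    fun q hq => (hfc q hq).of_le (show (1 : WithTop ℕ∞) ≤ ∞ by simp)
  refine (hder.congr_of_eventuallyEq hact).congr_deriv ?_
  -- Integration by parts.
  set W : Fin 3 ⊕ Unit → M → ℝ := fun μ x => ∑ a, elMomentum H (Φ x) (jet Φ x) a μ * δ x a with hW
  have hWs : ∀ μ x, timeOf x ∈ Icc t₁ t₂ → SmoothAt (W μ) x := fun μ x hx =>
    SmoothAt.sum fun a _ => (hΦ.smoothAt_elMomentum hH (hdet x hx) (hρ x hx) a μ).mul (hδa a x)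
  have hpoint : ∀ q ∈ K, fderiv ℝ f (0, q) (1, 0) =
      (∑ a, elResidual H Φ a (pt q) * δ (pt q) a) + ∑ μ, pderiv μ (W μ) (pt q) := by
    intro q hq
    have d1 := ((hfc q hq).differentiableAt (by simp)).hasFDerivAt.comp_hasDerivAt (0 : ℝ)
      ((hasDerivAt_id (0 : ℝ)).prodMk (hasDerivAt_const (0 : ℝ) q))
    have d2 := hasDerivAt_lagrangian hH (pt q) (hdet (pt q) hq.1) (hρ (pt q) hq.1) (δ (pt q))
      (jetVar δ (pt q))
    have e : f ∘ (fun s : ℝ => (id s, q)) = fun s : ℝ => (epTheory H).lagrangian (pt q)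
        (shift (Φ (pt q)) (s • δ (pt q))) (jet Φ (pt q) + s • jetVar δ (pt q)) := by
      funext s
      rw [lagrangian_eq]
      rfl
    rw [e] at d1
    rw [d1.unique d2]
    have hWd : ∀ μ, pderiv μ (W μ) (pt q) =
        ∑ a, (pderiv μ (fun y => elMomentum H (Φ y) (jet Φ y) a μ) (pt q) * δ (pt q) a +
          elMomentum H (Φ (pt q)) (jet Φ (pt q)) a μ * jetVar δ (pt q) a μ) := fun μ => by
      have hm : ∀ a, SmoothAt (fun y => elMomentum H (Φ y) (jet Φ y) a μ) (pt q) := fun a =>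
        hΦ.smoothAt_elMomentum hH (hdet (pt q) hq.1) (hρ (pt q) hq.1) a μ
      rw [hW, SmoothAt.pderiv_sum fun a _ => (hm a).mul (hδa a _)]
      exact Finset.sum_congr rfl fun a _ => (hm a).pderiv_mul (hδa a _) μ
    simp only [hWd, elResidual, sub_mul, Finset.sum_sub_distrib, Finset.sum_add_distrib,
      Finset.sum_mul]
    rw [Finset.sum_comm (f := fun μ a => elMomentum H (Φ (pt q)) (jet Φ (pt q)) a μ *
      jetVar δ (pt q) a μ), Finset.sum_comm (f := fun μ a =>
      pderiv μ (fun y => elMomentum H (Φ y) (jet Φ y) a μ) (pt q) * δ (pt q) a)]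
    ring
  rw [setIntegral_congr_fun hKc.measurableSet hpoint]
  have hWi : ∀ μ, IntegrableOn (fun q => pderiv μ (W μ) (pt q)) K := fun μ => by
    have : ContinuousOn (fun q => pderiv μ (W μ) (pt q)) K := fun q hq =>
      (((hWs μ (pt q) hq.1).smoothAt_pderiv μ).contDiffAt_pt.continuousAt).continuousWithinAt
    exact this.integrableOn_compact hKc
  have hRi : IntegrableOn (fun q => ∑ a, elResidual H Φ a (pt q) * δ (pt q) a) K := by
    have : ContinuousOn (fun q => ∑ a, elResidual H Φ a (pt q) * δ (pt q) a) K := fun q hq =>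
      ((SmoothAt.sum fun a _ => (hΦ.smoothAt_elResidual hH (hdet (pt q) hq.1)
        (hρ (pt q) hq.1) a).mul (hδa a (pt q))).contDiffAt_pt.continuousAt).continuousWithinAt
    exact this.integrableOn_compact hKc
  rw [integral_add hRi (integrable_finsetSum _ fun μ _ => hWi μ),
    integral_finsetSum _ fun μ _ => hWi μ, Finset.sum_eq_zero, add_zero]
  intro μ _
  have hzero : ∀ x t, (∀ x, δ (at_ x t) = 0) → timeOf x = t → W μ x = 0 := by
    rintro x t h rfl
    have : δ x = 0 := h x.1
    simp [hW, this]
  exact integral_pderiv_eq_zero h12 (hWs μ) (fun x hx => hzero x t₁ h1 hx)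
    (fun x hx => hzero x t₂ h2 hx) μ

end Variation

/-! ### Critical paths -/

section Critical

open MeasureTheory

variable {P : Set ℝ} {H : V3 → ℝ → V3 → ℝ} {Φ : M → F}

/-- A diffeomorphism of the torus has an injective differential. -/
theorem IsDiffeoT3.fderiv_injective {f : T3 → T3} (hf : IsDiffeoT3 f) (x : T3) {w : V3}
    (hw : fderiv ℝ (fun v : V3 => fun a =>
      (f (fun i => x i + ((v i : ℝ) : Real.Angle)) a - f x a).toReal) 0 w = 0) : w = 0 := by
  obtain ⟨hfs, g, hgs, hgf, -⟩ := hf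
  set f' : V3 → V3 := fun v a =>
    (f (fun i => x i + ((v i : ℝ) : Real.Angle)) a - f x a).toReal with hf'
  set g' : V3 → V3 := fun v a =>
    (g (fun i => f x i + ((v i : ℝ) : Real.Angle)) a - g (f x) a).toReal with hg'
  have df : HasFDerivAt f' (fderiv ℝ f' 0) 0 := ((hfs x).differentiableAt (by simp)).hasFDerivAt
  have f0 : f' 0 = 0 := by
    funext a
    simp [hf']
  have dg : HasFDerivAt g' (fderiv ℝ g' 0) (f' 0) := by
    rw [f0]
    exact ((hgs (f x)).differentiableAt (by simp)).hasFDerivAt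
  have hcomp : ∀ v a, (g' (f' v)) a = ((v a : ℝ) : Real.Angle).toReal := fun v a => by
    have e : (fun i => f x i + ((f' v i : ℝ) : Real.Angle)) =
        f (fun i => x i + ((v i : ℝ) : Real.Angle)) := by
      funext i
      simp [hf']
    simp only [hg', e, hgf _]
    congr 1
    abel
  have hid : g' ∘ f' =ᶠ[nhds 0] id := by
    have hb : ∀ᶠ v : V3 in nhds 0, ∀ a, |v a| < Real.pi := by
      rw [Filter.eventually_all]
      intro a
      have : ContinuousAt (fun v : V3 => |v a|) 0 := (continuous_apply a).abs.continuousAt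
      exact this.eventually_lt_const (by simp [Real.pi_pos])
    filter_upwards [hb] with v hv
    funext a
    rw [Function.comp_apply, hcomp, id, Real.Angle.toReal_coe_eq_self_iff]
    have := abs_lt.1 (hv a)
    exact ⟨this.1, this.2.le⟩
  have h1 := (dg.comp 0 df).unique ((hasFDerivAt_id (𝕜 := ℝ) (0 : V3)).congr_of_eventuallyEq hid)
  have h2 := congrArg (fun A : V3 →L[ℝ] V3 => A w) h1
  simpa [hw] using h2.symm

/-- Along a path in `C₀` the matrix `∇h` is invertible: its transpose is the differential of the
diffeomorphism `h` at the given time. -/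
theorem IsPath.det_ne_zero {t₁ t₂ : ℝ} (hΦ : IsPath t₁ t₂ Φ) (x : M)
    (hx : timeOf x ∈ Icc t₁ t₂) : (gradH (jet Φ x)).det ≠ 0 := by
  intro h0
  obtain ⟨w, hw0, hw⟩ := Matrix.exists_vecMul_eq_zero_iff.2 h0
  apply hw0
  have hd := hΦ.diffeo _ hx
  apply hd.fderiv_injective x.1
  set f' : V3 → V3 := fun v a => (hOf (Φ (at_ (fun i => x.1 i + ((v i : ℝ) : Real.Angle))
    (timeOf x))) a - hOf (Φ (at_ x.1 (timeOf x))) a).toReal with hf'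
  have df : HasFDerivAt f' (fderiv ℝ f' 0) 0 := ((hd.1 x.1).differentiableAt (by simp)).hasFDerivAt
  have hi : ∀ i a, fderiv ℝ f' 0 (Pi.single i 1) a = gradH (jet Φ x) i a := fun i a => by
    have h1 := hasDerivAt_pi.1 (df.comp_hasDerivAt_of_eq (0 : ℝ) (hasDerivAt_single i (0 : ℝ))
      (by simp)) a
    rw [← h1.deriv]
    simp only [gradH, jet, Matrix.of_apply]
    congr 1
    funext s
    have e : shift x (Pi.single (ixSpace i) s) =
        at_ (fun j => x.1 j + (((Pi.single i s : V3) j : ℝ) : Real.Angle)) (timeOf x) := by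
      ext j
      · simp [shift, at_, ixSpace, Pi.single_apply]
      · simp [shift, at_, timeOf]
    rw [e]
    rfl
  change fderiv ℝ f' 0 w = 0
  have hw' : w = ∑ i, w i • (Pi.single i 1 : V3) := by
    funext j
    simp [Finset.sum_apply, Pi.single_apply]
  rw [hw', map_sum]
  funext a
  rw [Finset.sum_apply]
  simp only [map_smul, Pi.smul_apply, smul_eq_mul, hi]
  exact congrFun hw a

theorem smoothAt_comp_timeOf {η : ℝ → ℝ} (hη : ContDiff ℝ ∞ η) (x : M) :
    SmoothAt (fun y => η (timeOf y)) x := by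
  refine hη.contDiffAt.comp (f := fun v : Fin 3 ⊕ Unit → ℝ => timeOf (shift x v)) 0 ?_
  simp only [timeOf, shift]
  fun_prop

/-- A continuous nonnegative function on `[t₁, t₂] × [0, 2π]³` with vanishing integral vanishes. -/
theorem eq_zero_of_integral_eq_zero {t₁ t₂ : ℝ} (h12 : t₁ < t₂) {f : ℝ × V3 → ℝ}
    (hf : ContinuousOn f (Icc t₁ t₂ ×ˢ cell)) (h0 : ∀ q ∈ Icc t₁ t₂ ×ˢ cell, 0 ≤ f q)
    (hi : ∫ q in Icc t₁ t₂ ×ˢ cell, f q = 0) : ∀ q ∈ Icc t₁ t₂ ×ˢ cell, f q = 0 := by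
  have hKc : IsCompact (Icc t₁ t₂ ×ˢ cell) := isCompact_Icc.prod isCompact_cell
  have hae := (setIntegral_eq_zero_iff_of_nonneg_ae (μ := volume)
    (by filter_upwards [ae_restrict_mem hKc.measurableSet] with q hq using h0 q hq)
    (hf.integrableOn_compact hKc)).1 hi
  have hcl : Icc t₁ t₂ ×ˢ cell ⊆ closure (interior (Icc t₁ t₂ ×ˢ cell)) := by
    rw [interior_prod_eq, closure_prod_eq, interior_Icc, closure_Ioo h12.ne, cell,
      ← pi_univ_Icc, interior_pi_set finite_univ, closure_pi_set]
    refine prod_mono le_rfl (pi_mono fun i _ => ?_)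
    rw [interior_Icc, closure_Ioo]
    exact (show (0 : ℝ) < 2 * Real.pi by positivity).ne
  exact fun q hq => Measure.eqOn_of_ae_eq hae hf continuousOn_const hcl hq

/-- The fundamental lemma of the calculus of variations: a path is critical if and only if the
Euler–Lagrange expressions vanish. The test variation is the Euler–Lagrange expression itself,
times a function of time that is positive exactly on `(t₁, t₂)`. -/
theorem isCritical_iff_elResidual (hH : SmoothDensity P H) {t₁ t₂ : ℝ} (h12 : t₁ < t₂)
    (hΦ : SmoothField Φ) (hdet : ∀ x, timeOf x ∈ Icc t₁ t₂ → (gradH (jet Φ x)).det ≠ 0)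
    (hρ : ∀ x, timeOf x ∈ Icc t₁ t₂ → rhoOf (Φ x) ∈ P) :
    IsCritical H t₁ t₂ Φ ↔ ∀ x, timeOf x ∈ Icc t₁ t₂ → ∀ a, elResidual H Φ a x = 0 := by
  have hR : ∀ x, timeOf x ∈ Icc t₁ t₂ → ∀ a, SmoothAt (elResidual H Φ a) x := fun x hx a =>
    hΦ.smoothAt_elResidual hH (hdet x hx) (hρ x hx) a
  constructor
  · intro hcrit
    set η : ℝ → ℝ := fun t => expNegInvGlue (t - t₁) * expNegInvGlue (t₂ - t) with hη
    have hηs : ContDiff ℝ ∞ η :=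
      (expNegInvGlue.contDiff.comp (contDiff_id.sub contDiff_const)).mul
        (expNegInvGlue.contDiff.comp (contDiff_const.sub contDiff_id))
    have hη0 : ∀ t, t ≤ t₁ ∨ t₂ ≤ t → η t = 0 := by
      rintro t (ht | ht)
      · simp [hη, expNegInvGlue.zero_of_nonpos (sub_nonpos.2 ht)]
      · simp [hη, expNegInvGlue.zero_of_nonpos (sub_nonpos.2 ht)]
    have hηnn : ∀ t, 0 ≤ η t := fun t =>
      mul_nonneg (expNegInvGlue.nonneg _) (expNegInvGlue.nonneg _)
    set δ : M → (Fin 3 ⊕ (Fin 3 ⊕ Unit ⊕ Unit) → ℝ) :=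
      fun x a => η (timeOf x) * elResidual H Φ a x with hδ
    have hδs : SmoothFun δ := fun x => by
      by_cases hx : timeOf x ∈ Icc t₁ t₂
      · exact smoothAt_pi.2 fun a => (smoothAt_comp_timeOf hηs x).mul (hR x hx a)
      · -- Here `elResidual` need not be smooth, but `η` vanishes near `x`.
        refine SmoothAt.congr (smoothAt_const 0 x) ?_
        have ho := (smoothAt_comp_timeOf (η := id) contDiff_id x).eventually_mem
          (isClosed_Icc (a := t₁) (b := t₂)).isOpen_compl hx
        filter_upwards [ho] with v hv
        funext a
        have : η (timeOf (shift x v)) = 0 := hη0 _ (by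
          by_contra! hc
          exact hv ⟨hc.1.le, hc.2.le⟩)
        simp [hδ, this]
    have h1 : ∀ x, δ (at_ x t₁) = 0 := fun x => funext fun a => by
      simp [hδ, timeOf, at_, hη0 t₁ (Or.inl le_rfl)]
    have h2 : ∀ x, δ (at_ x t₂) = 0 := fun x => funext fun a => by
      simp [hδ, timeOf, at_, hη0 t₂ (Or.inr le_rfl)]
    have hint := (hasDerivAt_action hH h12.le hΦ hdet hρ hδs h1 h2).unique (hcrit δ hδs h1 h2)
    have hzero := eq_zero_of_integral_eq_zero h12
      (f := fun q => ∑ a, elResidual H Φ a (pt q) * δ (pt q) a)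
      (fun q hq => ((SmoothAt.sum fun a _ => (hR (pt q) hq.1 a).mul
        (smoothAt_pi.1 (hδs (pt q)) a)).contDiffAt_pt.continuousAt).continuousWithinAt)
      (fun q _ => Finset.sum_nonneg fun a _ => by
        have : elResidual H Φ a (pt q) * δ (pt q) a =
          η (timeOf (pt q)) * (elResidual H Φ a (pt q)) ^ 2 := by
            simp only [hδ]; ring
        rw [this]
        exact mul_nonneg (hηnn _) (sq_nonneg _)) hint
    -- At the endpoints `η` vanishes; there the claim follows by continuity.
    have hopen : ∀ x, timeOf x ∈ Ioo t₁ t₂ → ∀ a, elResidual H Φ a x = 0 := by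
      intro x hx a
      obtain ⟨y, hy, hxy⟩ := exists_pt x
      rw [← hxy]
      have hpos : 0 < η (timeOf x) :=
        mul_pos (expNegInvGlue.pos_of_pos (sub_pos.2 hx.1))
          (expNegInvGlue.pos_of_pos (sub_pos.2 hx.2))
      have h := hzero (timeOf x, y) ⟨⟨hx.1.le, hx.2.le⟩, hy⟩
      have e : ∀ a, elResidual H Φ a (pt (timeOf x, y)) * δ (pt (timeOf x, y)) a =
          η (timeOf x) * (elResidual H Φ a (pt (timeOf x, y))) ^ 2 := fun a => by
        simp only [hδ, timeOf_pt]; ring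
      simp only [e] at h
      have := (Finset.sum_eq_zero_iff_of_nonneg fun a _ =>
        mul_nonneg hpos.le (sq_nonneg _)).1 h a (Finset.mem_univ a)
      simpa [hpos.ne'] using this
    intro x hx a
    obtain ⟨y, hy, hxy⟩ := exists_pt x
    rw [← hxy]
    have hcont : ContinuousOn (fun t => elResidual H Φ a (pt (t, y))) (Icc t₁ t₂) := fun t ht =>
      (((hR (pt (t, y)) ht a).contDiffAt_pt.continuousAt).comp (f := fun t : ℝ => (t, y))
        (by fun_prop)).continuousWithinAt
    have hEq : EqOn (fun t => elResidual H Φ a (pt (t, y))) (fun _ => 0) (Ioo t₁ t₂) :=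
      fun t ht => hopen (pt (t, y)) ht a
    exact hEq.of_subset_closure hcont continuousOn_const Ioo_subset_Icc_self
      (by rw [closure_Ioo h12.ne]) hx
  · intro h δ hδ h1 h2
    have := hasDerivAt_action hH h12.le hΦ hdet hρ hδ h1 h2
    rwa [setIntegral_eq_zero_of_forall_eq_zero fun q hq => ?_] at this
    exact Finset.sum_eq_zero fun a _ => by rw [h (pt q) hq.1 a, zero_mul]

/-- Critical paths are the solutions of the extended system. -/
theorem isCritical_iff_extendedSystem (hH : SmoothDensity P H) (hpos : Ioi 0 ⊆ P) {t₁ t₂ : ℝ}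
    (h12 : t₁ < t₂) (hΦ : IsPath t₁ t₂ Φ) :
    IsCritical H t₁ t₂ Φ ↔ ExtendedSystem H (Icc t₁ t₂) Φ := by
  have hρ : ∀ x, timeOf x ∈ Icc t₁ t₂ → rhoOf (Φ x) ∈ P := fun x hx => hpos (hΦ.pos _ hx x.1)
  rw [isCritical_iff_elResidual hH h12 hΦ.smooth hΦ.det_ne_zero hρ,
    elResidual_eq_zero_iff_extendedSystem hH hΦ.smooth hΦ.det_ne_zero hρ]

/-- The Euler–Lagrange equations on spacetime are the extended system. -/
theorem eulerLagrange_iff_extendedSystem (hH : SmoothDensity P H) (hΦ : SmoothField Φ)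
    (hdet : ∀ x, (gradH (jet Φ x)).det ≠ 0) (hρ : ∀ x, rhoOf (Φ x) ∈ P) :
    (epTheory H).EulerLagrange Φ ↔ ExtendedSystem H univ Φ := by
  rw [eulerLagrange_iff_elResidual hH hdet hρ, ← elResidual_eq_zero_iff_extendedSystem hH hΦ
    (fun x _ => hdet x) fun x _ => hρ x]
  simp

end Critical

/-! ### Smooth flows of globally Lipschitz vector fields -/

section Flow

set_option linter.unusedSectionVars false

variable {K : Type} [TopologicalSpace K] [CompactSpace K]
  {E : Type} [NormedAddCommGroup E] [NormedSpace ℝ E]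
  {G : Type} [NormedAddCommGroup G] [NormedSpace ℝ G]

/-- Pointwise application of a continuous family of linear maps to a curve. -/
noncomputable def pointApply : C(K, E →L[ℝ] G) →L[ℝ] C(K, E) →L[ℝ] C(K, G) :=
  LinearMap.mkContinuous₂
    (LinearMap.mk₂ ℝ (fun (A : C(K, E →L[ℝ] G)) (γ : C(K, E)) =>
        (⟨fun t => A t (γ t), A.continuous.clm_apply γ.continuous⟩ : C(K, G)))
      (fun _ _ _ => by ext; simp) (fun _ _ _ => by ext; simp) (fun _ _ _ => by ext; simp)
      (fun _ _ _ => by ext; simp)) 1 fun A γ => by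
    rw [one_mul, ContinuousMap.norm_le _ (by positivity)]
    intro t
    refine ((A t).le_opNorm _).trans ?_
    gcongr
    exacts [A.norm_coe_le_norm t, γ.norm_coe_le_norm t]

theorem eventually_dist_postcomp_lt (X : C(E, G)) (γ : C(K, E)) {c : ℝ} (hc : 0 < c) :
    ∀ᶠ γ' in nhds γ, dist (X.comp γ') (X.comp γ) < c :=
  (Metric.tendsto_nhds.1 (ContinuousMap.continuous_postcomp X).continuousAt.tendsto) c hc

/-- The derivative of `γ ↦ X ∘ γ` on curves, by the mean value inequality applied to each value of
the curve. -/
theorem hasFDerivAt_postcomp {X : C(E, G)} {X' : C(E, E →L[ℝ] G)}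
    (hX : ∀ x, HasFDerivAt X (X' x) x) (γ : C(K, E)) :
    HasFDerivAt (fun γ : C(K, E) => X.comp γ) (pointApply (X'.comp γ)) γ := by
  rw [hasFDerivAt_iff_isLittleO, Asymptotics.isLittleO_iff]
  intro c hc
  obtain ⟨r, hr, hball⟩ := 
    Metric.eventually_nhds_iff_ball.1 (eventually_dist_postcomp_lt X' γ hc)
  filter_upwards [Metric.ball_mem_nhds γ hr] with γ' hγ'
  rw [ContinuousMap.norm_le _ (by positivity)]
  intro t
  -- The constant translate of `γ` which passes through `b` at `t` stays close to `γ`.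
  have hb : ∀ b ∈ Metric.ball (γ t) r, ‖X' b - X' (γ t)‖ ≤ c := fun b hb => by
    have hmem : γ + ContinuousMap.const K (b - γ t) ∈ Metric.ball γ r := by
      rw [mem_ball_iff_norm, add_sub_cancel_left]
      rw [mem_ball_iff_norm] at hb
      exact lt_of_le_of_lt ((ContinuousMap.norm_le _ (norm_nonneg _)).2 fun _ => le_rfl) hb
    have h1 := hball _ hmem
    have h2 := (ContinuousMap.dist_apply_le_dist t).trans h1.le
    rw [dist_eq_norm] at h2
    simpa using h2
  have hmem : γ' t ∈ Metric.ball (γ t) r :=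
    lt_of_le_of_lt (ContinuousMap.dist_apply_le_dist t) hγ'
  have key := (convex_ball (γ t) r).norm_image_sub_le_of_norm_hasFDerivWithin_le'
    (f := X) (φ := X' (γ t)) (fun b _ => (hX b).hasFDerivWithinAt) hb
    (Metric.mem_ball_self hr) hmem
  refine le_trans ?_ (key.trans (mul_le_mul_of_nonneg_left ((γ' - γ).norm_coe_le_norm t) hc.le))
  rfl

/-- The derivative of `γ ↦ X ∘ γ` at `γ` is given by `γ ↦ DX ∘ γ`, an operation of the same kind;
hence the induction is over all target spaces. -/
theorem contDiff_nat_postcomp (n : ℕ) : ∀ {G : Type} [NormedAddCommGroup G] [NormedSpace ℝ G]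
    {X : C(E, G)}, ContDiff ℝ n X → ContDiff ℝ n (fun γ : C(K, E) => X.comp γ) := by
  induction n with
  | zero =>
    intro G _ _ X _
    exact contDiff_zero.2 (ContinuousMap.continuous_postcomp X)
  | succ n ih =>
    intro G _ _ X hX
    have hX' : ContDiff ℝ n (fderiv ℝ X) := by
      refine hX.fderiv_right ?_
      norm_cast
    set X' : C(E, E →L[ℝ] G) := ⟨fderiv ℝ X, hX'.continuous⟩ with hXdef
    push_cast
    refine contDiff_succ_iff_hasFDerivAt.2
      ⟨fun γ => pointApply (X'.comp γ), ?_, ?_⟩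
    · have h1 : ContDiff ℝ n (fun γ : C(K, E) => X'.comp γ) := ih (X := X') hX'
      exact ContDiff.comp (g := fun A : C(K, E →L[ℝ] G) => pointApply A)
        (ContinuousLinearMap.contDiff _) h1
    exact hasFDerivAt_postcomp fun x => (hX.differentiable (by simp) x).hasFDerivAt

/-- Composition with a smooth map is a smooth operation on curves. -/
theorem contDiff_postcomp {X : C(E, G)} (hX : ContDiff ℝ ∞ X) :
    ContDiff ℝ ∞ (fun γ : C(K, E) => X.comp γ) :=
  contDiff_infty.2 fun n => contDiff_nat_postcomp n (hX.of_le (by exact_mod_cast le_top))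

theorem norm_integral_IccExtend_le (γ : C(Icc (-1 : ℝ) 1, E)) (t : Icc (-1 : ℝ) 1) :
    ‖∫ τ in (0 : ℝ)..t, IccExtend (by norm_num : (-1 : ℝ) ≤ 1) γ τ‖ ≤ ‖γ‖ := by
  have h := intervalIntegral.norm_integral_le_of_norm_le_const (a := 0) (b := (t : ℝ))
    (f := fun τ => IccExtend (by norm_num : (-1 : ℝ) ≤ 1) γ τ) (C := ‖γ‖)
    fun τ _ => γ.norm_coe_le_norm _
  refine h.trans (mul_le_of_le_one_right (norm_nonneg _) ?_)
  rw [sub_zero, abs_le]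
  exact t.2

/-- The primitive `t ↦ ∫₀ᵗ γ` of a curve over `[-1, 1]`, as a continuous linear operator on
curves. -/
noncomputable def volterra : C(Icc (-1 : ℝ) 1, E) →L[ℝ] C(Icc (-1 : ℝ) 1, E) :=
  have hint : ∀ (γ : C(Icc (-1 : ℝ) 1, E)) (a b : ℝ), IntervalIntegrable
      (fun τ => IccExtend (by norm_num : (-1 : ℝ) ≤ 1) γ τ) MeasureTheory.volume a b :=
    fun γ a b => (γ.continuous.Icc_extend' (h := by norm_num)).intervalIntegrable a b
  LinearMap.mkContinuous
    { toFun := fun γ => ⟨fun t => ∫ τ in (0 : ℝ)..t, IccExtend (by norm_num : (-1 : ℝ) ≤ 1) γ τ,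
        (intervalIntegral.continuous_primitive (hint γ) 0).comp continuous_subtype_val⟩
      map_add' := fun γ γ' => by
        ext t
        exact intervalIntegral.integral_add (hint γ 0 t) (hint γ' 0 t)
      map_smul' := fun c γ => by
        ext t
        exact intervalIntegral.integral_smul c _ } 1 fun γ => by
    rw [one_mul, ContinuousMap.norm_le _ (norm_nonneg _)]
    exact norm_integral_IccExtend_le γ

theorem volterra_apply (γ : C(Icc (-1 : ℝ) 1, E)) (t : Icc (-1 : ℝ) 1) :
    volterra γ t = ∫ τ in (0 : ℝ)..t, IccExtend (by norm_num : (-1 : ℝ) ≤ 1) γ τ := rfl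

theorem norm_volterra_le (γ : C(Icc (-1 : ℝ) 1, E)) : ‖volterra γ‖ ≤ ‖γ‖ := by
  exact (ContinuousMap.norm_le _ (norm_nonneg _)).2 (norm_integral_IccExtend_le γ)

end Flow

section GlobalFlow

set_option linter.unusedSectionVars false

variable {E : Type} [NormedAddCommGroup E] [NormedSpace ℝ E]

open scoped NNReal Manifold

/-- Integral curves of a globally Lipschitz vector field exist for all time: Picard-Lindelöf gives
a uniform existence time. -/
theorem exists_integralCurve [CompleteSpace E] {X : E → E} (hX : ContDiff ℝ ∞ X)
    {K : ℝ≥0} (hK : LipschitzWith K X)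
    (x : E) : ∃ c : ℝ → E, c 0 = x ∧ ∀ t, HasDerivAt c (X (c t)) t := by
  have hv : ContMDiff 𝓘(ℝ, E) 𝓘(ℝ, E).tangent 1
      (fun x => (⟨x, X x⟩ : TangentBundle 𝓘(ℝ, E) E)) :=
    contMDiff_vectorSpace_iff_contDiff.2 (hX.of_le (by norm_cast))
  set ε : ℝ := 1 / (K + 1)
  have hε : 0 < ε := by positivity
  have hloc : ∀ x : E, ∃ γ : ℝ → E, γ 0 = x ∧
      IsMIntegralCurveOn (I := 𝓘(ℝ, E)) γ X (Ioo (-ε) ε) := by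
    intro x
    have h0 : (0 : ℝ) ∈ Icc (-ε) ε := ⟨by linarith, hε.le⟩
    -- On the ball of radius `‖X x‖` around `x` the field is bounded by `(K + 1) ‖X x‖`.
    have hpl : IsPicardLindelof (fun _ => X) (tmin := -ε) (tmax := ε) ⟨0, h0⟩ x
        ‖X x‖₊ 0 ((K + 1) * ‖X x‖₊) K := by
      refine .of_time_independent (fun y hy => ?_) hK.lipschitzOnWith ?_
      · have h1 := hK.dist_le_mul y x
        rw [dist_eq_norm] at h1
        have h2 : ‖X y‖ ≤ ‖X y - X x‖ + ‖X x‖ := by simpa using norm_add_le (X y - X x) (X x)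
        have h3 : (K : ℝ) * dist y x ≤ K * ‖X x‖ :=
          mul_le_mul_of_nonneg_left (Metric.mem_closedBall.1 hy) K.2
        push_cast
        linarith
      · have : max (ε - 0) (0 - -ε) = ε := by simp
        simp only [this]
        push_cast
        simp only [ε]
        have : (K : ℝ) + 1 ≠ 0 := by positivity
        field_simp
        simp
    obtain ⟨α, hα0, hα⟩ := hpl.exists_eq_forall_mem_Icc_hasDerivWithinAt₀
    refine ⟨α, hα0, fun t ht => ?_⟩
    have h1 : HasDerivAt α (X (α t)) t :=
      (hα t ⟨ht.1.le, ht.2.le⟩).hasDerivAt (Icc_mem_nhds ht.1 ht.2)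
    exact h1.hasFDerivAt.hasMFDerivAt.hasMFDerivWithinAt
  obtain ⟨γ, h0, hγ⟩ := exists_isMIntegralCurve_of_isMIntegralCurveOn hv hε hloc x
  exact ⟨γ, h0, fun t => (hγ t).hasFDerivAt⟩

theorem integralCurve_unique {X : E → E} {K : ℝ≥0} (hK : LipschitzWith K X) {c d : ℝ → E}
    (hc : ∀ t, HasDerivAt c (X (c t)) t) (hd : ∀ t, HasDerivAt d (X (d t)) t) {t₀ : ℝ}
    (h : c t₀ = d t₀) : c = d :=
  ODE_solution_unique_univ (v := fun _ => X) (s := fun _ => univ) (K := K)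
    (fun _ => hK.lipschitzOnWith) (fun t => ⟨hc t, trivial⟩) (fun t => ⟨hd t, trivial⟩) h

/-- The constant curves, depending linearly on their value. -/
noncomputable def constCurve : E →L[ℝ] C(Icc (-1 : ℝ) 1, E) :=
  LinearMap.mkContinuous
    { toFun := fun x => ContinuousMap.const _ x
      map_add' := fun _ _ => rfl
      map_smul' := fun _ _ => rfl } 1 fun x => by
    rw [one_mul]
    exact (ContinuousMap.norm_le _ (norm_nonneg _)).2 fun _ => le_rfl

theorem constCurve_apply (x : E) (t : Icc (-1 : ℝ) 1) : constCurve x t = x := rfl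

theorem contDiff_eval (t : Icc (-1 : ℝ) 1) :
    ContDiff ℝ ∞ (fun γ : C(Icc (-1 : ℝ) 1, E) => γ t) :=
  IsBoundedLinearMap.contDiff
    ⟨⟨fun _ _ => rfl, fun _ _ => rfl⟩, 1, one_pos, fun γ => by
      rw [one_mul]; exact γ.norm_coe_le_norm t⟩

/-- The defect of a curve `γ` in the integral equation `γ(t) = x + s ∫₀ᵗ X(γ)`. -/
noncomputable def flowDefect (X : C(E, E)) (q : (ℝ × E) × C(Icc (-1 : ℝ) 1, E)) :
    C(Icc (-1 : ℝ) 1, E) :=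
  q.2 - constCurve q.1.2 - q.1.1 • volterra (X.comp q.2)

theorem contDiff_flowDefect {X : C(E, E)} (hX : ContDiff ℝ ∞ X) : ContDiff ℝ ∞ (flowDefect X) := by
  have h1 : ContDiff ℝ ∞ (fun q : (ℝ × E) × C(Icc (-1 : ℝ) 1, E) => X.comp q.2) :=
    (contDiff_postcomp hX).comp contDiff_snd
  have h2 : ContDiff ℝ ∞ (fun q : (ℝ × E) × C(Icc (-1 : ℝ) 1, E) => volterra (X.comp q.2)) :=
    ContDiff.comp (g := fun γ : C(Icc (-1 : ℝ) 1, E) => volterra γ)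
      (ContinuousLinearMap.contDiff _) h1
  have h3 : ContDiff ℝ ∞ (fun q : (ℝ × E) × C(Icc (-1 : ℝ) 1, E) => constCurve q.1.2) :=
    ContDiff.comp (g := fun x : E => constCurve x) (ContinuousLinearMap.contDiff _)
      (contDiff_snd.comp contDiff_fst)
  exact (contDiff_snd.sub h3).sub ((contDiff_fst.comp contDiff_fst).smul h2)

theorem norm_postcomp_sub_le {X : C(E, E)} {K : ℝ≥0} (hK : LipschitzWith K X)
    (γ γ' : C(Icc (-1 : ℝ) 1, E)) : ‖X.comp γ - X.comp γ'‖ ≤ K * ‖γ - γ'‖ := by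
  refine (ContinuousMap.norm_le _ (by positivity)).2 fun t => ?_
  have h1 := hK.norm_sub_le (γ t) (γ' t)
  exact h1.trans (mul_le_mul_of_nonneg_left ((γ - γ').norm_coe_le_norm t) K.2)

/-- The integral equation has at most one solution for short times. -/
theorem flowDefect_injective {X : C(E, E)} {K : ℝ≥0} (hK : LipschitzWith K X) {s : ℝ}
    (hs : |s| * K < 1) {x : E} {γ γ' : C(Icc (-1 : ℝ) 1, E)}
    (h : flowDefect X ((s, x), γ) = flowDefect X ((s, x), γ')) : γ = γ' := by
  have h1 : γ - γ' = s • volterra (X.comp γ - X.comp γ') := by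
    rw [map_sub, smul_sub]
    simp only [flowDefect] at h
    rw [sub_right_comm, sub_right_comm γ', sub_left_inj] at h
    rw [← sub_eq_zero, ← sub_eq_zero.2 h]
    abel
  have h2 : ‖γ - γ'‖ ≤ |s| * K * ‖γ - γ'‖ := by
    calc ‖γ - γ'‖ = |s| * ‖volterra (X.comp γ - X.comp γ')‖ := by
          conv_lhs => rw [h1, norm_smul, Real.norm_eq_abs]
      _ ≤ |s| * (K * ‖γ - γ'‖) := by
          gcongr
          exact (norm_volterra_le _).trans (norm_postcomp_sub_le hK γ γ')
      _ = _ := by ring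
  have h3 : ‖γ - γ'‖ = 0 := by
    have := norm_nonneg (γ - γ')
    nlinarith
  exact sub_eq_zero.1 (norm_eq_zero.1 h3)

/-- The derivative of the defect in the curve is invertible for short times. -/
theorem isInvertible_fderiv_flowDefect [CompleteSpace E] {X : C(E, E)}
    (hX : ContDiff ℝ ∞ X) {K : ℝ≥0} (hK : LipschitzWith K X) {s : ℝ} (hs : |s| * K < 1) (x : E) (γ : C(Icc (-1 : ℝ) 1, E)) :
    (fderiv ℝ (flowDefect X) ((s, x), γ) ∘L
      .inr ℝ (ℝ × E) C(Icc (-1 : ℝ) 1, E)).IsInvertible := by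
  set X' : C(E, E →L[ℝ] E) := ⟨fderiv ℝ X, hX.continuous_fderiv (by simp)⟩
  set A : C(Icc (-1 : ℝ) 1, E) →L[ℝ] C(Icc (-1 : ℝ) 1, E) :=
    s • (volterra ∘L pointApply (X'.comp γ)) with hA
  have h1 : HasFDerivAt (fun γ' => flowDefect X ((s, x), γ')) (1 - A) γ := by
    have h2 := hasFDerivAt_postcomp (X := X) (X' := X')
      (fun x => (hX.differentiable (by simp) x).hasFDerivAt) γ
    have h3 := (volterra.hasFDerivAt.comp γ h2).const_smul s
    exact ((hasFDerivAt_id γ).sub_const (constCurve x)).sub h3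
  have h4 : HasFDerivAt (fun γ' => flowDefect X ((s, x), γ'))
      (fderiv ℝ (flowDefect X) ((s, x), γ) ∘L .inr ℝ (ℝ × E) C(Icc (-1 : ℝ) 1, E)) γ :=
    ((contDiff_flowDefect hX).differentiable (by simp) ((s, x), γ)).hasFDerivAt.comp γ
      (hasFDerivAt_prodMk_right (s, x) γ)
  rw [h4.unique h1]
  have hA1 : ‖A‖ < 1 := by
    refine lt_of_le_of_lt (A.opNorm_le_bound (M := |s| * K) (by positivity) fun γ' => ?_) hs
    have h5 : ‖pointApply (X'.comp γ) γ'‖ ≤ K * ‖γ'‖ := by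
      refine (ContinuousMap.norm_le _ (by positivity)).2 fun t => ?_
      refine ((fderiv ℝ X (γ t)).le_opNorm _).trans ?_
      gcongr
      · exact norm_fderiv_le_of_lipschitz ℝ hK
      · exact γ'.norm_coe_le_norm t
    calc ‖A γ'‖ = |s| * ‖volterra (pointApply (X'.comp γ) γ')‖ := by
          rw [hA]; simp [norm_smul]
      _ ≤ |s| * (K * ‖γ'‖) := by
          gcongr
          exact (norm_volterra_le _).trans h5
      _ = _ := by ring
  obtain ⟨e, he⟩ := isUnit_one_sub_of_norm_lt_one
    (R := C(Icc (-1 : ℝ) 1, E) →L[ℝ] C(Icc (-1 : ℝ) 1, E)) hA1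
  exact ⟨ContinuousLinearEquiv.unitsEquiv ℝ _ e, by ext1 y; exact DFunLike.congr_fun he y⟩

/-- Rescaled integral curves solve the integral equation. -/
theorem flowDefect_integralCurve [CompleteSpace E] {X : C(E, E)} {c : ℝ → E}
    (hc : ∀ t, HasDerivAt c (X (c t)) t) (s : ℝ) (γ : C(Icc (-1 : ℝ) 1, E))
    (hγ : ∀ t, γ t = c (s * t)) : flowDefect X ((s, c 0), γ) = 0 := by
  have hcc : Continuous c := continuous_iff_continuousAt.2 fun t => (hc t).continuousAt
  ext t
  have h1 : ∀ τ : ℝ, HasDerivAt (fun τ => c (s * τ)) (s • X (c (s * τ))) τ := fun τ => by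
    have := (hc (s * τ)).scomp τ ((hasDerivAt_id τ).const_mul s)
    simpa [Function.comp_def] using this
  have h2 := intervalIntegral.integral_eq_sub_of_hasDerivAt (a := 0) (b := (t : ℝ))
    (fun τ _ => h1 τ) (Continuous.intervalIntegrable (by fun_prop) _ _)
  rw [intervalIntegral.integral_smul] at h2
  have h3 : volterra (X.comp γ) t = ∫ τ in (0 : ℝ)..t, X (c (s * τ)) := by
    rw [volterra_apply]
    refine intervalIntegral.integral_congr fun τ hτ => ?_
    have hτ' : τ ∈ Icc (-1 : ℝ) 1 := by
      rw [uIcc, mem_Icc] at hτ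
      exact ⟨(le_min (by norm_num) t.2.1).trans hτ.1, hτ.2.trans (max_le (by norm_num) t.2.2)⟩
    simp only [IccExtend_of_mem _ _ hτ', ContinuousMap.comp_apply, hγ]
  simp only [flowDefect, ContinuousMap.sub_apply, ContinuousMap.smul_apply, constCurve_apply, h3,
    h2, hγ, ContinuousMap.zero_apply]
  simp

/-- The flow of a smooth, globally Lipschitz vector field: it exists for all times and is smooth.
For short times, smoothness is the implicit function theorem for the integral equation in the
Banach space of curves; longer times are reached by doubling. -/
theorem exists_smooth_flow [CompleteSpace E] {X : E → E} (hX : ContDiff ℝ ∞ X)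
    {K : ℝ≥0} (hK : LipschitzWith K X) :
    ∃ Ψ : ℝ → E → E, ContDiff ℝ ∞ (fun q : ℝ × E => Ψ q.1 q.2) ∧ (∀ x, Ψ 0 x = x) ∧
      ∀ s x, HasDerivAt (fun s => Ψ s x) (X (Ψ s x)) s := by
  choose c hc0 hc using exists_integralCurve hX hK
  have hcc : ∀ x, Continuous (c x) := fun x =>
    continuous_iff_continuousAt.2 fun t => (hc x t).continuousAt
  refine ⟨fun s x => c x s, ?_, hc0, fun s x => hc x s⟩
  set Xc : C(E, E) := ⟨X, hX.continuous⟩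
  -- For `|s| K < 1`, the rescaled integral curve is the implicit function of `flowDefect`.
  have hshort : ∀ (s : ℝ) (x : E), |s| * K < 1 →
      ContDiffAt ℝ ∞ (fun q : ℝ × E => c q.2 q.1) (s, x) := by
    intro s x hs
    let γ : ℝ × E → C(Icc (-1 : ℝ) 1, E) := fun q =>
      ⟨fun t => c q.2 (q.1 * t), (hcc q.2).comp (by fun_prop)⟩
    have hγ : ∀ q : ℝ × E, flowDefect Xc (q, γ q) = 0 := fun q => by
      have := flowDefect_integralCurve (X := Xc) (hc q.2) q.1 (γ q) fun t => rfl
      rwa [hc0] at this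
    have hsm : ContDiffAt ℝ ∞ (flowDefect Xc) ((s, x), γ (s, x)) :=
      (contDiff_flowDefect hX).contDiffAt
    have hinv := isInvertible_fderiv_flowDefect (X := Xc) hX hK hs x (γ (s, x))
    have hψ := hsm.contDiffAt_implicitFunction (by simp) hinv
    have heq := hsm.eventually_apply_implicitFunction (by simp) hinv
    have hev : ContDiffAt ℝ ∞ (fun q : ℝ × E =>
        hsm.implicitFunction (by simp) hinv q (⟨1, by norm_num⟩ : Icc (-1 : ℝ) 1)) (s, x) :=
      ContDiffAt.comp (g := fun γ : C(Icc (-1 : ℝ) 1, E) => γ ⟨1, by norm_num⟩) (s, x)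
        (contDiff_eval _).contDiffAt hψ
    refine hev.congr_of_eventuallyEq ?_
    have hnear : ∀ᶠ q : ℝ × E in nhds (s, x), |q.1| * K < 1 :=
      (Continuous.continuousAt (by fun_prop)).eventually_lt_const hs
    filter_upwards [heq, hnear] with q hq hq1
    rw [hγ] at hq
    have := flowDefect_injective (X := Xc) hK (s := q.1) (x := q.2) hq1 (hq.trans (hγ q).symm)
    rw [this]
    simp [γ]
  have hgroup : ∀ s x, c x s = c (c x (s / 2)) (s / 2) := by
    intro s x
    have h := integralCurve_unique hK (c := fun t => c x (t + s / 2)) (d := c (c x (s / 2)))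
      (fun t => (hc x (t + s / 2)).comp_add_const t (s / 2)) (hc _) (t₀ := 0) (by simp [hc0])
    have := congrFun h (s / 2)
    simpa using this
  -- Doubling the time: `c x s` is obtained by flowing twice for the time `s / 2`.
  have hall : ∀ n : ℕ, ∀ (s : ℝ) (x : E), |s| * K < 2 ^ n →
      ContDiffAt ℝ ∞ (fun q : ℝ × E => c q.2 q.1) (s, x) := by
    intro n
    induction n with
    | zero => simpa using hshort
    | succ n ih =>
      intro s x hs
      have hs2 : |s / 2| * K < 2 ^ n := by
        rw [abs_div, abs_two]
        rw [pow_succ] at hs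
        linarith
      have h1 : ContDiffAt ℝ ∞ (fun q : ℝ × E => c q.2 (q.1 / 2)) (s, x) :=
        ContDiffAt.comp (g := fun q : ℝ × E => c q.2 q.1) (s, x) (ih (s / 2) x hs2)
          (f := fun q : ℝ × E => (q.1 / 2, q.2)) (by fun_prop)
      have h2 : ContDiffAt ℝ ∞ (fun q : ℝ × E => c (c q.2 (q.1 / 2)) (q.1 / 2)) (s, x) :=
        ContDiffAt.comp (g := fun q : ℝ × E => c q.2 q.1) (s, x) (ih (s / 2) _ hs2)
          (f := fun q : ℝ × E => (q.1 / 2, c q.2 (q.1 / 2))) (ContDiffAt.prodMk (by fun_prop) h1)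
      exact h2.congr_of_eventuallyEq (Filter.Eventually.of_forall fun q => hgroup q.1 q.2)
  refine contDiff_iff_contDiffAt.2 fun q => ?_
  obtain ⟨n, hn⟩ := pow_unbounded_of_one_lt (|q.1| * K) (one_lt_two)
  exact hall n q.1 q.2 hn

end GlobalFlow

/-! ### Transport along the trajectories of a velocity field on the torus -/

section Transport

/-- The universal cover `ℝ³ × ℝ` of `M`; the covering map is `shift 0`. -/
abbrev Cover : Type := Fin 3 ⊕ Unit → ℝ

/-- The deck transformations of the cover are the translations by `w` with `shift 0 w = 0`. -/
theorem shift_add_period {v w : Cover} (hw : shift (0 : M) w = 0) :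
    shift (0 : M) (v + w) = shift 0 v := by
  rw [add_comm, ← shift_shift, hw]

theorem SmoothFun.contDiff_cover {E : Type} [NormedAddCommGroup E] [NormedSpace ℝ E] {f : M → E}
    (hf : SmoothFun f) : ContDiff ℝ ∞ (fun v : Cover => f (shift 0 v)) :=
  contDiff_iff_contDiffAt.2 fun _ => smoothAt_shift_iff.1 (hf _)

/-- A smooth function on `M` which is constant for large times is globally Lipschitz on the
universal cover, since its derivative there is periodic. -/
theorem SmoothFun.exists_lipschitzWith {E : Type} [NormedAddCommGroup E] [NormedSpace ℝ E]
    {f : M → E} (hf : SmoothFun f) {R : ℝ} {c : E} (hR : ∀ x, R < |timeOf x| → f x = c) :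
    ∃ K, LipschitzWith K (fun v : Cover => f (shift 0 v)) := by
  have hd := hf.contDiff_cover
  have hc : Continuous (fderiv ℝ fun v : Cover => f (shift 0 v)) :=
    hd.continuous_fderiv (by simp)
  obtain ⟨C, hC⟩ := (isCompact_closedBall (0 : Cover) (max Real.pi R)).exists_bound_of_continuousOn
    hc.continuousOn
  refine ⟨C.toNNReal, lipschitzWith_of_nnnorm_fderiv_le (hd.differentiable (by simp)) fun v => ?_⟩
  rw [← NNReal.coe_le_coe, coe_nnnorm]
  refine le_trans ?_ (Real.le_coe_toNNReal C)
  have hC0 : 0 ≤ C := (norm_nonneg _).trans (hC 0 (Metric.mem_closedBall_self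
    (Real.pi_pos.le.trans (le_max_left _ _))))
  by_cases hv : R < |v (Sum.inr ())|
  · have h1 : (fun v : Cover => f (shift 0 v)) =ᶠ[nhds v] fun _ => c := by
      have h2 : Continuous fun v : Cover => |v (Sum.inr ())| := by fun_prop
      filter_upwards [h2.continuousAt.eventually_const_lt hv] with w hw
      exact hR _ (by simpa [timeOf, shift] using hw)
    rw [h1.fderiv_eq, fderiv_fun_const]
    simpa using hC0
  · -- Move `v` by a deck transformation to a point `w` with spatial coordinates in `(-π, π]`.
    set w : Cover := relCoord (shift (0 : M) v) 0 with hw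
    have h1 : shift (0 : M) w = shift 0 v := shift_relCoord _ _
    have h2 : ∀ u : Cover, f (shift 0 (v + u)) = f (shift 0 (w + u)) := fun u => by
      rw [← shift_shift, ← shift_shift, h1]
    have h3 : fderiv ℝ (fun v : Cover => f (shift 0 v)) v =
        fderiv ℝ (fun v : Cover => f (shift 0 v)) w := by
      have e1 := fderiv_comp_add_left (𝕜 := ℝ) (f := fun v : Cover => f (shift 0 v)) v (x := 0)
      have e2 := fderiv_comp_add_left (𝕜 := ℝ) (f := fun v : Cover => f (shift 0 v)) w (x := 0)
      simp only [add_zero] at e1 e2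
      rw [← e1, ← e2]
      simp only [h2]
    rw [h3]
    refine hC w (mem_closedBall_zero_iff.2 ((pi_norm_le_iff_of_nonneg
      (Real.pi_pos.le.trans (le_max_left _ _))).2 fun μ => ?_))
    obtain i | ⟨⟩ := μ
    · have h4 : ‖w (Sum.inl i)‖ ≤ Real.pi := by
        rw [Real.norm_eq_abs]
        exact Real.Angle.abs_toReal_le_pi ((shift (0 : M) v).1 i - (0 : M).1 i)
      exact h4.trans (le_max_left _ _)
    · refine le_trans ?_ (le_max_right _ _)
      simpa [hw, relCoord, shift] using hv

/-- The flow on `Cover × ℝ` of the field `(v, c) ↦ Z (shift 0 v)`: it moves with unit speed in time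
if `Z` does, and it commutes with deck transformations and with translations of `c`. -/
theorem exists_cover_flow {Z : M → Cover × ℝ} (hZ : SmoothFun Z) {R : ℝ} {c₀ : Cover × ℝ}
    (hR : ∀ x, R < |timeOf x| → Z x = c₀) (hone : ∀ x, (Z x).1 (Sum.inr ()) = 1) :
    ∃ Ψ : ℝ → Cover × ℝ → Cover × ℝ, ContDiff ℝ ∞ (fun q : ℝ × Cover × ℝ => Ψ q.1 q.2) ∧
      (∀ z, Ψ 0 z = z) ∧
      (∀ s z, HasDerivAt (fun s => Ψ s z) (Z (shift 0 (Ψ s z).1)) s) ∧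
      (∀ s s' z, Ψ (s + s') z = Ψ s (Ψ s' z)) ∧
      (∀ s z, (Ψ s z).1 (Sum.inr ()) = z.1 (Sum.inr ()) + s) ∧
      ∀ s z (w : Cover) (d : ℝ), shift (0 : M) w = 0 → Ψ s (z + (w, d)) = Ψ s z + (w, d) := by
  obtain ⟨K, hK⟩ := hZ.exists_lipschitzWith hR
  have hX : ContDiff ℝ ∞ (fun z : Cover × ℝ => Z (shift 0 z.1)) :=
    hZ.contDiff_cover.comp contDiff_fst
  have hXK : LipschitzWith (K * 1) (fun z : Cover × ℝ => Z (shift 0 z.1)) :=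
    hK.comp LipschitzWith.prod_fst
  obtain ⟨Ψ, hΨ, h0, hd⟩ := exists_smooth_flow hX hXK
  refine ⟨Ψ, hΨ, h0, hd, fun s s' z => ?_, fun s z => ?_, fun s z w d hw => ?_⟩
  · have h := integralCurve_unique hXK (c := fun t => Ψ (t + s') z) (d := fun t => Ψ t (Ψ s' z))
      (fun t => (hd (t + s') z).comp_add_const t s') (fun t => hd t _) (t₀ := 0) (by simp [h0])
    exact congrFun h s
  · have h1 : ∀ t, HasDerivAt (fun t => (Ψ t z).1 (Sum.inr ()) - t) 0 t := fun t => by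
      have h2 : HasDerivAt (fun t => (Ψ t z).1) (Z (shift 0 (Ψ t z).1)).1 t :=
        (ContinuousLinearMap.fst ℝ Cover ℝ).hasFDerivAt.comp_hasDerivAt t (hd t z)
      have h3 := (hasDerivAt_pi.1 h2 (Sum.inr ())).sub (hasDerivAt_id t)
      rwa [hone, sub_self] at h3
    have h4 := is_const_of_deriv_eq_zero (fun t => (h1 t).differentiableAt)
      (fun t => (h1 t).deriv) s 0
    simp only [h0, sub_zero] at h4
    linarith
  · have h := integralCurve_unique hXK (c := fun t => Ψ t (z + (w, d)))
      (d := fun t => Ψ t z + (w, d)) (fun t => hd t _) (fun t => ?_) (t₀ := 0) (by simp [h0])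
    · exact congrFun h s
    · have h1 := (hd t z).add_const (w, d)
      simp only [Prod.fst_add, shift_add_period hw]
      exact h1

theorem eventually_toReal_coe_eq {V : Type*} [TopologicalSpace V] {f : V → ℝ} {x : V}
    (hf : ContinuousAt f x) (h0 : f x = 0) :
    ∀ᶠ v in nhds x, ((f v : ℝ) : Real.Angle).toReal = f v := by
  have h1 : ∀ᶠ v in nhds x, f v ∈ Ioo (-Real.pi) Real.pi :=
    hf.eventually_mem (Ioo_mem_nhds (by simp [h0, Real.pi_pos]) (by simp [h0, Real.pi_pos]))
  filter_upwards [h1] with v hv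
  exact Real.Angle.toReal_coe_eq_self_iff.2 ⟨hv.1, hv.2.le⟩

/-- A self-map of the torus with a smooth lift is smooth. -/
theorem smoothT3_of_lift {q : T3 → T3} {Q : V3 → V3} (hQ : ContDiff ℝ ∞ Q)
    (h : ∀ y i, q (fun i => ((y i : ℝ) : Real.Angle)) i = ((Q y i : ℝ) : Real.Angle)) :
    SmoothT3 q := by
  intro x
  set y : V3 := fun i => (x i).toReal with hy
  have hx : x = fun i => ((y i : ℝ) : Real.Angle) := by
    funext i
    simp [hy]
  have h1 : ContDiffAt ℝ ∞ (fun v : V3 => fun a => Q (y + v) a - Q y a) 0 := by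
    have := hQ.contDiffAt (x := y + 0)
    have h2 : ContDiffAt ℝ ∞ (fun v : V3 => Q (y + v)) 0 := this.comp 0 (by fun_prop)
    exact h2.sub contDiffAt_const
  refine h1.congr_of_eventuallyEq ?_
  have h3 : ∀ a, ∀ᶠ v : V3 in nhds 0,
      ((Q (y + v) a - Q y a : ℝ) : Real.Angle).toReal = Q (y + v) a - Q y a := fun a =>
    eventually_toReal_coe_eq (contDiffAt_pi.1 h1 a).continuousAt (by simp)
  filter_upwards [Filter.eventually_all.2 h3] with v hv
  funext a
  rw [← hv a, Real.Angle.coe_sub, ← h y a, ← hx, ← h (y + v) a]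
  simp [hx]

theorem at_coe (y : V3) (t : ℝ) :
    at_ (fun i => ((y i : ℝ) : Real.Angle)) t = shift 0 (Sum.elim y fun _ => t) := by
  ext <;> simp [at_, shift]

theorem contDiff_sumElim (t : ℝ) :
    ContDiff ℝ ∞ (fun y : V3 => (Sum.elim y (fun _ => t) : Cover)) := by
  refine contDiff_pi.2 fun μ => ?_
  obtain i | ⟨⟩ := μ <;> simp only [Sum.elim_inl, Sum.elim_inr] <;> fun_prop

/-- Smooth solutions of the transport equations `∂ₜh + a · ∇h = 0`, `∂ₜχ + a · ∇χ = f`: follow the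
trajectories back to time `t₁`. They are described by their lifts `η`, `ξ` to the universal cover,
on which `(a, 1)` is the direction of motion. -/
theorem exists_transport {a : M → V3} {f : M → ℝ} (ha : SmoothFun a) (hf : SmoothFun f) {R : ℝ}
    (hR : ∀ x, R < |timeOf x| → a x = 0 ∧ f x = 0) (t₁ : ℝ) :
    ∃ (h : M → T3) (χ : M → ℝ) (η : Cover → V3) (ξ : Cover → ℝ),
      ContDiff ℝ ∞ η ∧ ContDiff ℝ ∞ ξ ∧
      (∀ v i, h (shift 0 v) i = ((η v i : ℝ) : Real.Angle)) ∧ (∀ v, χ (shift 0 v) = ξ v) ∧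
      (∀ v, fderiv ℝ η v (Sum.elim (a (shift 0 v)) 1) = 0) ∧
      (∀ v, fderiv ℝ ξ v (Sum.elim (a (shift 0 v)) 1) = f (shift 0 v)) ∧
      ∀ t, IsDiffeoT3 (fun x => h (at_ x t)) := by
  set Z : M → Cover × ℝ := fun x => (Sum.elim (a x) 1, f x) with hZdef
  have hZ : SmoothFun Z := fun x => by
    refine ContDiffAt.prodMk (contDiffAt_pi.2 fun μ => ?_) (hf x)
    obtain i | ⟨⟩ := μ
    · exact contDiffAt_pi.1 (ha x) i
    · exact contDiffAt_const
  obtain ⟨Ψ, hΨ, h0, hd, hadd, htime, hper⟩ := exists_cover_flow (R := R)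
    (c₀ := (Sum.elim 0 1, 0)) hZ (fun x hx => by simp [hZdef, hR x hx]) (fun x => rfl)
  -- `G z` is the point at time `t₁` on the trajectory through `z`.
  set G : Cover × ℝ → Cover × ℝ := fun z => Ψ (t₁ - z.1 (Sum.inr ())) z with hG
  have hGs : ContDiff ℝ ∞ G :=
    ContDiff.comp (g := fun q : ℝ × Cover × ℝ => Ψ q.1 q.2)
      (f := fun z : Cover × ℝ => (t₁ - z.1 (Sum.inr ()), z)) hΨ (by fun_prop)
  have hGper : ∀ z (w : Cover) (d : ℝ), shift (0 : M) w = 0 → G (z + (w, d)) = G z + (w, d) := by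
    intro z w d hw
    have hw0 : w (Sum.inr ()) = 0 := by
      have := congrFun (congrArg Prod.snd hw) ()
      simpa [shift] using this
    simp only [hG, Prod.fst_add, Pi.add_apply, hw0, add_zero]
    exact hper _ _ _ _ hw
  -- `G` is constant along trajectories.
  have hGinv : ∀ z, fderiv ℝ G z (Z (shift 0 z.1)) = 0 := by
    intro z
    have h1 : ∀ s, G (Ψ s z) = G z := fun s => by
      simp only [hG, htime, ← hadd]
      congr 1
      ring
    have h2 := (hGs.differentiable (by simp) (Ψ 0 z)).hasFDerivAt.comp_hasDerivAt 0 (hd 0 z)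
    have h3 : G ∘ (fun s => Ψ s z) = fun _ => G z := funext h1
    rw [h3] at h2
    have h4 := h2.unique (hasDerivAt_const 0 (G z))
    rwa [h0] at h4
  -- `G (v, c) = g v + (0, c)`: the spatial components of `g` are the labels, its last one is
  -- minus the source accumulated since time `t₁`.
  set g : Cover → Cover × ℝ := fun v => G (v, 0) with hg
  have hgs : ContDiff ℝ ∞ g := hGs.comp (f := fun v : Cover => (v, (0 : ℝ))) (by fun_prop)
  have hgper : ∀ v w, shift (0 : M) v = shift 0 w → g v = g w + (v - w, 0) := by
    intro v w hvw
    have hw : shift (0 : M) (v - w) = 0 := by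
      rw [sub_eq_add_neg, ← shift_shift, hvw, shift_shift, add_neg_cancel, shift_zero]
    rw [hg]
    simp only
    rw [← hGper _ _ _ hw]
    simp
  have hgd : ∀ v, fderiv ℝ g v (Z (shift 0 v)).1 = -(0, f (shift 0 v)) := by
    intro v
    have h1 : G = fun z => g z.1 + (0, z.2) := by
      funext z
      have := hGper (z.1, 0) 0 z.2 (shift_zero _)
      simpa using this
    have h2 : HasFDerivAt G (fderiv ℝ g v ∘L ContinuousLinearMap.fst ℝ Cover ℝ +
        ContinuousLinearMap.inr ℝ Cover ℝ ∘L ContinuousLinearMap.snd ℝ Cover ℝ) (v, 0) := by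
      rw [h1]
      exact HasFDerivAt.add (HasFDerivAt.comp (g := g) (v, (0 : ℝ))
          (hgs.differentiable (by simp) v).hasFDerivAt hasFDerivAt_fst)
        (HasFDerivAt.comp (g := fun c : ℝ => ((0 : Cover), c)) (v, (0 : ℝ))
          (hasFDerivAt_prodMk_right _ _) hasFDerivAt_snd)
    have h3 := hGinv (v, 0)
    rw [h2.fderiv] at h3
    simpa [hZdef, add_eq_zero_iff_eq_neg] using h3
  have hgη : ContDiff ℝ ∞ (fun v i => (g v).1 (Sum.inl i) : Cover → V3) :=
    contDiff_pi.2 fun i => contDiff_pi.1 (contDiff_fst.comp hgs) (Sum.inl i)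
  have hlift : ∀ v i, (((g (relCoord (shift (0 : M) v) 0)).1 (Sum.inl i) : ℝ) : Real.Angle) =
      (((g v).1 (Sum.inl i) : ℝ) : Real.Angle) := by
    intro v i
    have h1 : shift (0 : M) (relCoord (shift (0 : M) v) 0) = shift 0 v := shift_relCoord _ _
    rw [hgper _ _ h1]
    simp [relCoord, shift]
  have hgdiff : ∀ v, HasFDerivAt g (fderiv ℝ g v) v := fun v =>
    (hgs.differentiable (by simp) v).hasFDerivAt
  refine ⟨fun x i => (((g (relCoord x 0)).1 (Sum.inl i) : ℝ) : Real.Angle),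
    fun x => -(g (relCoord x 0)).2, fun v i => (g v).1 (Sum.inl i), fun v => -(g v).2,
    hgη, (contDiff_snd.comp hgs).neg, hlift, fun v => ?_, fun v => ?_, fun v => ?_, fun t => ?_⟩
  · have h1 : shift (0 : M) (relCoord (shift (0 : M) v) 0) = shift 0 v := shift_relCoord _ _
    change -(g (relCoord (shift (0 : M) v) 0)).2 = -(g v).2
    rw [hgper _ _ h1]
    simp
  · have h1 : HasFDerivAt (fun v i => (g v).1 (Sum.inl i) : Cover → V3)
        (ContinuousLinearMap.pi fun i : Fin 3 =>
          ContinuousLinearMap.proj (R := ℝ) (φ := fun _ : Fin 3 ⊕ Unit => ℝ) (Sum.inl i) ∘L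
            ContinuousLinearMap.fst ℝ Cover ℝ ∘L fderiv ℝ g v) v :=
      hasFDerivAt_pi.2 fun i =>
        (ContinuousLinearMap.proj (R := ℝ) (φ := fun _ : Fin 3 ⊕ Unit => ℝ) (Sum.inl i) ∘L
            ContinuousLinearMap.fst ℝ Cover ℝ).hasFDerivAt.comp v (hgdiff v)
    rw [h1.fderiv]
    funext i
    have := hgd v
    simp only [hZdef] at this
    simp [this]
  · have h1 : HasFDerivAt (fun v => -(g v).2)
        (-(ContinuousLinearMap.snd ℝ Cover ℝ ∘L fderiv ℝ g v)) v :=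
      ((ContinuousLinearMap.snd ℝ Cover ℝ).hasFDerivAt.comp v (hgdiff v)).neg
    rw [h1.fderiv]
    have := hgd v
    simp only [hZdef] at this
    simp [this]
  · -- The inverse follows the trajectories from time `t₁` to time `t`.
    set Q : V3 → V3 := fun y i => (g (Sum.elim y fun _ => t)).1 (Sum.inl i) with hQ
    set Q' : V3 → V3 := fun y i => (Ψ (t - t₁) (Sum.elim y (fun _ => t₁), 0)).1 (Sum.inl i)
      with hQ'
    have hQs : ContDiff ℝ ∞ Q := hgη.comp (contDiff_sumElim t)
    have hQs' : ContDiff ℝ ∞ Q' := by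
      have h1 : ContDiff ℝ ∞ (fun y : V3 => Ψ (t - t₁) (Sum.elim y (fun _ => t₁), 0)) :=
        ContDiff.comp (g := fun q : ℝ × Cover × ℝ => Ψ q.1 q.2)
          (f := fun y : V3 => (t - t₁, ((Sum.elim y (fun _ => t₁) : Cover), (0 : ℝ)))) hΨ
          (contDiff_const.prodMk ((contDiff_sumElim t₁).prodMk contDiff_const))
      exact contDiff_pi.2 fun i => contDiff_pi.1 (contDiff_fst.comp h1) (Sum.inl i)
    have hper' : ∀ y y' : V3, (∀ i, ((y i : ℝ) : Real.Angle) = y' i) →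
        ∀ i, ((Q' y i : ℝ) : Real.Angle) = Q' y' i := by
      intro y y' hyy i
      have hw : shift (0 : M) (Sum.elim (y - y') 0) = 0 := by
        ext <;> simp [shift, hyy]
      have h1 := hper (t - t₁) (Sum.elim y' (fun _ => t₁), 0) _ 0 hw
      have h2 : ((Sum.elim y' (fun _ => t₁), 0) + (Sum.elim (y - y') 0, 0) : Cover × ℝ) =
          (Sum.elim y (fun _ => t₁), 0) := by
        ext μ
        · obtain i | ⟨⟩ := μ <;> simp
        · simp
      rw [h2] at h1
      simp [hQ', h1, hyy]
    have hq : ∀ y i, (fun x i => (((g (relCoord (at_ x t) 0)).1 (Sum.inl i) : ℝ) : Real.Angle))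
        (fun i => ((y i : ℝ) : Real.Angle)) i = ((Q y i : ℝ) : Real.Angle) := fun y i => by
      simp only [at_coe, hlift, hQ]
    set q' : T3 → T3 := fun x i => ((Q' (fun i => (x i).toReal) i : ℝ) : Real.Angle)
    have hq' : ∀ y i, q' (fun i => ((y i : ℝ) : Real.Angle)) i = ((Q' y i : ℝ) : Real.Angle) :=
      fun y i => hper' _ _ (fun i => Real.Angle.coe_toReal _) i
    have hcoe : ∀ x : T3, ∃ y : V3, x = fun i => ((y i : ℝ) : Real.Angle) := fun x =>
      ⟨fun i => (x i).toReal, by simp⟩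
    have hQ'Q : ∀ y, Q' (Q y) = y := by
      intro y
      set z : Cover × ℝ := (Sum.elim y (fun _ => t), 0) with hz
      have h1 : G z = (Sum.elim (Q y) (fun _ => t₁), 0) + (0, (G z).2) := by
        ext μ
        · obtain i | ⟨⟩ := μ
          · simp [hQ, hg, hz]
          · simp [hG, htime]
        · simp
      have h2 := hper (t - t₁) (Sum.elim (Q y) (fun _ => t₁), 0) 0 (G z).2 (shift_zero _)
      rw [← h1] at h2
      have h3 : Ψ (t - t₁) (G z) = z := by
        simp only [hG, ← hadd, hz, Sum.elim_inr]
        rw [show t - t₁ + (t₁ - t) = 0 by ring, h0]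
      rw [h3] at h2
      funext i
      have h4 := congrFun (congrArg Prod.fst h2) (Sum.inl i)
      simpa [hz, hQ'] using h4.symm
    have hQQ' : ∀ y, Q (Q' y) = y := by
      intro y
      set z : Cover × ℝ := (Sum.elim y (fun _ => t₁), 0) with hz
      set d := (Ψ (t - t₁) z).2
      have h1 : Ψ (t - t₁) z = (Sum.elim (Q' y) (fun _ => t), 0) + (0, d) := by
        ext μ
        · obtain i | ⟨⟩ := μ
          · simp [hQ', hz]
          · simp [htime, hz]
        · simp [d]
      have h2 := hGper (Sum.elim (Q' y) (fun _ => t), 0) 0 d (shift_zero _)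
      rw [← h1] at h2
      have h3 : G (Ψ (t - t₁) z) = z := by
        simp only [hG, htime, ← hadd, hz, Sum.elim_inr]
        rw [show t₁ - (t₁ + (t - t₁)) + (t - t₁) = 0 by ring, h0]
      rw [h3] at h2
      funext i
      have h4 := congrFun (congrArg Prod.fst h2) (Sum.inl i)
      simpa [hz, hQ, hg] using h4.symm
    refine ⟨smoothT3_of_lift hQs hq, q', smoothT3_of_lift hQs' hq', fun x => ?_, fun x => ?_⟩
    · obtain ⟨y, rfl⟩ := hcoe x
      have e : (fun x i => (((g (relCoord (at_ x t) 0)).1 (Sum.inl i) : ℝ) : Real.Angle))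
        (fun i => ((y i : ℝ) : Real.Angle)) = fun i => ((Q y i : ℝ) : Real.Angle) :=
        funext (hq y)
      simp only at e ⊢
      rw [e]
      funext i
      rw [hq', hQ'Q]
    · obtain ⟨y, rfl⟩ := hcoe x
      have e : q' (fun i => ((y i : ℝ) : Real.Angle)) = fun i => ((Q' y i : ℝ) : Real.Angle) :=
        funext (hq' y)
      rw [e]
      funext i
      have := hq (Q' y) i
      rw [hQQ'] at this
      exact this

end Transport

/-! ### Critical paths from solutions of the LBEP equations -/

theorem EqNear.pderiv {τ ν : Type} [Fintype τ] [Fintype ν] [DecidableEq τ] [DecidableEq ν]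
    {f g : Mixed τ ν → ℝ} {x : Mixed τ ν} (h : EqNear f g x) (μ : τ ⊕ ν) :
    EqNear (pderiv μ f) (pderiv μ g) x := by
  filter_upwards [eventually_eventually_nhds.2 h] with v hv
  refine pderiv_congr ?_ μ
  have h1 : Filter.Tendsto (fun w : τ ⊕ ν → ℝ => v + w) (nhds 0) (nhds v) := by
    have : Continuous fun w : τ ⊕ ν → ℝ => v + w := by fun_prop
    simpa using this.tendsto 0
  filter_upwards [h1.eventually hv] with w hw
  simpa [shift_shift] using hw

/-- The LBEP equations at the times in `I` only involve the density near those times. -/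
theorem LBEP.congr {L : V3 → ℝ → V3 → ℝ} {I : Set ℝ} {u : M → V3} {ρ ρ' : M → ℝ}
    (h : LBEP L I u ρ) (hρ : ∀ x, timeOf x ∈ I → EqNear ρ' ρ x) : LBEP L I u ρ' := by
  unfold LBEP
  intro Lu Lρ Lw x hx
  obtain ⟨h1, h2⟩ := h x hx
  have e := hρ x hx
  have eg : ∀ i, EqNear (pderiv (ixSpace i) ρ') (pderiv (ixSpace i) ρ) x := fun i => e.pderiv _
  have hg : EqNear (grad ρ') (grad ρ) x := by
    filter_upwards [Filter.eventually_all.2 eg] with v hv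
    exact funext hv
  have hLw : ∀ i, EqNear (fun y => Lw y i) (fun y => dGrad L (u y) (ρ y) (grad ρ y) i) x := by
    intro i
    filter_upwards [e, hg] with v h1 h2
    simp only [Lw, h1, h2]
  have hdiv : EqNear (div Lw) (div fun y => dGrad L (u y) (ρ y) (grad ρ y)) x := by
    filter_upwards [Filter.eventually_all.2 fun i => (hLw i).pderiv (ixSpace i)] with v hv
    exact Finset.sum_congr rfl fun i _ => hv i
  constructor
  · rw [← h1]
    simp only [dt, div]
    congr 1
    · exact pderiv_congr e _
    · refine Finset.sum_congr rfl fun i _ => pderiv_congr ?_ _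
      filter_upwards [e] with v hv
      simp only [hv]
  · intro j
    have h2j := h2 j
    simp only [dt, divT] at h2j ⊢
    refine Eq.trans ?_ (h2j.trans ?_)
    · congr 1
      · refine pderiv_congr ?_ _
        filter_upwards [e, hg] with v h1 h2
        simp only [Lu, h1, h2]
      · refine Finset.sum_congr rfl fun i _ => pderiv_congr ?_ _
        filter_upwards [e, hg] with v h1 h2
        simp only [Lu, h1, h2]
    · refine Finset.sum_congr rfl fun i _ => pderiv_congr ?_ _
      filter_upwards [e, hg, hdiv] with v h1 h2 h3
      simp only [Lρ, h1, h2, h3]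
      simp only [Lw, h1, h2]

/-- A smooth function that is positive at the times in `[t₁, t₂]` can be modified at other times so
as to become positive everywhere. -/
theorem exists_pos_extension {ρ : M → ℝ} (hρ : SmoothFun ρ) {t₁ t₂ : ℝ} (h12 : t₁ < t₂)
    (hpos : ∀ x, timeOf x ∈ Icc t₁ t₂ → 0 < ρ x) :
    ∃ ρ' : M → ℝ, SmoothFun ρ' ∧ (∀ x, 0 < ρ' x) ∧
      ∀ x, timeOf x ∈ Icc t₁ t₂ → EqNear ρ' ρ x := by
  have hcont : Continuous fun q : ℝ × V3 => ρ (pt q) := continuous_iff_continuousAt.2 fun q =>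
    (SmoothAt.contDiffAt_pt (smoothAt_of_smoothFun hρ (pt q))).continuousAt
  obtain ⟨q₀, hq₀, hmin⟩ := (isCompact_Icc.prod isCompact_cell).exists_isMinOn
    (s := Icc t₁ t₂ ×ˢ cell) ⟨(t₁, 0), ⟨le_rfl, h12.le⟩, le_rfl, fun _ => Real.two_pi_pos.le⟩
    hcont.continuousOn
  set m : ℝ := ρ (pt q₀) / 2 with hm
  have hm0 : 0 < m := half_pos (hpos _ hq₀.1)
  have hlow : ∀ x, timeOf x ∈ Icc t₁ t₂ → m < ρ x := fun x hx => by
    obtain ⟨y, hy, hyx⟩ := exists_pt x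
    have h1 := hmin (show (timeOf x, y) ∈ Icc t₁ t₂ ×ˢ cell from ⟨hx, hy⟩)
    simp only [mem_ofPred_eq, hyx] at h1
    linarith
  -- `Θ` is smooth and positive, and equals the identity on `[m, ∞)`.
  set Θ : ℝ → ℝ := fun r => m / 2 + Real.smoothTransition (2 * r / m - 1) * (r - m / 2) with hΘ
  have hΘs : ContDiff ℝ ∞ Θ := by
    have h1 : ContDiff ℝ ∞ fun r : ℝ => Real.smoothTransition (2 * r / m - 1) :=
      Real.smoothTransition.contDiff.comp (by fun_prop)
    exact contDiff_const.add (h1.mul (by fun_prop))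
  have hΘpos : ∀ r, 0 < Θ r := fun r => by
    rcases le_total r (m / 2) with hr | hr
    · have h1 : 2 * r / m - 1 ≤ 0 := by
        rw [sub_nonpos, div_le_one hm0]
        linarith
      simp only [hΘ, Real.smoothTransition.zero_of_nonpos h1, zero_mul]
      linarith
    · have h1 := mul_nonneg (Real.smoothTransition.nonneg (2 * r / m - 1)) (sub_nonneg.2 hr)
      simp only [hΘ]
      linarith
  have hΘid : ∀ r, m < r → Θ r = r := fun r hr => by
    have h1 : 1 ≤ 2 * r / m - 1 := by
      rw [le_sub_iff_add_le, le_div_iff₀ hm0]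
      linarith
    simp only [hΘ, Real.smoothTransition.one_of_one_le h1]
    ring
  refine ⟨fun x => Θ (ρ x), fun x => hΘs.contDiffAt.comp _ (hρ x), fun x => hΘpos _,
    fun x hx => ?_⟩
  filter_upwards [(smoothAt_of_smoothFun hρ x).eventually_mem isOpen_Ioi (hlow x hx)] with v hv
  exact hΘid _ hv

/-- A smooth function of time that is `1` on `[t₁, t₂]` and vanishes for large times. -/
theorem exists_time_cutoff (t₁ t₂ : ℝ) : ∃ (b : ℝ → ℝ) (R : ℝ), ContDiff ℝ ∞ b ∧
    (∀ t ∈ Icc t₁ t₂, b t = 1) ∧ ∀ t, R < |t| → b t = 0 := by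
  set R : ℝ := max |t₁| |t₂| + 1
  have hR : 0 < R := by positivity
  let b : ContDiffBump (0 : ℝ) := ⟨R, R + 1, hR, by linarith⟩
  refine ⟨b, R + 1, b.contDiff, fun t ht => b.one_of_mem_closedBall ?_,
    fun t ht => b.zero_of_le_dist ?_⟩
  · rw [mem_closedBall_zero_iff, Real.norm_eq_abs]
    exact (abs_le_max_abs_abs ht.1 ht.2).trans (by simp [b, R])
  · rw [dist_zero_right, Real.norm_eq_abs]
    exact ht.le

/-- The field with components `h`, `p`, `ρ`, `χ`. -/
def mkField (h : M → T3) (p : M → V3) (ρ χ : M → ℝ) : M → F :=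
  fun x => (h x, Sum.elim (p x) (Sum.elim (fun _ => ρ x) fun _ => χ x))

section MkField

variable {h : M → T3} {p : M → V3} {ρ χ : M → ℝ} {η : Cover → V3}

/-- The universal cover maps onto `M`. -/
theorem exists_cover (x : M) : ∃ v : Cover, shift (0 : M) v = x := ⟨_, shift_relCoord 0 x⟩

/-- Near a point the angle coordinates of `h` are the increments of its lift `η`. -/
theorem eventually_relCoord_eq (hη : ContDiff ℝ ∞ η)
    (hh : ∀ v i, h (shift 0 v) i = ((η v i : ℝ) : Real.Angle)) (v₀ : Cover) (i : Fin 3) :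
    ∀ᶠ v : Cover in nhds 0, relCoord (mkField h p ρ χ (shift (shift 0 v₀) v))
      (mkField h p ρ χ (shift 0 v₀)) (ixH i) = η (v₀ + v) i - η v₀ i := by
  have h1 : Continuous fun v : Cover => η (v₀ + v) i - η v₀ i := by
    have := hη.continuous
    fun_prop
  filter_upwards [eventually_toReal_coe_eq h1.continuousAt (by simp)] with v hv
  simp only [relCoord, mkField, Sum.elim_inl, shift_shift, hh, ← Real.Angle.coe_sub, hv]

theorem smoothField_mkField (hη : ContDiff ℝ ∞ η)
    (hh : ∀ v i, h (shift 0 v) i = ((η v i : ℝ) : Real.Angle)) (hp : SmoothFun p)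
    (hρ : SmoothFun ρ) (hχ : SmoothFun χ) : SmoothField (mkField h p ρ χ) := by
  intro x
  obtain ⟨v₀, rfl⟩ := exists_cover x
  refine contDiffAt_pi.2 fun a => ?_
  obtain i | j | ⟨⟩ | ⟨⟩ := a
  · have h1 : ContDiff ℝ ∞ fun v : Cover => η (v₀ + v) i - η v₀ i := by fun_prop
    exact h1.contDiffAt.congr_of_eventuallyEq (eventually_relCoord_eq hη hh v₀ i)
  · exact (contDiffAt_pi.1 (hp _) j).sub contDiffAt_const
  · exact (hρ _).sub contDiffAt_const
  · exact (hχ _).sub contDiffAt_const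

theorem jet_mkField_h (hη : ContDiff ℝ ∞ η)
    (hh : ∀ v i, h (shift 0 v) i = ((η v i : ℝ) : Real.Angle)) (v₀ : Cover) (i : Fin 3)
    (μ : Fin 3 ⊕ Unit) :
    jet (mkField h p ρ χ) (shift 0 v₀) (ixH i) μ = fderiv ℝ η v₀ (Pi.single μ 1) i := by
  have hc : ContinuousAt (fun s : ℝ => (Pi.single μ s : Cover)) 0 :=
    (hasDerivAt_single μ (0 : ℝ)).continuousAt
  have h1 : (fun s : ℝ => relCoord (mkField h p ρ χ (shift (shift 0 v₀) (Pi.single μ s)))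
      (mkField h p ρ χ (shift 0 v₀)) (ixH i)) =ᶠ[nhds 0]
      fun s => η (v₀ + Pi.single μ s) i - η v₀ i := by
    have h0 := eventually_relCoord_eq (p := p) (ρ := ρ) (χ := χ) hη hh v₀ i
    rw [← Pi.single_zero (M := fun _ : Fin 3 ⊕ Unit => ℝ) μ] at h0
    exact hc.eventually h0
  have h2 : HasDerivAt (fun s : ℝ => v₀ + Pi.single μ s) (Pi.single μ (1 : ℝ)) 0 :=
    (hasDerivAt_single μ (0 : ℝ)).const_add v₀
  have h3 := (hη.differentiable (by simp) v₀).hasFDerivAt.comp_hasDerivAt_of_eq (0 : ℝ) h2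
    (by simp)
  have h4 := (hasDerivAt_pi.1 h3 i).sub_const (η v₀ i)
  simp only [jet, Matrix.of_apply]
  rw [h1.deriv_eq]
  exact h4.deriv

end MkField

theorem pderiv_eq_fderiv_cover {f : M → ℝ} {ξ : Cover → ℝ} (hξ : ContDiff ℝ ∞ ξ)
    (h : ∀ v, f (shift 0 v) = ξ v) (v₀ : Cover) (μ : Fin 3 ⊕ Unit) :
    pderiv μ f (shift 0 v₀) = fderiv ℝ ξ v₀ (Pi.single μ 1) := by
  have e : (fun w : Cover => f (shift 0 w)) = ξ := funext h
  have := pderiv_shift_of_differentiableAt (f := f) (x := (0 : M)) (v := v₀)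
    (by rw [e]; exact hξ.differentiable (by simp) v₀) μ
  rw [e] at this
  exact this.deriv

theorem smoothFun_of_cover {f : M → ℝ} {ξ : Cover → ℝ} (hξ : ContDiff ℝ ∞ ξ)
    (h : ∀ v, f (shift 0 v) = ξ v) : SmoothFun f := fun x => by
  obtain ⟨v₀, rfl⟩ := exists_cover x
  simp only [shift_shift, h]
  have : ContDiff ℝ ∞ fun v : Cover => ξ (v₀ + v) := by fun_prop
  exact this.contDiffAt

theorem map_sumElim_one {E : Type} [NormedAddCommGroup E] [NormedSpace ℝ E] (A : Cover →L[ℝ] E)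
    (a : V3) : A (Sum.elim a 1) = A (Pi.single ixTime 1) +
      ∑ i, a i • A (Pi.single (ixSpace i) 1) := by
  have h : (Sum.elim a 1 : Cover) =
      Pi.single ixTime 1 + ∑ i, a i • (Pi.single (ixSpace i) 1 : Cover) := by
    funext μ
    obtain i | ⟨⟩ := μ <;> simp [ixTime, ixSpace, Finset.sum_apply, Pi.single_apply]
  rw [h, map_add, map_sum]
  simp only [map_smul]

section Lift

variable {P : Set ℝ} {L : V3 → ℝ → V3 → ℝ} {u : M → V3} {ρ : M → ℝ}

/-- The Legendre transform turns the LBEP equations into their momentum form. -/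
theorem LBEP.momentumLBEP (hP : IsOpen P) (hL : IsEPDensity P L) {I : Set ℝ} (hu : SmoothFun u)
    (hρ : SmoothFun ρ) (hρP : ∀ x, ρ x ∈ P) (h : LBEP L I u ρ) :
    MomentumLBEP (hamiltonian L) I (fun y => dVec L (u y) (ρ y) (grad ρ y)) ρ := by
  have hv : ∀ y, legendreVelocity L (dVec L (u y) (ρ y) (grad ρ y)) (ρ y) (grad ρ y) = u y :=
    fun y => hL.legendreVelocity_dVec (hρP y) _ _
  have hLs := hL.smoothDensity hP
  unfold MomentumLBEP
  intro Hp Hρ Hw x hx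
  obtain ⟨h1, h2⟩ := h x hx
  have eHp : Hp = u := funext fun y => (hL.dVec_hamiltonian hP (hρP y) _ _).trans (hv y)
  have eHρ : Hρ = fun y => -dRho L (u y) (ρ y) (grad ρ y) := funext fun y => by
    simp only [Hρ, hL.dRho_hamiltonian hP (hρP y), hv]
  have eHw : Hw = fun y => -dGrad L (u y) (ρ y) (grad ρ y) := funext fun y => by
    simp only [Hw, hL.dGrad_hamiltonian hP (hρP y), hv]
  have hus : SmoothAt u x := hu x
  have hρs : SmoothAt ρ x := hρ x
  have hws : SmoothAt (grad ρ) x := smoothAt_pi.2 fun i => hρs.smoothAt_pderiv _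
  have hLw : ∀ i, SmoothAt (fun y => dGrad L (u y) (ρ y) (grad ρ y) i) x := fun i =>
    (hLs.dGrad i).smoothAt hus hρs hws (hρP x)
  have hLu : ∀ i, SmoothAt (fun y => dVec L (u y) (ρ y) (grad ρ y) i) x := fun i =>
    (hLs.dVec i).smoothAt hus hρs hws (hρP x)
  have hdiv : SmoothAt (div fun y => dGrad L (u y) (ρ y) (grad ρ y)) x :=
    SmoothAt.sum fun i _ => (hLw i).smoothAt_pderiv _
  -- Since `p · u - H = L`, this is minus the bracket in the momentum form.
  set π : M → ℝ := fun y => ρ y * dRho L (u y) (ρ y) (grad ρ y) -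
    ρ y * div (fun y => dGrad L (u y) (ρ y) (grad ρ y)) y - L (u y) (ρ y) (grad ρ y) with hπ
  have hπs : SmoothAt π x := ((hρs.mul (hLs.dRho.smoothAt hus hρs hws (hρP x))).sub
    (hρs.mul hdiv)).sub (hLs.smoothAt hus hρs hws (hρP x))
  rw [eHp, eHρ, eHw]
  refine ⟨h1, fun j => ?_⟩
  have e1 : (fun y => ρ y * -dRho L (u y) (ρ y) (grad ρ y) -
      ρ y * div (fun y => -dGrad L (u y) (ρ y) (grad ρ y)) y +
      dVec L (u y) (ρ y) (grad ρ y) ⬝ᵥ u y -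
      hamiltonian L (dVec L (u y) (ρ y) (grad ρ y)) (ρ y) (grad ρ y)) = fun y => -π y := by
    funext y
    have e2 : div (fun y => -dGrad L (u y) (ρ y) (grad ρ y)) y =
        -div (fun y => dGrad L (u y) (ρ y) (grad ρ y)) y := by
      simp only [div, Pi.neg_apply, pderiv_neg, Finset.sum_neg_distrib]
    simp only [e2, hamiltonian, hv, hπ]
    rw [dotProduct_comm (u y)]
    ring
  rw [e1]
  have h2j := h2 j
  have e3 : ∀ i, SmoothAt (fun y => Matrix.vecMulVec (u y) (dVec L (u y) (ρ y) (grad ρ y)) i j) x :=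
    fun i => (smoothAt_pi.1 hus i).mul (hLu j)
  have e4 : ∀ i, SmoothAt (fun y =>
      Matrix.vecMulVec (dGrad L (u y) (ρ y) (grad ρ y)) (grad ρ y) i j) x :=
    fun i => (hLw i).mul (smoothAt_pi.1 hws j)
  have e5 : ∀ i, SmoothAt (fun y => (π y • (1 : Matrix (Fin 3) (Fin 3) ℝ)) i j) x :=
    fun i => hπs.mul (smoothAt_const _ x)
  have e6 : ∑ i, pderiv (ixSpace i) (fun y => (π y • (1 : Matrix (Fin 3) (Fin 3) ℝ)) i j) x =
      pderiv (ixSpace j) π x := by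
    rw [Finset.sum_eq_single j]
    · simp
    · intro i _ hij
      simp [Matrix.one_apply_ne hij, pderiv_const]
    · simp
  have e7 : divT (fun y => Matrix.vecMulVec (u y) (dVec L (u y) (ρ y) (grad ρ y)) +
      Matrix.vecMulVec (-dGrad L (u y) (ρ y) (grad ρ y)) (grad ρ y)) x j =
      divT (fun y => Matrix.vecMulVec (u y) (dVec L (u y) (ρ y) (grad ρ y))) x j -
      divT (fun y => Matrix.vecMulVec (dGrad L (u y) (ρ y) (grad ρ y)) (grad ρ y)) x j := by
    simp only [divT, Matrix.neg_vecMulVec, ← sub_eq_add_neg, Matrix.sub_apply]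
    rw [← Finset.sum_sub_distrib]
    exact Finset.sum_congr rfl fun i _ => (e3 i).pderiv_sub (e4 i) _
  have e8 : divT (fun y => π y • (1 : Matrix (Fin 3) (Fin 3) ℝ) +
      Matrix.vecMulVec (dGrad L (u y) (ρ y) (grad ρ y)) (grad ρ y)) x j =
      pderiv (ixSpace j) π x +
      divT (fun y => Matrix.vecMulVec (dGrad L (u y) (ρ y) (grad ρ y)) (grad ρ y)) x j := by
    rw [← e6]
    simp only [divT, Matrix.add_apply]
    rw [← Finset.sum_add_distrib]
    exact Finset.sum_congr rfl fun i _ => (e5 i).pderiv_add (e4 i) _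
  rw [e7]
  simp only [grad, pderiv_neg]
  have h2' := h2j.trans e8
  linarith

/-- Every solution of the LBEP equations comes from a critical path: `p = ∂L/∂u`, and `h` and `χ`
are obtained by transport along the trajectories of `u`. -/
theorem exists_critical_of_LBEP (hP : IsOpen P) (hpos : Ioi 0 ⊆ P) (hL : IsEPDensity P L)
    {t₁ t₂ : ℝ} (h12 : t₁ < t₂) (hu : SmoothFun u) (hρ : SmoothFun ρ)
    (hρ0 : ∀ x, timeOf x ∈ Icc t₁ t₂ → 0 < ρ x) (hLB : LBEP L (Icc t₁ t₂) u ρ) :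
    ∃ Φ : M → F, IsPath t₁ t₂ Φ ∧ IsCritical (hamiltonian L) t₁ t₂ Φ ∧
      ∀ x, timeOf x ∈ Icc t₁ t₂ → rhoOf (Φ x) = ρ x ∧
        dVec L (u x) (ρ x) (grad ρ x) = pOf (Φ x) := by
  obtain ⟨ρ', hρ', hpos', hnear⟩ := exists_pos_extension hρ h12 hρ0
  have hLs := hL.smoothDensity hP
  have hHs := hL.smoothDensity_hamiltonian hP
  have hρP : ∀ x, ρ' x ∈ P := fun x => hpos (hpos' x)
  have hw : SmoothFun (grad ρ') := fun x =>
    contDiffAt_pi.2 fun i => SmoothAt.smoothAt_pderiv (hρ' x) (ixSpace i)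
  set p : M → V3 := fun y => dVec L (u y) (ρ' y) (grad ρ' y) with hp
  have hps : SmoothFun p := fun x =>
    contDiffAt_pi.2 fun i => (hLs.dVec i).smoothAt (hu x) (hρ' x) (hw x) (hρP x)
  set S : M → ℝ := fun y => dRho (hamiltonian L) (p y) (ρ' y) (grad ρ' y) -
    div (fun y => dGrad (hamiltonian L) (p y) (ρ' y) (grad ρ' y)) y with hS
  have hSs : SmoothFun S := fun x =>
    SmoothAt.sub (hHs.dRho.smoothAt (hps x) (hρ' x) (hw x) (hρP x))
      (SmoothAt.sum fun i _ =>
        SmoothAt.smoothAt_pderiv ((hHs.dGrad i).smoothAt (hps x) (hρ' x) (hw x) (hρP x)) _)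
  obtain ⟨b, R, hb, hb1, hbR⟩ := exists_time_cutoff t₁ t₂
  obtain ⟨h, χ, η, ξ, hη, hξ, hhη, hχξ, hηd, hξd, hdiff⟩ := exists_transport
    (a := fun x => b (timeOf x) • u x) (f := fun x => b (timeOf x) * S x) (R := R)
    (fun x => (smoothAt_comp_timeOf hb x).smul (hu x))
    (fun x => (smoothAt_comp_timeOf hb x).mul (hSs x)) (fun x hx => by simp [hbR _ hx]) t₁
  have hχs : SmoothFun χ := smoothFun_of_cover hξ hχξ
  have hpath : IsPath t₁ t₂ (mkField h p ρ' χ) :=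
    ⟨smoothField_mkField hη hhη hps hρ' hχs, fun t _ => hdiff t, fun t _ x => hpos' _⟩
  have hvel : ∀ y, dVec (hamiltonian L) (p y) (ρ' y) (grad ρ' y) = u y := fun y => by
    rw [hL.dVec_hamiltonian hP (hρP y)]
    exact hL.legendreVelocity_dVec (hρP y) _ _
  have hext : ExtendedSystem (hamiltonian L) (Icc t₁ t₂) (mkField h p ρ' χ) := by
    refine ⟨fun x hx => ?_, (hLB.congr hnear).momentumLBEP hP hL hu hρ' hρP, fun x hx => ?_⟩
    · obtain ⟨v, rfl⟩ := exists_cover x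
      have h1 := hηd v
      rw [map_sumElim_one, hb1 _ hx, one_smul] at h1
      funext i
      have h2 := congrFun h1 i
      simp only [Pi.add_apply, Finset.sum_apply, Pi.smul_apply, smul_eq_mul, Pi.zero_apply] at h2
      change jet _ _ _ _ = -∑ j, dVec (hamiltonian L) (p _) (ρ' _) (grad ρ' _) j * jet _ _ _ _
      simp only [hvel, jet_mkField_h hη hhη]
      linarith
    · obtain ⟨v, rfl⟩ := exists_cover x
      have h1 := hξd v
      rw [map_sumElim_one, hb1 _ hx, one_smul, one_mul] at h1
      change pderiv _ χ _ + ∑ j, dVec (hamiltonian L) (p _) (ρ' _) (grad ρ' _) j *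
        pderiv _ χ _ = S _
      simpa only [hvel, pderiv_eq_fderiv_cover hξ hχξ, smul_eq_mul] using h1
  refine ⟨mkField h p ρ' χ, hpath, (isCritical_iff_extendedSystem hHs hpos h12 hpath).2 hext,
    fun x hx => ⟨(hnear x hx).eq, ?_⟩⟩
  have hg : grad ρ' x = grad ρ x := funext fun i => pderiv_congr (hnear x hx) _
  change _ = p x
  rw [hp]
  simp only [hg, (hnear x hx).eq]

end Lift

end EulerPoincare

theorem mainTheorem2
    (P : Set ℝ) (hP : IsOpen P) (hpos : Set.Ioi (0 : ℝ) ⊆ P)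
    (L : EulerPoincare.V3 → ℝ → EulerPoincare.V3 → ℝ)
    (hL : EulerPoincare.IsEPDensity P L) :
    (∀ t₁ t₂ : ℝ, t₁ < t₂ →
      (∀ Φ : EulerPoincare.M → EulerPoincare.F, EulerPoincare.IsPath t₁ t₂ Φ →
        (EulerPoincare.IsCritical (EulerPoincare.hamiltonian L) t₁ t₂ Φ ↔
          EulerPoincare.ExtendedSystem (EulerPoincare.hamiltonian L) (Set.Icc t₁ t₂) Φ)) ∧
      (∀ (u : EulerPoincare.M → EulerPoincare.V3) (ρ : EulerPoincare.M → ℝ),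
        EulerPoincare.SmoothFun u → EulerPoincare.SmoothFun ρ →
        (∀ x, EulerPoincare.timeOf x ∈ Set.Icc t₁ t₂ → 0 < ρ x) →
        EulerPoincare.LBEP L (Set.Icc t₁ t₂) u ρ →
        ∃ Φ : EulerPoincare.M → EulerPoincare.F,
          EulerPoincare.IsPath t₁ t₂ Φ ∧
          EulerPoincare.IsCritical (EulerPoincare.hamiltonian L) t₁ t₂ Φ ∧
          ∀ x, EulerPoincare.timeOf x ∈ Set.Icc t₁ t₂ →
            EulerPoincare.rhoOf (Φ x) = ρ x ∧
            EulerPoincare.dVec L (u x) (ρ x) (EulerPoincare.grad ρ x) =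
              EulerPoincare.pOf (Φ x))) ∧
    (EulerPoincare.epTheory (EulerPoincare.hamiltonian L)).IsOrdinary ∧
    (∀ φ ∈ (EulerPoincare.epTheory (EulerPoincare.hamiltonian L)).fields,
      (∀ x, (EulerPoincare.gradH (EulerPoincare.jet φ x)).det ≠ 0) →
      (∀ x, EulerPoincare.rhoOf (φ x) ∈ P) →
      ((EulerPoincare.epTheory (EulerPoincare.hamiltonian L)).EulerLagrange φ ↔
        EulerPoincare.ExtendedSystem (EulerPoincare.hamiltonian L) Set.univ φ)) := by
  have hH := hL.smoothDensity_hamiltonian hP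
  refine ⟨fun t₁ t₂ h12 => ⟨fun Φ hΦ => ?_, fun u ρ hu hρ hρ0 h => ?_⟩, fun φ hφ _ => hφ,
    fun φ hφ hdet hρ => ?_⟩
  · exact EulerPoincare.isCritical_iff_extendedSystem hH hpos h12 hΦ
  · exact EulerPoincare.exists_critical_of_LBEP hP hpos hL h12 hu hρ hρ0 h
  · exact EulerPoincare.eulerLagrange_iff_extendedSystem hH hφ hdet hρ
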